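/- Let $3/2<n<3$ and put $$\nu=\frac3n,\qquad A=\nu(\nu-1)(2-\nu)>0,\qquad \beta=\frac{\sqrt{-3\nu^2+12\nu-8}-3\nu+4}{2}\in(0,1),\qquad \gamma=2(1+\nu).$$ There exist $\varepsilon\in(0,1)$, a function $\bar u$ that is real-analytic on (a neighbourhood of) the box $[0,\varepsilon^2]\times[0,\varepsilon]\times[0,\varepsilon^2]$ with $$\bar u(0,0,0)=0,\qquad \partial_2\bar u(0,0,0)<0,$$ and, for every $\mu>0$, a number $b(\mu)>0$ and a function $H_\mu\in C^1([0,1])\cap C^3((0,1])$ with $H_\mu>0$ on $(0,1]$, such that the following hold ($\varepsilon$ and $\bar u$ do not depend on $\mu$). (i) For every $\mu>0$ the function $H=H_\mu$ solves $$H^{n-1}H'''=-1+x+\mu H^{n+1}H'\quad\text{for }x\in(0,1],\qquad H(0)=H'(0)=0,\qquad H'(1)=0,$$ where derivatives at the endpoints $0$ and $1$ are one-sided, and $$H_\mu(x)=A^{-\nu/3}x^\nu\Bigl(1+\bar u\bigl(x,\,b(\mu)x^\beta,\,\mu x^\gamma\bigr)\Bigr)\quad\text{for } 0\le x\le\min\Bigl\{\varepsilon^2,\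 \Bigl(\frac{\varepsilon}{b(\mu)}\Bigr)^{1/\beta},\ \Bigl(\frac{\varepsilon^2}{\mu}\Bigr)^{1/\gamma}\Bigr\}.$$ (ii) For every mass $M>0$ there exists $\bar\mu>0$ such that $H_{\bar\mu}$ also satisfies the mass constraint $$\int_0^1H_{\bar\mu}(x)\,dx=\frac12\kappa(\bar\mu),\qquad \kappa(\mu):=\frac{\sqrt{n+3}}{\sqrt{\mu}}\,M.$$ -/

import Mathlib

open Set

namespace ThinFilm

noncomputable section

/-- The exponent `ν = 3 / n` of the travelling wave. -/
def nu (n : ℝ) : ℝ := 3 / n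

/-- The constant `A = ν (ν - 1) (2 - ν)`. -/
def coeffA (n : ℝ) : ℝ := nu n * (nu n - 1) * (2 - nu n)

/-- The exponent `β = (√(-3ν² + 12ν - 8) - 3ν + 4) / 2`. -/
def beta (n : ℝ) : ℝ :=
  (Real.sqrt (-3 * nu n ^ 2 + 12 * nu n - 8) - 3 * nu n + 4) / 2

/-- The exponent `γ = 2 (1 + ν)`. -/
def gamma (n : ℝ) : ℝ := 2 * (1 + nu n)

/-- The rescaled mass `κ(μ) = √(n + 3) / √μ * M`, where `M` is the mass of the droplet. -/
def kappa (n M μ : ℝ) : ℝ := Real.sqrt (n + 3) / Real.sqrt μ * M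

/-- The closed box `[0, ε²] × [0, ε] × [0, ε²]`. -/
def box (ε : ℝ) : Set (ℝ × ℝ × ℝ) := Icc 0 (ε ^ 2) ×ˢ Icc 0 ε ×ˢ Icc 0 (ε ^ 2)

/-- `H` is a classical positive solution on `[0, 1]` of
`H ^ (n - 1) * H''' = -1 + x + μ * H ^ (n + 1) * H'` for `x ∈ (0, 1]`,
`H(0) = H'(0) = 0` and `H'(1) = 0`. Only the values of `H` on `[0, 1]` matter: derivatives at
the endpoints `0` and `1` are one-sided. -/
structure IsProfile (n μ : ℝ) (H : ℝ → ℝ) : Prop where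
  contDiffOn_one : ContDiffOn ℝ 1 H (Icc 0 1)
  contDiffOn_three : ContDiffOn ℝ 3 H (Ioc 0 1)
  pos : ∀ x ∈ Ioc (0 : ℝ) 1, 0 < H x
  ode : ∀ x ∈ Ioc (0 : ℝ) 1,
    H x ^ (n - 1) * iteratedDerivWithin 3 H (Ioc 0 1) x =
      -1 + x + μ * H x ^ (n + 1) * derivWithin H (Icc 0 1) x
  value_zero : H 0 = 0
  deriv_zero : derivWithin H (Icc 0 1) 0 = 0
  deriv_one : derivWithin H (Icc 0 1) 1 = 0

end

end ThinFilm

/-!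
The free boundary problem is solved by shooting from the contact line `x = 0`.

In terms of `G = H'` and the flux variable `Q = H'' - μ H ^ 3 / 3` the equation is the system
`H' = G`, `G' = Q + μ H ^ 3 / 3`, `Q' = (x - 1) H ^ (1 - n)`. Near `x = 0` its solutions with
`H(0) = H'(0) = 0` form a one-parameter family
`H = c x ^ ν (1 - b x ^ β + ...)`, where `c = A ^ (-ν / 3)`, and where `ν + β` is the indicial root
larger than `2` of the linearisation at `c x ^ ν`. To construct this family, a solution on `[0, x₁]`
is rescaled to `[0, 1]` and the remainder beyond `- b x ^ β` is expressed through the (weighted)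
second derivative `f` of the remainder, a continuous function on `[0, 1]`. Integrating the equation
turns it into a fixed point equation for `f` that is analytic in `f` and in the three parameters
`(x₁, b x₁ ^ β, μ x₁ ^ γ)`. Its linearisation is a multiple of a product of averaging operators,
and a contraction because the weight of the remainder exceeds `β` (`WaveExponents.norm_M_lt_one`). The
analytic implicit function theorem then gives an analytic family of remainders
(`WaveExponents.exists_remainder`), and evaluating them at `t = 1` gives the analytic function `u`.
Uniqueness of the fixed point makes the family covariant under dilations
(`WaveExponents.exists_family`), so that for fixed `b` and `μ` the functions obtained for different
`x₁` are restrictions of a single solution (`WaveExponents.exists_localFamily`).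

The global part rests on a comparison principle (`IsTraj.comparison`): the flux is singular at the
contact line, but its singular part is the same for all solutions because `ν + β > 2`, so the
differences of `H`, `G`, `Q` tend to `0` there, and a film that is higher near `0` stays higher and
steeper. Hence the slope at `x = 1` is strictly decreasing in `b`. It is positive for `b = 0`, since
that film lies above `c x ^ ν` (`Shooting.slope_zero_pos`), and negative for a large `b` that can be
chosen uniformly for `μ` in a bounded range (`Shooting.slope_max_neg`): there the flux deficit is of
order `x₀ ^ (ν - 2)` at the point `x₀` where the local family is left, and `ν < 2`. In between
there is exactly one `b(μ)` with `H'(1) = 0`. Films that stop increasing before `1` have negative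
slope at `1` (`IsTraj.neg_of_nonpos`), so the film found is increasing; this, together with the
convexity estimate `IsTraj.slope_le`, gives bounds from above and below that make the truncations
used for the shooting harmless (`Shooting.isFilm`).

Since `b(μ)` is the zero of a continuous, strictly monotone function, the mass is continuous in `μ`
(`ContactData.exists_films`). The product `√μ ∫ H_μ` tends to `0` with `μ`, the films being
bounded, and is unbounded for large `μ`, because a film that is too thin has too large a mobility
`H ^ (1 - n)` to remain thin (`IsFilm.lt_half_height`). The intermediate value theorem yields every
mass (`ContactData.exists_mass_eq`); uniqueness of the film (`ContactData.film_unique`) identifies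
the films obtained for different ranges of `μ`. Unique continuation of trajectories
(`IsTraj.unique`) extends the local expansion to the whole range in which its parameters lie in the
box (`ContactData.film_eq_along`).
-/

open Filter Topology unitInterval

namespace ThinFilm

noncomputable section

/-! ### Power functions, dilations and averaging operators on `C([0, 1])` -/

/-- The power function `t ↦ t ^ e` on `[0, 1]`, for `e ≥ 0` (negative exponents are replaced
by `0`). -/
def tpow (e : ℝ) : C(I, ℝ) :=
  ⟨fun t => (t : ℝ) ^ max e 0,
    (Real.continuous_rpow_const (le_max_right e 0)).comp continuous_subtype_val⟩

lemma tpow_apply {e : ℝ} (he : 0 ≤ e) (t : I) : tpow e t = (t : ℝ) ^ e := by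
  simp [tpow, max_eq_left he]

/-- The dilation `(dil τ f)(t) = f (τ t)` of a function on `[0, 1]`. -/
def dil (τ : I) (f : C(I, ℝ)) : C(I, ℝ) := ⟨fun t => f (τ * t), by fun_prop⟩

@[simp] lemma dil_apply (τ : I) (f : C(I, ℝ)) (t : I) : dil τ f t = f (τ * t) := rfl

lemma norm_dil_le (τ : I) (f : C(I, ℝ)) : ‖dil τ f‖ ≤ ‖f‖ :=
  (ContinuousMap.norm_le _ (norm_nonneg f)).2 fun _ => f.norm_coe_le_norm _

/-- The constant extension of a function on `[0, 1]` to the real line. -/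
def ext (f : C(I, ℝ)) : ℝ → ℝ := IccExtend (zero_le_one' ℝ) f

lemma continuous_ext (f : C(I, ℝ)) : Continuous (ext f) := f.continuous.Icc_extend'

lemma ext_of_mem (f : C(I, ℝ)) {t : ℝ} (ht : t ∈ I) : ext f t = f ⟨t, ht⟩ :=
  IccExtend_of_mem _ _ ht

lemma abs_ext_le (f : C(I, ℝ)) (t : ℝ) : |ext f t| ≤ ‖f‖ := f.norm_coe_le_norm _

lemma intervalIntegrable_avg {a : ℝ} (ha : 0 < a) (f : C(I, ℝ)) (t : ℝ) (p q : ℝ) :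
    IntervalIntegrable (fun r : ℝ => r ^ (a - 1) * ext f (r * t)) MeasureTheory.volume p q :=
  (intervalIntegral.intervalIntegrable_rpow' (by linarith)).mul_continuousOn
    ((continuous_ext f).comp (continuous_id.mul continuous_const)).continuousOn

lemma integral_rpow_unit {a : ℝ} (ha : 0 < a) : ∫ r in (0 : ℝ)..1, r ^ (a - 1) = a⁻¹ := by
  rw [integral_rpow (Or.inl (by linarith))]
  simp [ha.ne']

/-- The averaging operator `(avg f)(t) = ∫₀¹ r ^ (a - 1) f (r t) dr` for `a > 0`: the inverse of
`a + t d/dt` on bounded functions. -/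
def avg (a : ℝ) (ha : 0 < a) : C(I, ℝ) →L[ℝ] C(I, ℝ) :=
  LinearMap.mkContinuous
    { toFun := fun f =>
        ⟨fun t => ∫ r in (0 : ℝ)..1, r ^ (a - 1) * ext f (r * t), by
          refine intervalIntegral.continuous_of_dominated_interval
            (bound := fun r => r ^ (a - 1) * ‖f‖) (fun t => ?_) (fun _ => ?_) ?_ ?_
          · exact (intervalIntegrable_avg ha f t 0 1).aestronglyMeasurable_restrict_uIoc
          · refine Eventually.of_forall fun r hr => ?_
            rw [uIoc_of_le zero_le_one] at hr
            rw [norm_mul, Real.norm_of_nonneg (Real.rpow_nonneg hr.1.le _)]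
            exact mul_le_mul_of_nonneg_left (abs_ext_le f _) (Real.rpow_nonneg hr.1.le _)
          · exact (intervalIntegral.intervalIntegrable_rpow' (by linarith)).mul_const _
          · refine Eventually.of_forall fun r _ => ?_
            exact continuous_const.mul ((continuous_ext f).comp
              (continuous_const.mul continuous_subtype_val))⟩
      map_add' := fun f g => by
        ext t
        simp only [ContinuousMap.coe_mk, ContinuousMap.add_apply]
        rw [← intervalIntegral.integral_add (intervalIntegrable_avg ha f t 0 1)
          (intervalIntegrable_avg ha g t 0 1)]
        refine intervalIntegral.integral_congr fun r _ => ?_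
        simp only [ext, IccExtend, Function.comp_apply, ContinuousMap.add_apply]
        ring
      map_smul' := fun s f => by
        ext t
        simp only [ContinuousMap.coe_mk, ContinuousMap.smul_apply, smul_eq_mul, RingHom.id_apply]
        rw [← intervalIntegral.integral_const_mul]
        refine intervalIntegral.integral_congr fun r _ => ?_
        simp only [ext, IccExtend, Function.comp_apply, ContinuousMap.smul_apply, smul_eq_mul]
        ring } a⁻¹ fun f => by
      refine (ContinuousMap.norm_le _ (by positivity)).2 fun t => ?_
      rw [← integral_rpow_unit ha, ← intervalIntegral.integral_mul_const]
      refine intervalIntegral.norm_integral_le_of_norm_le zero_le_one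
        (Eventually.of_forall fun r hr => ?_)
        ((intervalIntegral.intervalIntegrable_rpow' (by linarith)).mul_const _)
      rw [norm_mul, Real.norm_of_nonneg (Real.rpow_nonneg hr.1.le _)]
      exact mul_le_mul_of_nonneg_left (abs_ext_le f _) (Real.rpow_nonneg hr.1.le _)

lemma avg_apply {a : ℝ} (ha : 0 < a) (f : C(I, ℝ)) (t : I) :
    avg a ha f t = ∫ r in (0 : ℝ)..1, r ^ (a - 1) * ext f (r * t) := rfl

lemma norm_avg_le {a : ℝ} (ha : 0 < a) : ‖avg a ha‖ ≤ a⁻¹ :=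
  LinearMap.mkContinuous_norm_le _ (by positivity) _

lemma avg_dil {a : ℝ} (ha : 0 < a) (τ : I) (f : C(I, ℝ)) :
    avg a ha (dil τ f) = dil τ (avg a ha f) := by
  ext t
  rw [dil_apply, avg_apply, avg_apply]
  refine intervalIntegral.integral_congr fun r hr => ?_
  rw [uIcc_of_le zero_le_one] at hr
  have h1 : r * (t : ℝ) ∈ I := ⟨mul_nonneg hr.1 t.2.1, mul_le_one₀ hr.2 t.2.1 t.2.2⟩
  have h2 : r * ((τ * t : I) : ℝ) ∈ I :=
    ⟨mul_nonneg hr.1 (τ * t).2.1, mul_le_one₀ hr.2 (τ * t).2.1 (τ * t).2.2⟩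
  rw [ext_of_mem _ h1, ext_of_mem _ h2, dil_apply]
  congr 2
  ext
  simp
  ring

lemma rpow_mul_avg {a : ℝ} (ha : 0 < a) (f : C(I, ℝ)) {t : I} (ht : 0 < (t : ℝ)) :
    (t : ℝ) ^ a * avg a ha f t = ∫ s in (0 : ℝ)..t, s ^ (a - 1) * ext f s := by
  have h := intervalIntegral.integral_comp_mul_right (a := 0) (b := 1)
    (fun s : ℝ => s ^ (a - 1) * ext f s) ht.ne'
  rw [zero_mul, one_mul, smul_eq_mul, eq_inv_mul_iff_mul_eq₀ ht.ne'] at h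
  rw [← h, avg_apply, ← intervalIntegral.integral_const_mul, ← intervalIntegral.integral_const_mul]
  refine intervalIntegral.integral_congr fun r hr => ?_
  rw [uIcc_of_le zero_le_one] at hr
  rw [Real.mul_rpow hr.1 ht.le, Real.rpow_sub_one ht.ne']
  field_simp

/-- The averaging operator integrates: `t ^ a (avg f)(t)` is a primitive of `t ^ (a - 1) f(t)`. -/
lemma hasDerivAt_rpow_mul_avg {a : ℝ} (ha : 0 < a) (f : C(I, ℝ)) {t : ℝ} (ht : t ∈ Ioo (0 : ℝ) 1) :
    HasDerivAt (fun s : ℝ => s ^ a * ext (avg a ha f) s) (t ^ (a - 1) * ext f t) t := by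
  have hc : ContinuousAt (fun s : ℝ => s ^ (a - 1) * ext f s) t :=
    (Real.continuousAt_rpow_const _ _ (Or.inl ht.1.ne')).mul (continuous_ext f).continuousAt
  have hi : IntervalIntegrable (fun s : ℝ => s ^ (a - 1) * ext f s) MeasureTheory.volume 0 t := by
    simpa using intervalIntegrable_avg ha f 1 0 t
  have hm : StronglyMeasurableAtFilter (fun s : ℝ => s ^ (a - 1) * ext f s) (𝓝 t)
      MeasureTheory.volume := by
    refine ContinuousOn.stronglyMeasurableAtFilter isOpen_Ioo (s := Ioo 0 1) (fun s hs => ?_) t ht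
    exact ((Real.continuousAt_rpow_const _ _ (Or.inl hs.1.ne')).mul
      (continuous_ext f).continuousAt).continuousWithinAt
  refine (intervalIntegral.integral_hasDerivAt_right hi hm hc).congr_of_eventuallyEq ?_
  filter_upwards [isOpen_Ioo.mem_nhds ht] with s hs
  have hs' : s ∈ I := Ioo_subset_Icc_self hs
  rw [ext_of_mem _ hs']
  exact rpow_mul_avg ha f (t := ⟨s, hs'⟩) hs.1

lemma avg_tpow {a e : ℝ} (ha : 0 < a) (he : 0 ≤ e) :
    avg a ha (tpow e) = (a + e)⁻¹ • tpow e := by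
  ext t
  rw [avg_apply, ContinuousMap.smul_apply, tpow_apply he, smul_eq_mul, ← integral_rpow_unit
    (by linarith : 0 < a + e), ← intervalIntegral.integral_mul_const]
  refine intervalIntegral.integral_congr_ae (Eventually.of_forall fun r hr => ?_)
  rw [uIoc_of_le zero_le_one] at hr
  have h1 : r * (t : ℝ) ∈ I := ⟨mul_nonneg hr.1.le t.2.1, mul_le_one₀ hr.2 t.2.1 t.2.2⟩
  rw [ext_of_mem _ h1, tpow_apply he, Real.mul_rpow hr.1.le t.2.1, ← mul_assoc,
    ← Real.rpow_add hr.1]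
  ring_nf

/-! ### Superposition operators -/

/-- A function that is analytic at `0` induces an analytic superposition operator on
`C([0, 1])`, given by the same power series in this Banach algebra. -/
theorem exists_analyticAt_superposition {g : ℝ → ℝ} (hg : AnalyticAt ℝ g 0) :
    ∃ F : C(I, ℝ) → C(I, ℝ), AnalyticAt ℝ F 0 ∧ ∀ᶠ U in 𝓝 0, ∀ t, F U t = g (U t) := by
  obtain ⟨p, ρ, hp⟩ := hg
  set P := FormalMultilinearSeries.ofScalars C(I, ℝ) (𝕜 := ℝ) p.coeff with hP
  have hrad : ρ ≤ P.radius := by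
    refine hp.r_le.trans (ENNReal.le_of_forall_nnreal_lt fun s hs => ?_)
    obtain ⟨C, _, hC⟩ := p.norm_mul_pow_le_of_lt_radius hs
    refine P.le_radius_of_bound C fun k => ?_
    rw [hP, FormalMultilinearSeries.ofScalars_norm]
    simpa [FormalMultilinearSeries.norm_apply_eq_norm_coef] using hC k
  have hpos : 0 < P.radius := hp.r_pos.trans_le hrad
  refine ⟨P.sum, (P.hasFPowerSeriesOnBall hpos).analyticAt, ?_⟩
  filter_upwards [Metric.eball_mem_nhds (0 : C(I, ℝ)) hp.r_pos] with U hU t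
  have h1 := (P.hasFPowerSeriesOnBall hpos).hasSum (y := U)
    (Metric.eball_subset_eball hrad hU)
  have h2 := h1.map (ContinuousMap.evalCLM ℝ t) (ContinuousMap.evalCLM ℝ t).continuous
  have hUt : U t ∈ Metric.eball (0 : ℝ) ρ := by
    rw [Metric.mem_eball, edist_zero_right] at hU ⊢
    refine lt_of_le_of_lt ?_ hU
    rw [enorm_le_iff_norm_le]
    exact U.norm_coe_le_norm t
  have h3 := hp.hasSum hUt
  rw [zero_add] at h2 h3
  refine h2.unique ?_
  have h4 : (⇑(ContinuousMap.evalCLM ℝ t) ∘ fun k => (P k) fun _ => U) =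
      fun k => (p k) fun _ => U t := by
    funext k
    simp [hP, FormalMultilinearSeries.ofScalars_apply_eq, mul_comm]
  rw [h4]
  exact h3

/-- The quadratic remainder of `1 - (1 + w) ^ (1 - n)` at `w = 0` is `w ^ 2` times an analytic
function. -/
theorem exists_quadratic_remainder (n : ℝ) :
    ∃ m : ℝ → ℝ, AnalyticAt ℝ m 0 ∧
      ∀ᶠ w in 𝓝 (0 : ℝ), 1 - (1 + w) ^ (1 - n) = (n - 1) * w + w ^ 2 * m w := by
  have hS : AnalyticAt ℝ (fun w : ℝ => (1 + w) ^ (1 - n)) 0 :=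
    Real.one_add_rpow_hasFPowerSeriesAt_zero.analyticAt
  set f : ℝ → ℝ := fun w => 1 - (1 + w) ^ (1 - n) - (n - 1) * w with hf
  have hfa : AnalyticAt ℝ f 0 :=
    (analyticAt_const.sub hS).sub (analyticAt_const.mul analyticAt_id)
  have hf0 : f 0 = 0 := by simp [hf]
  have hf1 : HasDerivAt f 0 0 := by
    have h1 : HasDerivAt (fun w : ℝ => (1 + w) ^ (1 - n)) (1 * (1 - n) * (1 + 0) ^ (1 - n - 1)) 0 :=
      ((hasDerivAt_id (0 : ℝ)).const_add 1).rpow_const (Or.inl (by simp))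
    have h2 := (h1.const_sub 1).sub ((hasDerivAt_id (0 : ℝ)).const_mul (n - 1))
    exact h2.congr_deriv (by simp)
  have hg1 : AnalyticAt ℝ (dslope f 0) 0 := by
    obtain ⟨p, hp⟩ := hfa
    exact hp.has_fpower_series_dslope_fslope.analyticAt
  have hg2 : AnalyticAt ℝ (dslope (dslope f 0) 0) 0 := by
    obtain ⟨p, hp⟩ := hg1
    exact hp.has_fpower_series_dslope_fslope.analyticAt
  refine ⟨_, hg2, Eventually.of_forall fun w => ?_⟩
  have e1 := sub_smul_dslope f 0 w
  have e2 := sub_smul_dslope (dslope f 0) 0 w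
  rw [dslope_same, hf1.deriv] at e2
  simp only [sub_zero, smul_eq_mul] at e1 e2
  rw [hf0, sub_zero] at e1
  have : f w = w ^ 2 * dslope (dslope f 0) 0 w := by rw [← e1, ← e2]; ring
  change 1 - (1 + w) ^ (1 - n) - (n - 1) * w = _ at this
  linarith

/-! ### The singular initial value problem at the contact line -/

/-- The algebraic relations between the exponents of the travelling wave. The number `ς` is the
weight of the remainder in the expansion `H = c x ^ ν (1 - b x ^ β + O(x ^ ς))`. -/
structure WaveExponents (n ν β ς A : ℝ) : Prop where
  one_lt : 1 < ν
  lt_two : ν < 2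
  nu_mul : ν * n = 3
  A_eq : A = ν * (ν - 1) * (2 - ν)
  beta_pos : 0 < β
  lt_sigma : β < ς
  sigma_le_one : ς ≤ 1
  sigma_le : ς ≤ 2 * β
  two_lt : 2 < ν + β
  indicial : (ν + β) * (ν + β - 1) * (ν + β - 2) = (n - 1) * A

namespace WaveExponents

variable {n ν β ς A : ℝ}

lemma A_pos (E : WaveExponents n ν β ς A) : 0 < A := by
  rw [E.A_eq]
  have := E.one_lt
  have := E.lt_two
  exact mul_pos (mul_pos (by linarith) (by linarith)) (by linarith)

lemma one_lt_n (E : WaveExponents n ν β ς A) : 1 < n := by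
  have h1 := E.one_lt
  have h2 := E.lt_two
  have h3 := E.nu_mul
  by_contra h
  nlinarith

lemma pos₂ (E : WaveExponents n ν β ς A) : 0 < ν + ς - 2 := by
  have := E.two_lt; have := E.lt_sigma; linarith

lemma pos₁ (E : WaveExponents n ν β ς A) : 0 < ν + ς - 1 := by
  have := E.pos₂; linarith

lemma pos₀ (E : WaveExponents n ν β ς A) : 0 < ν + ς := by
  have := E.pos₂; linarith

/-- The operator recovering the (weighted) first derivative from the second one: it maps `f` to
`g` with `(t ^ (ν + ς - 1) g)' = t ^ (ν + ς - 2) f`. -/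
def L₁ (E : WaveExponents n ν β ς A) : C(I, ℝ) →L[ℝ] C(I, ℝ) := avg (ν + ς - 1) E.pos₁

/-- The operator recovering the (weighted) function from its second derivative. -/
def L₀ (E : WaveExponents n ν β ς A) : C(I, ℝ) →L[ℝ] C(I, ℝ) := (avg (ν + ς) E.pos₀).comp E.L₁

/-- The operator recovering the (weighted) second derivative from the third one. -/
def L₂ (E : WaveExponents n ν β ς A) : C(I, ℝ) →L[ℝ] C(I, ℝ) := avg (ν + ς - 2) E.pos₂

/-- The linearisation at the leading-order profile of the remainder equation. -/
def M (E : WaveExponents n ν β ς A) : C(I, ℝ) →L[ℝ] C(I, ℝ) := (A * (n - 1)) • E.L₂.comp E.L₀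

/-- `(s + ν)(s + ν - 1)(s + ν - 2)` exceeds its value at `s = β` for `s > β`. -/
lemma indicial_lt (E : WaveExponents n ν β ς A) {s : ℝ} (hs : β < s) :
    A * (n - 1) < (ν + s - 2) * ((ν + s) * (ν + s - 1)) := by
  have h2 := E.two_lt
  have h : (ν + β) * (ν + β - 1) * (ν + β - 2) < (ν + s) * (ν + s - 1) * (ν + s - 2) := by
    have h0 : 0 < ν + β - 2 := by linarith
    have h1 : 0 < ν + β - 1 := by linarith
    have h3 : 0 < ν + β := by linarith
    have h4 : 0 < ν + s := by linarith
    gcongr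
  have := E.indicial
  nlinarith

lemma A_mul_pos (E : WaveExponents n ν β ς A) : 0 < A * (n - 1) :=
  mul_pos E.A_pos (by linarith [E.one_lt_n])

/-- The linearisation is a contraction exactly because `ς` lies above the indicial root `β`. -/
lemma norm_M_lt_one (E : WaveExponents n ν β ς A) : ‖E.M‖ < 1 := by
  have h0 := E.pos₀
  have h1 := E.pos₁
  have h2 := E.pos₂
  have hA := E.A_mul_pos
  calc ‖E.M‖ ≤ A * (n - 1) * ((ν + ς - 2)⁻¹ * ((ν + ς)⁻¹ * (ν + ς - 1)⁻¹)) := by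
        refine (ContinuousLinearMap.opNorm_smul_le _ _).trans ?_
        rw [Real.norm_of_nonneg hA.le]
        gcongr
        refine (ContinuousLinearMap.opNorm_comp_le _ _).trans ?_
        gcongr
        · exact norm_avg_le _
        · refine (ContinuousLinearMap.opNorm_comp_le _ _).trans ?_
          gcongr
          · exact norm_avg_le _
          · exact norm_avg_le _
    _ < 1 := by
        rw [← mul_inv, ← mul_inv, ← div_eq_mul_inv, div_lt_one (by positivity)]
        exact E.indicial_lt E.lt_sigma

lemma L₀_tpow (E : WaveExponents n ν β ς A) {e : ℝ} (he : 0 ≤ e) :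
    E.L₀ (tpow e) = ((ν + ς + e)⁻¹ * (ν + ς - 1 + e)⁻¹) • tpow e := by
  rw [L₀, ContinuousLinearMap.comp_apply, L₁, avg_tpow _ he, map_smul, avg_tpow _ he, smul_smul,
    mul_comm]

/-- The resolvent of the linearisation maps powers to positive multiples of themselves. -/
lemma M_tpow (E : WaveExponents n ν β ς A) {e : ℝ} (he : 0 ≤ e) :
    ∃ k : ℝ, 0 < k ∧ k • tpow e - E.M (k • tpow e) = tpow e := by
  have h0 := E.pos₀
  have h1 := E.pos₁
  have h2 := E.pos₂
  set θ := A * (n - 1) * ((ν + ς - 2 + e)⁻¹ * ((ν + ς + e)⁻¹ * (ν + ς - 1 + e)⁻¹)) with hθ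
  have hM : E.M (tpow e) = θ • tpow e := by
    rw [M, _root_.smul_apply, ContinuousLinearMap.comp_apply, L₀_tpow _ he, map_smul,
      L₂, avg_tpow _ he, smul_smul, smul_smul, hθ]
    congr 1
    ring
  have hlt : θ < 1 := by
    rw [hθ, ← mul_inv, ← mul_inv, ← div_eq_mul_inv, div_lt_one (by positivity)]
    refine (E.indicial_lt (s := ς + e) (by linarith [E.lt_sigma])).trans_eq ?_
    ring
  have h3 : (1 - θ) ≠ 0 := by linarith
  refine ⟨(1 - θ)⁻¹, inv_pos.2 (by linarith), ?_⟩
  rw [map_smul, hM, smul_smul, ← sub_smul]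
  have : (1 - θ)⁻¹ - (1 - θ)⁻¹ * θ = 1 := by field_simp
  rw [this, one_smul]

/-- The parameter `x`, as a linear map of `((x, y, z), f)`. -/
def parX : (ℝ × ℝ × ℝ) × C(I, ℝ) →L[ℝ] ℝ :=
  (ContinuousLinearMap.fst ℝ ℝ (ℝ × ℝ)).comp (ContinuousLinearMap.fst ℝ _ _)

/-- The parameter `y`, as a linear map of `((x, y, z), f)`. -/
def parY : (ℝ × ℝ × ℝ) × C(I, ℝ) →L[ℝ] ℝ :=
  (ContinuousLinearMap.fst ℝ ℝ ℝ).comp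
    ((ContinuousLinearMap.snd ℝ ℝ (ℝ × ℝ)).comp (ContinuousLinearMap.fst ℝ _ _))

/-- The parameter `z`, as a linear map of `((x, y, z), f)`. -/
def parZ : (ℝ × ℝ × ℝ) × C(I, ℝ) →L[ℝ] ℝ :=
  (ContinuousLinearMap.snd ℝ ℝ ℝ).comp
    ((ContinuousLinearMap.snd ℝ ℝ (ℝ × ℝ)).comp (ContinuousLinearMap.fst ℝ _ _))

/-- The weighted perturbation `Q = t ^ (ς - β) L₀ f - y`, as a linear map of `((x, y, z), f)`. -/
def Q (E : WaveExponents n ν β ς A) : (ℝ × ℝ × ℝ) × C(I, ℝ) →L[ℝ] C(I, ℝ) :=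
  (ContinuousLinearMap.mul ℝ C(I, ℝ) (tpow (ς - β))).comp
      (E.L₀.comp (ContinuousLinearMap.snd ℝ _ _)) -
    parY.smulRight 1

lemma Q_apply (E : WaveExponents n ν β ς A) (P : (ℝ × ℝ × ℝ) × C(I, ℝ)) :
    E.Q P = tpow (ς - β) * E.L₀ P.2 - P.1.2.1 • (1 : C(I, ℝ)) := rfl

/-- The relative perturbation `U = t ^ β Q` of the leading-order profile. -/
def U (E : WaveExponents n ν β ς A) : (ℝ × ℝ × ℝ) × C(I, ℝ) →L[ℝ] C(I, ℝ) :=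
  (ContinuousLinearMap.mul ℝ C(I, ℝ) (tpow β)).comp E.Q

lemma U_apply (E : WaveExponents n ν β ς A) (P : (ℝ × ℝ × ℝ) × C(I, ℝ)) :
    E.U P = tpow β * E.Q P := rfl

/-- The right-hand side of the remainder equation before its last integration; `S` and `R` stand
for the superposition operators of `(1 + w) ^ (1 - n)` and of its quadratic remainder. -/
def forcing (E : WaveExponents n ν β ς A) (S R : C(I, ℝ) → C(I, ℝ))
    (P : (ℝ × ℝ × ℝ) × C(I, ℝ)) : C(I, ℝ) :=
  (n - 1) • E.L₀ P.2 + tpow (2 * β - ς) * (E.Q P * E.Q P * R (E.U P)) +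
    P.1.1 • (tpow (1 - ς) * S (E.U P))

/-- The map whose fixed points `f` are the remainders of the second derivative of solutions with
parameters `(x, y, z)`; `c` is the leading coefficient of the profile. With `(x, y, z)` equal to
`(x₁, b x₁ ^ β, μ x₁ ^ (2 ν + 2))` and `H(x₁ t) = c x₁ ^ ν h(t)`, the equation becomes
`(h'' - (z c ^ 2 / 3) h ^ 3)' = A (x t - 1) h ^ (1 - n)`. The fixed point equation is its integral
for `h = t ^ ν - y t ^ (ν + β) + t ^ (ν + ς) L₀ f = t ^ ν (1 + U)`, after the terms that
`t ^ ν` and `t ^ (ν + β)` already account for have been cancelled. -/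
def waveMap (E : WaveExponents n ν β ς A) (c : ℝ) (S R : C(I, ℝ) → C(I, ℝ))
    (P : (ℝ × ℝ × ℝ) × C(I, ℝ)) : C(I, ℝ) :=
  A • E.L₂ (E.forcing S R P) +
    P.1.2.2 • ((c ^ 2 / 3) • (tpow (2 * ν + 2 - ς) * (1 + E.U P) ^ 3))

lemma analyticAt_waveMap (E : WaveExponents n ν β ς A) (c : ℝ) {S R : C(I, ℝ) → C(I, ℝ)}
    (hS : AnalyticAt ℝ S 0) (hR : AnalyticAt ℝ R 0) : AnalyticAt ℝ (E.waveMap c S R) 0 := by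
  have hQ : AnalyticAt ℝ E.Q 0 := E.Q.analyticAt 0
  have hU : AnalyticAt ℝ E.U 0 := E.U.analyticAt 0
  have hS' : AnalyticAt ℝ (S ∘ E.U) 0 := AnalyticAt.comp (by rwa [map_zero]) hU
  have hR' : AnalyticAt ℝ (R ∘ E.U) 0 := AnalyticAt.comp (by rwa [map_zero]) hU
  have hx : AnalyticAt ℝ parX 0 := parX.analyticAt 0
  have hz : AnalyticAt ℝ parZ 0 := parZ.analyticAt 0
  have hL := (E.L₀.comp (ContinuousLinearMap.snd ℝ (ℝ × ℝ × ℝ) C(I, ℝ))).analyticAt 0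
  have hF : AnalyticAt ℝ (E.forcing S R) 0 :=
    (((analyticAt_const (v := n - 1)).smul hL).add
      ((analyticAt_const (v := tpow (2 * β - ς))).mul ((hQ.mul hQ).mul hR'))).add
      (hx.smul ((analyticAt_const (v := tpow (1 - ς))).mul hS'))
  have hLF : AnalyticAt ℝ (E.L₂ ∘ E.forcing S R) 0 := (E.L₂.analyticAt _).comp hF
  exact ((analyticAt_const (v := A)).smul hLF).add
    (hz.smul ((analyticAt_const (v := c ^ 2 / 3)).smul
      ((analyticAt_const (v := tpow (2 * ν + 2 - ς))).mul
        (((analyticAt_const (v := (1 : C(I, ℝ)))).add hU).pow 3))))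

lemma hasFDerivAt_waveMap (E : WaveExponents n ν β ς A) (c : ℝ) {S R : C(I, ℝ) → C(I, ℝ)}
    (hS : AnalyticAt ℝ S 0) (hR : AnalyticAt ℝ R 0) (hS0 : S 0 = 1) :
    ∃ D : (ℝ × ℝ × ℝ) × C(I, ℝ) →L[ℝ] C(I, ℝ), HasFDerivAt (E.waveMap c S R) D 0 ∧
      ∀ p f, D (p, f) = E.M f + p.1 • A • E.L₂ (tpow (1 - ς)) +
        p.2.2 • (c ^ 2 / 3) • tpow (2 * ν + 2 - ς) := by
  have hQ : HasFDerivAt E.Q E.Q 0 := E.Q.hasFDerivAt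
  have hU : HasFDerivAt E.U E.U 0 := E.U.hasFDerivAt
  have hS' : HasFDerivAt (S ∘ E.U) _ 0 := HasFDerivAt.comp (g := S) 0
    (by rw [map_zero]; exact hS.differentiableAt.hasFDerivAt) hU
  have hR' : HasFDerivAt (R ∘ E.U) _ 0 := HasFDerivAt.comp (g := R) 0
    (by rw [map_zero]; exact hR.differentiableAt.hasFDerivAt) hU
  have hx : HasFDerivAt parX parX 0 := parX.hasFDerivAt
  have hz : HasFDerivAt parZ parZ 0 := parZ.hasFDerivAt
  have hL := (E.L₀.comp (ContinuousLinearMap.snd ℝ (ℝ × ℝ × ℝ) C(I, ℝ))).hasFDerivAt (x := 0)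
  have hF : HasFDerivAt (E.forcing S R) _ 0 :=
    ((hL.const_smul (n - 1)).add (((hQ.mul hQ).mul hR').const_mul (tpow (2 * β - ς)))).add
      (hx.smul (hS'.const_mul (tpow (1 - ς))))
  have hLF : HasFDerivAt (E.L₂ ∘ E.forcing S R) _ 0 := E.L₂.hasFDerivAt.comp 0 hF
  have hG : HasFDerivAt (E.waveMap c S R) _ 0 := (hLF.const_smul A).add
    (hz.smul ((((hU.const_add 1).pow 3).const_mul (tpow (2 * ν + 2 - ς))).const_smul (c ^ 2 / 3)))
  refine ⟨_, hG, fun p f => ?_⟩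
  simp only [hS0, M, smul_smul, map_zero, Pi.mul_apply, Function.comp_apply, mul_zero, zero_smul,
    smul_zero, add_zero, zero_add, _root_.add_apply, _root_.smul_apply,
    ContinuousLinearMap.comp_apply, ContinuousLinearMap.smulRight_apply, Pi.smul_apply, mul_one,
    one_pow, ContinuousLinearMap.coe_snd', map_add, map_smul, smul_add, zero_mul]
  rw [mul_comm A (parX _)]
  rfl

lemma waveMap_zero (E : WaveExponents n ν β ς A) (c : ℝ) (S R : C(I, ℝ) → C(I, ℝ)) :
    E.waveMap c S R 0 = 0 := by
  simp [waveMap, forcing]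

/-- The fixed points of `waveMap` near the origin form an analytic family, by the implicit function
theorem; its derivative at the origin is explicit. -/
theorem exists_remainder (E : WaveExponents n ν β ς A) {c : ℝ} (hc : 0 < c)
    {S R : C(I, ℝ) → C(I, ℝ)} (hS : AnalyticAt ℝ S 0) (hR : AnalyticAt ℝ R 0) (hS0 : S 0 = 1) :
    ∃ φ : ℝ × ℝ × ℝ → C(I, ℝ), AnalyticAt ℝ φ 0 ∧ φ 0 = 0 ∧
      (∃ (D : ℝ × ℝ × ℝ →L[ℝ] C(I, ℝ)) (k₁ k₃ : ℝ), HasStrictFDerivAt φ D 0 ∧ 0 < k₁ ∧ 0 < k₃ ∧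
        ∀ p, D p = p.1 • k₁ • tpow (1 - ς) + p.2.2 • k₃ • tpow (2 * ν + 2 - ς)) ∧
      ∀ᶠ P in 𝓝 ((0 : ℝ × ℝ × ℝ), (0 : C(I, ℝ))), E.waveMap c S R P = P.2 ↔ φ P.1 = P.2 := by
  have h2 := E.one_lt
  have h4 := E.sigma_le_one
  obtain ⟨D, hD, hDa⟩ := E.hasFDerivAt_waveMap c hS hR hS0
  have hA := E.analyticAt_waveMap c hS hR
  set G : (ℝ × ℝ × ℝ) × C(I, ℝ) → C(I, ℝ) := fun P => P.2 - E.waveMap c S R P with hG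
  have hGa : AnalyticAt ℝ G ((0 : ℝ × ℝ × ℝ), (0 : C(I, ℝ))) :=
    ((ContinuousLinearMap.snd ℝ (ℝ × ℝ × ℝ) C(I, ℝ)).analyticAt 0).sub hA
  have hGd : fderiv ℝ G ((0 : ℝ × ℝ × ℝ), (0 : C(I, ℝ))) =
      ContinuousLinearMap.snd ℝ (ℝ × ℝ × ℝ) C(I, ℝ) - D :=
    ((ContinuousLinearMap.snd ℝ (ℝ × ℝ × ℝ) C(I, ℝ)).hasFDerivAt.sub hD).fderiv
  have hcd : ContDiffAt ℝ ⊤ G ((0 : ℝ × ℝ × ℝ), (0 : C(I, ℝ))) := hGa.contDiffAt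
  -- The partial derivative with respect to `f` is `1 - M`, invertible by a Neumann series.
  have hlin : fderiv ℝ G ((0 : ℝ × ℝ × ℝ), (0 : C(I, ℝ))) ∘L .inr ℝ (ℝ × ℝ × ℝ) C(I, ℝ) =
      1 - E.M := by
    ext1 f
    rw [hGd]
    simp [hDa]
  have hinv : (fderiv ℝ G ((0 : ℝ × ℝ × ℝ), (0 : C(I, ℝ))) ∘L
      .inr ℝ (ℝ × ℝ × ℝ) C(I, ℝ)).IsInvertible := by
    rw [hlin]
    exact ⟨ContinuousLinearEquiv.ofUnit (Units.oneSub E.M E.norm_M_lt_one), by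
      ext; rfl⟩
  have hG0 : G 0 = 0 := by simp [hG, waveMap_zero]
  refine ⟨hcd.implicitFunction (by simp) hinv,
    (hcd.contDiffAt_implicitFunction (by simp) hinv).analyticAt,
    hcd.implicitFunction_apply_self (by simp) hinv, ?_, ?_⟩
  · obtain ⟨k₁, hk₁, e₁⟩ := E.M_tpow (e := 1 - ς) (by linarith)
    obtain ⟨k₃, hk₃, e₃⟩ := E.M_tpow (e := 2 * ν + 2 - ς) (by linarith)
    have hν : 0 < ν + ς - 2 + (1 - ς) := by linarith
    refine ⟨_, A * (ν + ς - 2 + (1 - ς))⁻¹ * k₁, c ^ 2 / 3 * k₃,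
      hcd.hasStrictFDerivAt_implicitFunction (by simp) hinv,
      mul_pos (mul_pos E.A_pos (inv_pos.2 hν)) hk₁, mul_pos (by positivity) hk₃, fun p => ?_⟩
    obtain ⟨e, he⟩ := hinv
    rw [← he, ContinuousLinearMap.inverse_equiv]
    change -(e.symm ((fderiv ℝ G (0, 0)) (p, 0))) = _
    rw [← map_neg, ContinuousLinearEquiv.symm_apply_eq, ← ContinuousLinearEquiv.coe_coe, he, hlin,
      hGd]
    have hb : avg (ν + ς - 2) E.pos₂ (tpow (1 - ς)) =
      (ν + ς - 2 + (1 - ς))⁻¹ • (k₁ • tpow (1 - ς) - E.M (k₁ • tpow (1 - ς))) := by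
      rw [e₁, avg_tpow _ (by linarith)]
    have hDp : D (p, 0) = p.1 • A • avg (ν + ς - 2) E.pos₂ (tpow (1 - ς)) +
        p.2.2 • (c ^ 2 / 3) • (k₃ • tpow (2 * ν + 2 - ς) -
          E.M (k₃ • tpow (2 * ν + 2 - ς))) := by
      rw [e₃]
      simp [hDa, L₂]
    have hl : -(ContinuousLinearMap.snd ℝ (ℝ × ℝ × ℝ) C(I, ℝ) - D) (p, 0) = D (p, 0) := by simp
    rw [hl, hDp, hb]
    simp only [_root_.sub_apply, one_apply_eq_self, map_add, map_smul]
    module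
  · filter_upwards [hcd.eventually_apply_eq_iff_implicitFunction (by simp) hinv] with P hP
    rw [← hP]
    change _ ↔ G P = G 0
    rw [hG0, hG, sub_eq_zero, eq_comm]

end WaveExponents

/-! ### Scaling covariance -/

/-- The action `(x, y, z) ↦ (τ x, τ ^ β y, τ ^ (2 ν + 2) z)` of dilations on the parameters. -/
def scale (ν β τ : ℝ) (p : ℝ × ℝ × ℝ) : ℝ × ℝ × ℝ :=
  (τ * p.1, τ ^ β * p.2.1, τ ^ (2 * ν + 2) * p.2.2)

lemma norm_scale_le {ν β τ : ℝ} (hν : 0 ≤ 2 * ν + 2) (hβ : 0 ≤ β) (h0 : 0 ≤ τ) (h1 : τ ≤ 1)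
    (p : ℝ × ℝ × ℝ) : ‖scale ν β τ p‖ ≤ ‖p‖ := by
  have key : ∀ s w : ℝ, 0 ≤ s → s ≤ 1 → ‖s * w‖ ≤ ‖w‖ := fun s w hs hs' => by
    rw [norm_mul, Real.norm_of_nonneg hs]
    exact mul_le_of_le_one_left (norm_nonneg _) hs'
  refine max_le ((key _ _ h0 h1).trans (norm_fst_le p)) (max_le ?_ ?_)
  · exact (key _ _ (Real.rpow_nonneg h0 _) (Real.rpow_le_one h0 h1 hβ)).trans
      ((norm_fst_le p.2).trans (norm_snd_le p))
  · exact (key _ _ (Real.rpow_nonneg h0 _) (Real.rpow_le_one h0 h1 hν)).trans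
      ((norm_snd_le p.2).trans (norm_snd_le p))

namespace WaveExponents

variable {n ν β ς A : ℝ}

lemma L₁_dil (E : WaveExponents n ν β ς A) (τ : I) (f : C(I, ℝ)) :
    E.L₁ (dil τ f) = dil τ (E.L₁ f) := avg_dil _ _ _

lemma L₀_dil (E : WaveExponents n ν β ς A) (τ : I) (f : C(I, ℝ)) :
    E.L₀ (dil τ f) = dil τ (E.L₀ f) := by
  simp only [L₀, ContinuousLinearMap.comp_apply, L₁_dil, avg_dil]

lemma Q_scale (E : WaveExponents n ν β ς A) {τ : I} (hτ : 0 < (τ : ℝ)) (p : ℝ × ℝ × ℝ)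
    (f : C(I, ℝ)) :
    E.Q (scale ν β τ p, (τ : ℝ) ^ ς • dil τ f) = (τ : ℝ) ^ β • dil τ (E.Q (p, f)) := by
  have h := E.lt_sigma
  ext t
  simp only [Q_apply, scale, map_smul, L₀_dil, ContinuousMap.sub_apply, ContinuousMap.mul_apply,
    ContinuousMap.smul_apply, dil_apply, ContinuousMap.one_apply, smul_eq_mul, mul_one,
    tpow_apply (sub_nonneg.2 h.le), Set.Icc.coe_mul, Real.mul_rpow τ.2.1 t.2.1]
  rw [Real.rpow_sub hτ]
  have := (Real.rpow_pos_of_pos hτ β).ne'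
  field_simp

lemma U_scale (E : WaveExponents n ν β ς A) {τ : I} (hτ : 0 < (τ : ℝ)) (p : ℝ × ℝ × ℝ)
    (f : C(I, ℝ)) :
    E.U (scale ν β τ p, (τ : ℝ) ^ ς • dil τ f) = dil τ (E.U (p, f)) := by
  have h := E.beta_pos
  rw [U_apply, Q_scale E hτ]
  ext t
  simp only [U_apply, ContinuousMap.mul_apply, ContinuousMap.smul_apply, dil_apply, smul_eq_mul,
    tpow_apply h.le, Set.Icc.coe_mul, Real.mul_rpow τ.2.1 t.2.1]
  ring

lemma waveMap_scale (E : WaveExponents n ν β ς A) (c : ℝ) {S R : C(I, ℝ) → C(I, ℝ)}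
    {s m : ℝ → ℝ} {ρ : ℝ} (hS : ∀ V, ‖V‖ < ρ → ∀ t, S V t = s (V t))
    (hR : ∀ V, ‖V‖ < ρ → ∀ t, R V t = m (V t)) {τ : I} (hτ : 0 < (τ : ℝ)) (p : ℝ × ℝ × ℝ)
    (f : C(I, ℝ)) (hU : ‖E.U (p, f)‖ < ρ) :
    E.waveMap c S R (scale ν β τ p, (τ : ℝ) ^ ς • dil τ f) =
      (τ : ℝ) ^ ς • dil τ (E.waveMap c S R (p, f)) := by
  have h1 := E.one_lt
  have h2 := E.sigma_le_one
  have h3 := E.sigma_le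
  have hU' : ‖dil τ (E.U (p, f))‖ < ρ := (norm_dil_le _ _).trans_lt hU
  have hSd : S (dil τ (E.U (p, f))) = dil τ (S (E.U (p, f))) := by
    ext t
    rw [hS _ hU', dil_apply, dil_apply, hS _ hU]
  have hRd : R (dil τ (E.U (p, f))) = dil τ (R (E.U (p, f))) := by
    ext t
    rw [hR _ hU', dil_apply, dil_apply, hR _ hU]
  have hF : E.forcing S R (scale ν β τ p, (τ : ℝ) ^ ς • dil τ f) =
      (τ : ℝ) ^ ς • dil τ (E.forcing S R (p, f)) := by
    rw [forcing, U_scale E hτ, Q_scale E hτ, hSd, hRd]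
    ext t
    simp only [forcing, scale, map_smul, L₀_dil, ContinuousMap.add_apply, ContinuousMap.mul_apply,
      ContinuousMap.smul_apply, dil_apply, smul_eq_mul,
      tpow_apply (show 0 ≤ 1 - ς by linarith), tpow_apply (show 0 ≤ 2 * β - ς by linarith),
      Set.Icc.coe_mul, Real.mul_rpow τ.2.1 t.2.1]
    rw [Real.rpow_sub hτ, Real.rpow_sub hτ, two_mul, Real.rpow_add hτ, Real.rpow_one]
    have := (Real.rpow_pos_of_pos hτ ς).ne'
    field_simp
  have hF' : E.L₂ (dil τ (E.forcing S R (p, f))) = dil τ (E.L₂ (E.forcing S R (p, f))) :=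
    avg_dil _ _ _
  rw [waveMap, U_scale E hτ, hF, map_smul, hF']
  ext t
  simp only [waveMap, scale, ContinuousMap.add_apply, ContinuousMap.mul_apply,
    ContinuousMap.pow_apply, ContinuousMap.one_apply,
    ContinuousMap.smul_apply, dil_apply, smul_eq_mul,
    tpow_apply (show 0 ≤ 2 * ν + 2 - ς by linarith), Set.Icc.coe_mul, Real.mul_rpow τ.2.1 t.2.1]
  rw [Real.rpow_sub hτ]
  have := (Real.rpow_pos_of_pos hτ ς).ne'
  field_simp

/-- The family of remainders: analytic in the parameters, solving the remainder equation, and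
covariant under dilations. -/
theorem exists_family (E : WaveExponents n ν β ς A) {c : ℝ} (hc : 0 < c) :
    ∃ (r : ℝ) (φ : ℝ × ℝ × ℝ → C(I, ℝ)), 0 < r ∧ AnalyticOnNhd ℝ φ (Metric.ball 0 r) ∧ φ 0 = 0 ∧
      (∃ (D : ℝ × ℝ × ℝ →L[ℝ] C(I, ℝ)) (k₁ k₃ : ℝ), HasStrictFDerivAt φ D 0 ∧ 0 < k₁ ∧ 0 < k₃ ∧
        ∀ p, D p = p.1 • k₁ • tpow (1 - ς) + p.2.2 • k₃ • tpow (2 * ν + 2 - ς)) ∧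
      (∀ p ∈ Metric.ball (0 : ℝ × ℝ × ℝ) r, ‖E.U (p, φ p)‖ ≤ 1 / 2) ∧
      (∀ p ∈ Metric.ball (0 : ℝ × ℝ × ℝ) r, ∃ F : C(I, ℝ),
        φ p = E.L₂ F + p.2.2 • ((c ^ 2 / 3) • (tpow (2 * ν + 2 - ς) * (1 + E.U (p, φ p)) ^ 3)) ∧
        ∀ t : I, 0 < (t : ℝ) → (t : ℝ) ^ ς * F t =
          A * ((p.1 * t - 1) * (1 + E.U (p, φ p) t) ^ (1 - n) + 1 +
            (n - 1) * (p.2.1 * (t : ℝ) ^ β))) ∧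
      ∀ p ∈ Metric.ball (0 : ℝ × ℝ × ℝ) r, ∀ τ : I, 0 < (τ : ℝ) →
        φ (scale ν β τ p) = (τ : ℝ) ^ ς • dil τ (φ p) := by
  obtain ⟨m, hm, hmeq⟩ := exists_quadratic_remainder n
  have hs : AnalyticAt ℝ (fun w : ℝ => (1 + w) ^ (1 - n)) 0 :=
    Real.one_add_rpow_hasFPowerSeriesAt_zero.analyticAt
  obtain ⟨S, hS, hSev⟩ := exists_analyticAt_superposition hs
  obtain ⟨R, hR, hRev⟩ := exists_analyticAt_superposition hm
  have hS0 : S 0 = 1 := by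
    ext t
    rw [hSev.self_of_nhds t]
    simp
  obtain ⟨φ, hφ, hφ0, hD, hiff⟩ := E.exists_remainder hc hS hR hS0
  obtain ⟨ρ₁, hρ₁, h₁⟩ := Metric.eventually_nhds_iff_ball.1 (hSev.and hRev)
  obtain ⟨ρ₂, hρ₂, h₂⟩ := Metric.eventually_nhds_iff_ball.1 hmeq
  have hUev : ∀ᶠ P in 𝓝 ((0 : ℝ × ℝ × ℝ), (0 : C(I, ℝ))), ‖E.U P‖ < min (min ρ₁ ρ₂) (1 / 2) := by
    have : Tendsto (fun P => ‖E.U P‖) (𝓝 ((0 : ℝ × ℝ × ℝ), (0 : C(I, ℝ)))) (𝓝 0) := by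
      have := (E.U.continuous.norm.tendsto (0 : (ℝ × ℝ × ℝ) × C(I, ℝ)))
      rw [map_zero, norm_zero] at this
      exact this
    exact this.eventually_lt_const (by positivity)
  obtain ⟨ρ₃, hρ₃, h₃⟩ := Metric.eventually_nhds_iff_ball.1 (hUev.and hiff)
  have hφev : ∀ᶠ p in 𝓝 (0 : ℝ × ℝ × ℝ), ‖φ p‖ < ρ₃ := by
    have : Tendsto (fun p => ‖φ p‖) (𝓝 0) (𝓝 0) := by
      simpa [hφ0] using hφ.continuousAt.norm.tendsto
    exact this.eventually_lt_const hρ₃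
  obtain ⟨r₁, hr₁, h₄⟩ := Metric.eventually_nhds_iff_ball.1 (hφev.and hφ.eventually_analyticAt)
  have hmem : ∀ p ∈ Metric.ball (0 : ℝ × ℝ × ℝ) (min r₁ ρ₃), ∀ g : C(I, ℝ), ‖g‖ < ρ₃ →
      (p, g) ∈ Metric.ball ((0 : ℝ × ℝ × ℝ), (0 : C(I, ℝ))) ρ₃ := fun p hp g hg => by
    rw [← ball_prod_same]
    exact ⟨Metric.ball_subset_ball (min_le_right _ _) hp, by simpa using hg⟩
  have hfix : ∀ p ∈ Metric.ball (0 : ℝ × ℝ × ℝ) (min r₁ ρ₃),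
      (p, φ p) ∈ Metric.ball ((0 : ℝ × ℝ × ℝ), (0 : C(I, ℝ))) ρ₃ := fun p hp =>
    hmem p hp _ (h₄ p (Metric.ball_subset_ball (min_le_left _ _) hp)).1
  have hSp : ∀ V : C(I, ℝ), ‖V‖ < min ρ₁ ρ₂ → ∀ t, S V t = (1 + V t) ^ (1 - n) := fun V hV t =>
    (h₁ V (by simpa using hV.trans_le (min_le_left _ _))).1 t
  have hRp : ∀ V : C(I, ℝ), ‖V‖ < min ρ₁ ρ₂ → ∀ t, R V t = m (V t) := fun V hV t =>
    (h₁ V (by simpa using hV.trans_le (min_le_left _ _))).2 t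
  have hUp : ∀ p ∈ Metric.ball (0 : ℝ × ℝ × ℝ) (min r₁ ρ₃), ‖E.U (p, φ p)‖ < min ρ₁ ρ₂ :=
    fun p hp => (h₃ _ (hfix p hp)).1.trans_le (min_le_left _ _)
  refine ⟨min r₁ ρ₃, φ, lt_min hr₁ hρ₃,
    fun p hp => (h₄ p (Metric.ball_subset_ball (min_le_left _ _) hp)).2, hφ0, hD,
    fun p hp => ((h₃ _ (hfix p hp)).1.trans_le (min_le_right _ _)).le, fun p hp => ?_,
    fun p hp τ hτ => ?_⟩
  · refine ⟨A • E.forcing S R (p, φ p), ?_, fun t ht => ?_⟩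
    · have h := ((h₃ _ (hfix p hp)).2.2 rfl).symm
      rw [map_smul]
      exact h
    · have hU := hUp p hp
      have hUt : |E.U (p, φ p) t| < ρ₂ :=
        ((E.U (p, φ p)).norm_coe_le_norm t).trans_lt (hU.trans_le (min_le_right _ _))
      have e := h₂ (E.U (p, φ p) t) (by simpa using hUt)
      have e1 := E.sigma_le
      have e2 := E.sigma_le_one
      have e3 := E.lt_sigma
      have e4 := E.beta_pos
      have hQt : E.U (p, φ p) t = (t : ℝ) ^ β * E.Q (p, φ p) t := by
        rw [U_apply, ContinuousMap.mul_apply, tpow_apply e4.le]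
      have hLt : (t : ℝ) ^ ς * E.L₀ (φ p) t = E.U (p, φ p) t + p.2.1 * (t : ℝ) ^ β := by
        rw [hQt, Q_apply]
        simp only [ContinuousMap.sub_apply, ContinuousMap.mul_apply, ContinuousMap.smul_apply,
          ContinuousMap.one_apply, smul_eq_mul, tpow_apply (sub_nonneg.2 e3.le)]
        rw [Real.rpow_sub ht]
        have := (Real.rpow_pos_of_pos ht β).ne'
        field_simp
        ring
      have hq : (t : ℝ) ^ ς * ((t : ℝ) ^ (2 * β - ς) * (E.Q (p, φ p) t * E.Q (p, φ p) t)) =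
          E.U (p, φ p) t ^ 2 := by
        rw [hQt, Real.rpow_sub ht, two_mul, Real.rpow_add ht]
        have := (Real.rpow_pos_of_pos ht ς).ne'
        field_simp
      have hx : (t : ℝ) ^ ς * (t : ℝ) ^ (1 - ς) = t := by
        rw [← Real.rpow_add ht]
        simp
      simp only [forcing, ContinuousMap.smul_apply, ContinuousMap.add_apply,
        ContinuousMap.mul_apply, smul_eq_mul, tpow_apply (show 0 ≤ 1 - ς by linarith),
        tpow_apply (show 0 ≤ 2 * β - ς by linarith), hSp _ hU, hRp _ hU]
      linear_combination A * ((n - 1) * hLt + m (E.U (p, φ p) t) * hq +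
        p.1 * (1 + E.U (p, φ p) t) ^ (1 - n) * hx - e)
  · have hν : 0 ≤ 2 * ν + 2 := by linarith [E.one_lt]
    have hp' : scale ν β τ p ∈ Metric.ball (0 : ℝ × ℝ × ℝ) (min r₁ ρ₃) := by
      rw [mem_ball_zero_iff] at hp ⊢
      exact (norm_scale_le hν E.beta_pos.le hτ.le τ.2.2 p).trans_lt hp
    have hς : 0 ≤ ς := E.beta_pos.le.trans E.lt_sigma.le
    have hn : ‖(τ : ℝ) ^ ς • dil τ (φ p)‖ < ρ₃ := by
      refine lt_of_le_of_lt ?_ (h₄ p (Metric.ball_subset_ball (min_le_left _ _) hp)).1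
      rw [norm_smul, Real.norm_of_nonneg (Real.rpow_nonneg hτ.le _)]
      exact (mul_le_of_le_one_left (norm_nonneg _) (Real.rpow_le_one hτ.le τ.2.2 hς)).trans
        (norm_dil_le _ _)
    -- The dilated remainder is a fixed point for the scaled parameters, hence the remainder there.
    refine (h₃ _ (hmem _ hp' _ hn)).2.1 ?_
    have := E.waveMap_scale c (s := fun w => (1 + w) ^ (1 - n)) hSp hRp hτ p (φ p) (hUp p hp)
    rw [this, (h₃ _ (hfix p hp)).2.2 rfl]

end WaveExponents

/-! ### The local family of solutions -/

/-- The local solutions at the contact line in normalised form: with `P = (x, b x ^ β, μ x ^ γ)`,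
the film height is `H = c x ^ ν (1 + u P)`, its derivative is `c x ^ (ν - 1) v P`, and the flux
variable `H'' - μ H ^ 3 / 3` is `c x ^ (ν - 2) w P`. The functions are controlled on the ball of
radius `r`: `C` is a Lipschitz constant of `w` at the origin, and `κ` bounds from below the rate at
which `w` decreases in its second argument. -/
structure LocalFamily (n ν β c r κ C : ℝ) (u v w : ℝ × ℝ × ℝ → ℝ) : Prop where
  r_pos : 0 < r
  κ_pos : 0 < κ
  analyticOnNhd_u : AnalyticOnNhd ℝ u (Metric.ball 0 r)
  continuousOn_v : ContinuousOn v (Metric.ball 0 r)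
  continuousOn_w : ContinuousOn w (Metric.ball 0 r)
  u_zero : u 0 = 0
  deriv_u : deriv (fun y : ℝ => u (0, y, 0)) 0 < 0
  abs_u_le : ∀ p ∈ Metric.ball (0 : ℝ × ℝ × ℝ) r, |u p| ≤ 1 / 2
  v_pos : ∀ p ∈ Metric.ball (0 : ℝ × ℝ × ℝ) r, 0 < v p
  v_le : ∀ p ∈ Metric.ball (0 : ℝ × ℝ × ℝ) r, v p ≤ 2 * ν
  abs_w_sub_le : ∀ p ∈ Metric.ball (0 : ℝ × ℝ × ℝ) r, |w p - ν * (ν - 1)| ≤ C * ‖p‖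
  u_anti : ∀ x y y' z, (x, y, z) ∈ Metric.ball (0 : ℝ × ℝ × ℝ) r →
    (x, y', z) ∈ Metric.ball (0 : ℝ × ℝ × ℝ) r → y < y' → u (x, y', z) < u (x, y, z)
  w_anti : ∀ x y y' z, (x, y, z) ∈ Metric.ball (0 : ℝ × ℝ × ℝ) r →
    (x, y', z) ∈ Metric.ball (0 : ℝ × ℝ × ℝ) r → y ≤ y' →
    κ * (y' - y) ≤ w (x, y, z) - w (x, y', z)
  u_pos : ∀ x z, (x, 0, z) ∈ Metric.ball (0 : ℝ × ℝ × ℝ) r → 0 < x → 0 ≤ z → 0 < u (x, 0, z)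
  ode : ∀ b μ x, 0 < x → (x, b * x ^ β, μ * x ^ (2 * ν + 2)) ∈ Metric.ball (0 : ℝ × ℝ × ℝ) r →
    HasDerivAt (fun s => c * s ^ ν * (1 + u (s, b * s ^ β, μ * s ^ (2 * ν + 2))))
      (c * x ^ (ν - 1) * v (x, b * x ^ β, μ * x ^ (2 * ν + 2))) x ∧
    HasDerivAt (fun s => c * s ^ (ν - 1) * v (s, b * s ^ β, μ * s ^ (2 * ν + 2)))
      (c * x ^ (ν - 2) * w (x, b * x ^ β, μ * x ^ (2 * ν + 2)) +
        μ / 3 * (c * x ^ ν * (1 + u (x, b * x ^ β, μ * x ^ (2 * ν + 2)))) ^ 3) x ∧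
    HasDerivAt (fun s => c * s ^ (ν - 2) * w (s, b * s ^ β, μ * s ^ (2 * ν + 2)))
      ((x - 1) * (c * x ^ ν * (1 + u (x, b * x ^ β, μ * x ^ (2 * ν + 2)))) ^ (1 - n)) x

namespace WaveExponents

variable {n ν β ς A : ℝ}

lemma U_eq (E : WaveExponents n ν β ς A) (p : ℝ × ℝ × ℝ) (f : C(I, ℝ)) {t : I}
    (ht : 0 < (t : ℝ)) :
    E.U (p, f) t = (t : ℝ) ^ ς * E.L₀ f t - (t : ℝ) ^ β * p.2.1 := by
  have e3 := E.lt_sigma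
  rw [U_apply, Q_apply]
  simp only [ContinuousMap.sub_apply, ContinuousMap.mul_apply, ContinuousMap.smul_apply,
    ContinuousMap.one_apply, smul_eq_mul, tpow_apply (sub_nonneg.2 e3.le),
    tpow_apply E.beta_pos.le]
  rw [Real.rpow_sub ht]
  have := (Real.rpow_pos_of_pos ht β).ne'
  field_simp

/-- The differential equations along the orbit `t ↦ scale t p` of a single parameter. -/
lemma hasDerivAt_orbit (E : WaveExponents n ν β ς A) {c : ℝ} {φ : ℝ × ℝ × ℝ → C(I, ℝ)}
    {u v w : ℝ × ℝ × ℝ → ℝ} (hu : ∀ p, u p = E.L₀ (φ p) 1 - p.2.1)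
    (hv : ∀ p, v p = ν - (ν + β) * p.2.1 + E.L₁ (φ p) 1)
    (hw : ∀ p, w p = ν * (ν - 1) - (ν + β) * (ν + β - 1) * p.2.1 + φ p 1 -
      p.2.2 * (c ^ 2 / 3) * (1 + u p) ^ 3)
    {p : ℝ × ℝ × ℝ} {F : C(I, ℝ)}
    (hφ : φ p = E.L₂ F + p.2.2 • ((c ^ 2 / 3) • (tpow (2 * ν + 2 - ς) * (1 + E.U (p, φ p)) ^ 3)))
    (hF : ∀ t : I, 0 < (t : ℝ) → (t : ℝ) ^ ς * F t =
      A * ((p.1 * t - 1) * (1 + E.U (p, φ p) t) ^ (1 - n) + 1 +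
        (n - 1) * (p.2.1 * (t : ℝ) ^ β)))
    (hsc : ∀ τ : I, 0 < (τ : ℝ) → φ (scale ν β τ p) = (τ : ℝ) ^ ς • dil τ (φ p))
    {t : ℝ} (ht : t ∈ Ioo (0 : ℝ) 1) :
    HasDerivAt (fun s => s ^ ν * (1 + u (scale ν β s p))) (t ^ (ν - 1) * v (scale ν β t p)) t ∧
    HasDerivAt (fun s => s ^ (ν - 1) * v (scale ν β s p))
      (t ^ (ν - 2) * w (scale ν β t p) +
        p.2.2 * (c ^ 2 / 3) * (t ^ ν * (1 + u (scale ν β t p))) ^ 3) t ∧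
    HasDerivAt (fun s => s ^ (ν - 2) * w (scale ν β s p))
      (A * t ^ (ν - 3) * ((p.1 * t - 1) * (1 + u (scale ν β t p)) ^ (1 - n))) t := by
  have e1 := E.one_lt
  have e2 := E.sigma_le_one
  have hU : ∀ s : I, 0 < (s : ℝ) → u (scale ν β s p) = E.U (p, φ p) s := fun s hs => by
    rw [hu, hsc s hs, E.U_eq p _ hs, map_smul, L₀_dil]
    simp [scale]
  have r0 : ∀ s ∈ Ioo (0 : ℝ) 1, s ^ ν * (1 + u (scale ν β s p)) =
      s ^ ν - p.2.1 * s ^ (ν + β) + s ^ (ν + ς) * ext (E.L₀ (φ p)) s := fun s hs => by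
    have hs' : s ∈ I := Ioo_subset_Icc_self hs
    rw [hU ⟨s, hs'⟩ hs.1, E.U_eq _ _ hs.1, ext_of_mem _ hs', Real.rpow_add hs.1,
      Real.rpow_add hs.1]
    simp only []
    ring
  have r1 : ∀ s ∈ Ioo (0 : ℝ) 1, s ^ (ν - 1) * v (scale ν β s p) =
      ν * s ^ (ν - 1) - p.2.1 * ((ν + β) * s ^ (ν + β - 1)) +
        s ^ (ν + ς - 1) * ext (E.L₁ (φ p)) s := fun s hs => by
    have hs' : s ∈ I := Ioo_subset_Icc_self hs
    rw [hv, hsc ⟨s, hs'⟩ hs.1, ext_of_mem _ hs', map_smul, L₁_dil, add_sub_right_comm,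
      add_sub_right_comm, Real.rpow_add hs.1, Real.rpow_add hs.1]
    simp only [scale, ContinuousMap.smul_apply, dil_apply, smul_eq_mul, mul_one]
    ring
  have r2 : ∀ s ∈ Ioo (0 : ℝ) 1, s ^ (ν - 2) * w (scale ν β s p) =
      ν * (ν - 1) * s ^ (ν - 2) - p.2.1 * ((ν + β) * ((ν + β - 1) * s ^ (ν + β - 2))) +
        s ^ (ν + ς - 2) * ext (E.L₂ F) s := fun s hs => by
    have hs' : s ∈ I := Ioo_subset_Icc_self hs
    have h0 := congrArg (fun g : C(I, ℝ) => g ⟨s, hs'⟩) hφ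
    simp only [ContinuousMap.smul_apply, ContinuousMap.add_apply, ContinuousMap.mul_apply,
      ContinuousMap.pow_apply, ContinuousMap.one_apply, smul_eq_mul,
      tpow_apply (show 0 ≤ 2 * ν + 2 - ς by linarith), ← hU ⟨s, hs'⟩ hs.1] at h0
    have h1 : s ^ (2 * ν + 2) = s ^ ς * s ^ (2 * ν + 2 - ς) := by
      rw [← Real.rpow_add hs.1]
      ring_nf
    rw [hw, hsc ⟨s, hs'⟩ hs.1, ext_of_mem _ hs', show ν + β - 2 = ν - 2 + β by ring,
      show ν + ς - 2 = ν - 2 + ς by ring, Real.rpow_add hs.1, Real.rpow_add hs.1]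
    simp only [ContinuousMap.smul_apply, dil_apply, smul_eq_mul, mul_one]
    rw [h0]
    simp only [scale, h1]
    ring
  have hnhds : Ioo (0 : ℝ) 1 ∈ 𝓝 t := isOpen_Ioo.mem_nhds ht
  have ht' : t ∈ I := Ioo_subset_Icc_self ht
  have hp : ∀ a : ℝ, HasDerivAt (fun s : ℝ => s ^ a) (a * t ^ (a - 1)) t := fun a =>
    Real.hasDerivAt_rpow_const (Or.inl ht.1.ne')
  refine ⟨?_, ?_, ?_⟩
  · refine HasDerivAt.congr_of_eventuallyEq ?_ (Filter.eventually_of_mem hnhds r0)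
    rw [r1 t ht]
    exact ((hp ν).sub ((hp (ν + β)).const_mul p.2.1)).add (hasDerivAt_rpow_mul_avg E.pos₀ _ ht)
  · refine HasDerivAt.congr_of_eventuallyEq ?_ (Filter.eventually_of_mem hnhds r1)
    have h := (((hp (ν - 1)).const_mul ν).sub (((hp (ν + β - 1)).const_mul (ν + β)).const_mul
      p.2.1)).add (hasDerivAt_rpow_mul_avg E.pos₁ (φ p) ht)
    refine h.congr_deriv ?_
    rw [r2 t ht]
    have h0 := congrArg (fun g : C(I, ℝ) => g ⟨t, ht'⟩) hφ
    simp only [ContinuousMap.smul_apply, ContinuousMap.add_apply, ContinuousMap.mul_apply,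
      ContinuousMap.pow_apply, ContinuousMap.one_apply, smul_eq_mul,
      tpow_apply (show 0 ≤ 2 * ν + 2 - ς by linarith), ← hU ⟨t, ht'⟩ ht.1] at h0
    have h1 : (t ^ ν) ^ 3 = t ^ (ν + ς - 2) * t ^ (2 * ν + 2 - ς) := by
      rw [← Real.rpow_add ht.1, ← Real.rpow_natCast, ← Real.rpow_mul ht.1.le]
      congr 1
      push_cast
      ring
    rw [ext_of_mem _ ht', ext_of_mem _ ht', h0, mul_pow, h1, show ν + ς - 1 - 1 = ν + ς - 2 by ring,
      show ν + β - 1 - 1 = ν + β - 2 by ring, show ν - 1 - 1 = ν - 2 by ring]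
    ring
  · refine HasDerivAt.congr_of_eventuallyEq ?_ (Filter.eventually_of_mem hnhds r2)
    have h := (((hp (ν - 2)).const_mul (ν * (ν - 1))).sub
      ((((hp (ν + β - 2)).const_mul (ν + β - 1)).const_mul (ν + β)).const_mul
      p.2.1)).add (hasDerivAt_rpow_mul_avg E.pos₂ F ht)
    refine h.congr_deriv ?_
    have h0 := hF ⟨t, ht'⟩ ht.1
    simp only [← hU ⟨t, ht'⟩ ht.1] at h0
    rw [ext_of_mem _ ht', show ν - 2 - 1 = ν - 3 by ring,
      show ν + β - 2 - 1 = ν - 3 + β by ring, show ν + ς - 2 - 1 = ν - 3 + ς by ring,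
      Real.rpow_add ht.1, Real.rpow_add ht.1]
    linear_combination (t ^ (ν - 3)) * h0 - p.2.1 * t ^ (ν - 3) * t ^ β * E.indicial +
      t ^ (ν - 3) * E.A_eq

end WaveExponents

namespace WaveExponents

variable {n ν β ς A : ℝ}

/-- Passing from the orbits of the dilations to the physical variable `x`. -/
lemma hasDerivAt_physical (E : WaveExponents n ν β ς A) {c r : ℝ} (hc : 0 < c)
    (hcA : c ^ (-n) = A) {u v w : ℝ × ℝ × ℝ → ℝ}
    (hu : ∀ p ∈ Metric.ball (0 : ℝ × ℝ × ℝ) r, |u p| ≤ 1 / 2)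
    (h : ∀ p ∈ Metric.ball (0 : ℝ × ℝ × ℝ) r, ∀ t ∈ Ioo (0 : ℝ) 1,
      HasDerivAt (fun s => s ^ ν * (1 + u (scale ν β s p))) (t ^ (ν - 1) * v (scale ν β t p)) t ∧
      HasDerivAt (fun s => s ^ (ν - 1) * v (scale ν β s p))
        (t ^ (ν - 2) * w (scale ν β t p) +
          p.2.2 * (c ^ 2 / 3) * (t ^ ν * (1 + u (scale ν β t p))) ^ 3) t ∧
      HasDerivAt (fun s => s ^ (ν - 2) * w (scale ν β s p))
        (A * t ^ (ν - 3) * ((p.1 * t - 1) * (1 + u (scale ν β t p)) ^ (1 - n))) t)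
    (b μ : ℝ) {x : ℝ} (hx : 0 < x)
    (hP : (x, b * x ^ β, μ * x ^ (2 * ν + 2)) ∈ Metric.ball (0 : ℝ × ℝ × ℝ) r) :
    HasDerivAt (fun s => c * s ^ ν * (1 + u (s, b * s ^ β, μ * s ^ (2 * ν + 2))))
      (c * x ^ (ν - 1) * v (x, b * x ^ β, μ * x ^ (2 * ν + 2))) x ∧
    HasDerivAt (fun s => c * s ^ (ν - 1) * v (s, b * s ^ β, μ * s ^ (2 * ν + 2)))
      (c * x ^ (ν - 2) * w (x, b * x ^ β, μ * x ^ (2 * ν + 2)) +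
        μ / 3 * (c * x ^ ν * (1 + u (x, b * x ^ β, μ * x ^ (2 * ν + 2)))) ^ 3) x ∧
    HasDerivAt (fun s => c * s ^ (ν - 2) * w (s, b * s ^ β, μ * s ^ (2 * ν + 2)))
      ((x - 1) * (c * x ^ ν * (1 + u (x, b * x ^ β, μ * x ^ (2 * ν + 2)))) ^ (1 - n)) x := by
  -- The curve through `P x` is the orbit of a point `P x₁` slightly further out.
  set P : ℝ → ℝ × ℝ × ℝ := fun s => (s, b * s ^ β, μ * s ^ (2 * ν + 2)) with hPdef
  have hcont : ContinuousAt P x :=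
    continuousAt_id.prodMk
      ((continuousAt_const.mul (Real.continuousAt_rpow_const _ _ (Or.inl hx.ne'))).prodMk
        (continuousAt_const.mul (Real.continuousAt_rpow_const _ _ (Or.inl hx.ne'))))
  have hev : ∀ᶠ s in 𝓝 x, P s ∈ Metric.ball (0 : ℝ × ℝ × ℝ) r :=
    hcont.eventually_mem (Metric.isOpen_ball.mem_nhds hP)
  obtain ⟨x₁, hx₁, hxx₁⟩ := ((hev.filter_mono nhdsWithin_le_nhds).and
    (self_mem_nhdsWithin (s := Ioi x))).exists
  have hx₁0 : 0 < x₁ := hx.trans hxx₁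
  have hs : ∀ s : ℝ, 0 < s → scale ν β (s / x₁) (P x₁) = P s := fun s hs => by
    simp only [scale, hPdef, Real.div_rpow hs.le hx₁0.le]
    have h1 := (Real.rpow_pos_of_pos hx₁0 β).ne'
    have h2 := (Real.rpow_pos_of_pos hx₁0 (2 * ν + 2)).ne'
    ext <;> field_simp
  have ht : x / x₁ ∈ Ioo (0 : ℝ) 1 := ⟨div_pos hx hx₁0, (div_lt_one hx₁0).2 hxx₁⟩
  obtain ⟨h0, h1, h2⟩ := h (P x₁) hx₁ _ ht
  rw [hs x hx] at h0 h1 h2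
  have key : ∀ (a d : ℝ) (g : ℝ × ℝ × ℝ → ℝ),
      HasDerivAt (fun s => s ^ a * g (scale ν β s (P x₁))) d (x / x₁) →
      HasDerivAt (fun s => c * s ^ a * g (P s)) (c * x₁ ^ (a - 1) * d) x := fun a d g hg => by
    have e := (hg.comp x ((hasDerivAt_id x).div_const x₁)).const_mul (c * x₁ ^ a)
    refine (e.congr_of_eventuallyEq ?_).congr_deriv ?_
    · filter_upwards [lt_mem_nhds hx] with s hs0
      simp only [Function.comp_apply, id]
      rw [hs s hs0, Real.div_rpow hs0.le hx₁0.le]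
      have := (Real.rpow_pos_of_pos hx₁0 a).ne'
      field_simp
    · rw [Real.rpow_sub_one hx₁0.ne']
      field_simp
  have hpow : ∀ a : ℝ, x ^ a = x₁ ^ a * (x / x₁) ^ a := fun a => by
    rw [← Real.mul_rpow hx₁0.le ht.1.le, mul_div_cancel₀ _ hx₁0.ne']
  have hu1 : 0 < 1 + u (P x) := by linarith [(abs_le.1 (hu _ hP)).1]
  refine ⟨?_, ?_, ?_⟩
  · refine (key ν _ (fun q => 1 + u q) h0).congr_deriv ?_
    rw [hpow (ν - 1)]
    ring
  · refine (key (ν - 1) _ v h1).congr_deriv ?_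
    have e1 : x₁ ^ (ν - 1 - 1) * x₁ ^ (2 * ν + 2) = (x₁ ^ ν) ^ 3 := by
      rw [← Real.rpow_add hx₁0, ← Real.rpow_natCast, ← Real.rpow_mul hx₁0.le]
      congr 1
      push_cast
      ring
    rw [hpow (ν - 2), hpow ν, mul_pow, mul_pow, mul_pow, mul_pow, ← e1,
      show ν - 1 - 1 = ν - 2 by ring]
    simp only [hPdef]
    ring
  · refine (key (ν - 2) _ w h2).congr_deriv ?_
    rw [Real.mul_rpow (by positivity) hu1.le, Real.mul_rpow hc.le (by positivity),
      ← Real.rpow_mul hx.le, show ν * (1 - n) = ν - 3 by linarith [E.nu_mul],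
      show 1 - n = 1 + -n by ring, Real.rpow_add hc, hcA, Real.rpow_one, hpow (ν - 3),
      show ν - 2 - 1 = ν - 3 by ring]
    simp only [hPdef]
    field_simp

set_option maxHeartbeats 1000000 in
/-- Existence of the local family of solutions at the contact line. -/
theorem exists_localFamily (E : WaveExponents n ν β ς A) {c : ℝ} (hc : 0 < c)
    (hcA : c ^ (-n) = A) : ∃ r κ C u v w, LocalFamily n ν β c r κ C u v w := by
  obtain ⟨r, φ, hr, hφa, hφ0, ⟨D, k₁, k₃, hD, hk₁, hk₃, hDp⟩, hU, hF, hsc⟩ := E.exists_family hc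
  have e1 := E.one_lt
  have e2 := E.sigma_le_one
  have e3 := E.two_lt
  have e4 := E.pos₀
  have e5 := E.pos₁
  set ev : C(I, ℝ) →L[ℝ] ℝ := ContinuousMap.evalCLM ℝ (1 : I) with hev
  have hev1 : ∀ f, ev f = f 1 := fun f => rfl
  set py : ℝ × ℝ × ℝ →L[ℝ] ℝ :=
    (ContinuousLinearMap.fst ℝ ℝ ℝ).comp (ContinuousLinearMap.snd ℝ ℝ (ℝ × ℝ)) with hpy
  set pz : ℝ × ℝ × ℝ →L[ℝ] ℝ :=
    (ContinuousLinearMap.snd ℝ ℝ ℝ).comp (ContinuousLinearMap.snd ℝ ℝ (ℝ × ℝ)) with hpz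
  set d := (ν + β) * (ν + β - 1) with hd
  have hdpos : 0 < d := mul_pos (by linarith) (by linarith)
  set u : ℝ × ℝ × ℝ → ℝ := fun p => E.L₀ (φ p) 1 - p.2.1 with hu
  set v : ℝ × ℝ × ℝ → ℝ := fun p => ν - (ν + β) * p.2.1 + E.L₁ (φ p) 1 with hv
  set w : ℝ × ℝ × ℝ → ℝ := fun p => ν * (ν - 1) - d * p.2.1 + φ p 1 -
      p.2.2 * (c ^ 2 / 3) * (1 + u p) ^ 3 with hw
  have hφc : ContinuousOn φ (Metric.ball 0 r) := hφa.continuousOn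
  have hua : AnalyticOnNhd ℝ u (Metric.ball 0 r) := fun p hp =>
    (((ev.comp E.L₀).analyticAt _).comp (hφa p hp)).sub (py.analyticAt p)
  have hvc : ContinuousOn v (Metric.ball 0 r) :=
    (continuousOn_const.sub (continuousOn_const.mul py.continuous.continuousOn)).add
      ((ev.comp E.L₁).continuous.comp_continuousOn hφc)
  have hwc : ContinuousOn w (Metric.ball 0 r) :=
    ((continuousOn_const.sub (continuousOn_const.mul py.continuous.continuousOn)).add
      (ev.continuous.comp_continuousOn hφc)).sub
      ((pz.continuous.continuousOn.mul continuousOn_const).mul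
        ((continuousOn_const.add hua.continuousOn).pow 3))
  have hu0 : u 0 = 0 := by simp [hu, hφ0]
  have hv0 : v 0 = ν := by simp [hv, hφ0]
  have hw0 : w 0 = ν * (ν - 1) := by simp [hw, hφ0]
  have hub : ∀ p ∈ Metric.ball (0 : ℝ × ℝ × ℝ) r, |u p| ≤ 1 / 2 := fun p hp => by
    have h1 : u p = E.U (p, φ p) 1 := by
      rw [E.U_eq p (φ p) (t := 1) (by simp)]
      simp [hu]
    rw [h1]
    exact ((E.U (p, φ p)).norm_coe_le_norm 1).trans (hU p hp)
  have hus : HasStrictFDerivAt u ((ev.comp E.L₀).comp D - py) 0 :=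
    ((ev.comp E.L₀).hasStrictFDerivAt.comp 0 hD).sub py.hasStrictFDerivAt
  -- The derivative of `w` at the origin is needed in the second direction only.
  obtain ⟨W, hws, hW⟩ : ∃ W : ℝ × ℝ × ℝ →L[ℝ] ℝ, HasStrictFDerivAt w W 0 ∧
      ∀ y, W (0, y, 0) = -d * y := by
    have h1 : HasStrictFDerivAt w _ 0 :=
      (((py.hasStrictFDerivAt.const_mul d).const_sub (ν * (ν - 1))).add
        (ev.hasStrictFDerivAt.comp 0 hD)).sub
        ((pz.hasStrictFDerivAt.mul_const (c ^ 2 / 3)).mul ((hus.const_add 1).pow 3))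
    refine ⟨_, h1, fun y => ?_⟩
    simp [hDp, hpy, hpz]
  set a₁ := k₁ * ((ν + ς + (1 - ς))⁻¹ * (ν + ς - 1 + (1 - ς))⁻¹) with ha₁
  set a₃ := k₃ * ((ν + ς + (2 * ν + 2 - ς))⁻¹ * (ν + ς - 1 + (2 * ν + 2 - ς))⁻¹) with ha₃
  have ha₁pos : 0 < a₁ := mul_pos hk₁ (mul_pos (inv_pos.2 (by linarith)) (inv_pos.2 (by linarith)))
  have ha₃pos : 0 < a₃ := mul_pos hk₃ (mul_pos (inv_pos.2 (by linarith)) (inv_pos.2 (by linarith)))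
  have hu' : ∀ p, ((ev.comp E.L₀).comp D - py) p = a₁ * p.1 - p.2.1 + a₃ * p.2.2 := fun p => by
    have h1 : (0 : ℝ) ≤ 1 - ς := by linarith
    have h3 : (0 : ℝ) ≤ 2 * ν + 2 - ς := by linarith
    simp [hDp, hpy, E.L₀_tpow h1, E.L₀_tpow h3, hev1, tpow_apply h1, tpow_apply h3, ha₁, ha₃]
    ring
  -- The derivative of `u` at the origin is `a₁ x - y + a₃ z`. An error of relative size `η` is
  -- smaller than each of the three terms.
  set η := min (min a₁ a₃) 1 / 2 with hη
  have hηpos : 0 < η := by positivity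
  have hη1 : η < a₁ := by
    have : min (min a₁ a₃) 1 ≤ a₁ := (min_le_left _ _).trans (min_le_left _ _)
    linarith
  have hη3 : η < a₃ := by
    have : min (min a₁ a₃) 1 ≤ a₃ := (min_le_left _ _).trans (min_le_right _ _)
    linarith
  have hη2 : η < 1 := by
    have : min (min a₁ a₃) 1 ≤ 1 := min_le_right _ _
    linarith
  obtain ⟨r₁, hr₁, h₁⟩ := Metric.eventually_nhds_iff_ball.1 (hus.isLittleO.def hηpos)
  obtain ⟨r₂, hr₂, h₂⟩ := Metric.eventually_nhds_iff_ball.1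
    (hws.isLittleO.def (by positivity : 0 < d / 2))
  obtain ⟨C, hC⟩ := hws.hasFDerivAt.isBigO_sub.bound
  obtain ⟨r₃, hr₃, h₃⟩ := Metric.eventually_nhds_iff_ball.1 hC
  have hvat : ContinuousAt v 0 := hvc.continuousAt (Metric.ball_mem_nhds 0 hr)
  have hvI : ∀ᶠ p in 𝓝 (0 : ℝ × ℝ × ℝ), v p ∈ Ioo 0 (2 * ν) :=
    hvat.eventually_mem (isOpen_Ioo.mem_nhds (by rw [hv0]; constructor <;> linarith))
  obtain ⟨r₄, hr₄, h₄⟩ := Metric.eventually_nhds_iff_ball.1 hvI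
  set ρ := min (min r r₁) (min r₂ (min r₃ r₄)) with hρ
  have hρr : ρ ≤ r := (min_le_left _ _).trans (min_le_left _ _)
  have hρ1 : ρ ≤ r₁ := (min_le_left _ _).trans (min_le_right _ _)
  have hρ2 : ρ ≤ r₂ := (min_le_right _ _).trans (min_le_left _ _)
  have hρ3 : ρ ≤ r₃ := (min_le_right _ _).trans ((min_le_right _ _).trans (min_le_left _ _))
  have hρ4 : ρ ≤ r₄ := (min_le_right _ _).trans ((min_le_right _ _).trans (min_le_right _ _))
  have hb : ∀ {p : ℝ × ℝ × ℝ} {s : ℝ}, ρ ≤ s → p ∈ Metric.ball (0 : ℝ × ℝ × ℝ) ρ →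
    p ∈ Metric.ball (0 : ℝ × ℝ × ℝ) s := fun hs hp => Metric.ball_subset_ball hs hp
  have hbb : ∀ {p q : ℝ × ℝ × ℝ} {s : ℝ}, ρ ≤ s → p ∈ Metric.ball (0 : ℝ × ℝ × ℝ) ρ →
      q ∈ Metric.ball (0 : ℝ × ℝ × ℝ) ρ →
      (p, q) ∈ Metric.ball ((0 : ℝ × ℝ × ℝ), (0 : ℝ × ℝ × ℝ)) s := fun hs hp hq => by
    rw [← ball_prod_same]
    exact ⟨hb hs hp, hb hs hq⟩
  have hρpos : 0 < ρ := by positivity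
  refine ⟨ρ, d / 2, C, u, v, w,
    { r_pos := hρpos
      κ_pos := by positivity
      analyticOnNhd_u := hua.mono (Metric.ball_subset_ball hρr)
      continuousOn_v := hvc.mono (Metric.ball_subset_ball hρr)
      continuousOn_w := hwc.mono (Metric.ball_subset_ball hρr)
      u_zero := hu0
      deriv_u := ?_
      abs_u_le := fun p hp => hub p (hb hρr hp)
      v_pos := fun p hp => (h₄ p (hb hρ4 hp)).1
      v_le := fun p hp => (h₄ p (hb hρ4 hp)).2.le
      abs_w_sub_le := fun p hp => ?_
      u_anti := fun x y y' z hp hq hyy' => ?_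
      w_anti := fun x y y' z hp hq hyy' => ?_
      u_pos := fun x z hp hx hz => ?_
      ode := fun b μ x hx hP => ?_ }⟩
  · have h1 : HasDerivAt (fun y : ℝ => ((0 : ℝ), y, (0 : ℝ))) ((0 : ℝ), (1 : ℝ), (0 : ℝ)) 0 :=
      (hasDerivAt_const _ _).prodMk ((hasDerivAt_id _).prodMk (hasDerivAt_const _ _))
    have h2 : HasDerivAt (fun y : ℝ => u (0, y, 0)) _ 0 :=
      HasFDerivAt.comp_hasDerivAt (l := u) 0 hus.hasFDerivAt h1
    rw [h2.deriv, hu']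
    simp
  · have := h₃ p (hb hρ3 hp)
    rw [hw0, sub_zero] at this
    exact this
  · have h := h₁ _ (hbb hρ1 hp hq)
    simp only [Prod.mk_sub_mk, sub_self, hu', mul_zero, zero_sub, add_zero, Prod.norm_mk,
      norm_zero, Real.norm_eq_abs] at h
    have h5 : max 0 (max |y - y'| 0) = y' - y := by
      rw [abs_sub_comm, abs_of_pos (sub_pos.2 hyy'), max_eq_left (sub_pos.2 hyy').le,
        max_eq_right (sub_pos.2 hyy').le]
    rw [h5] at h
    have := (abs_le.1 h).1
    nlinarith
  · have h := h₂ _ (hbb hρ2 hp hq)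
    simp only [Prod.mk_sub_mk, sub_self, hW, Prod.norm_mk,
      norm_zero, Real.norm_eq_abs] at h
    have h5 : max 0 (max |y - y'| 0) = y' - y := by
      rw [abs_sub_comm, abs_of_nonneg (sub_nonneg.2 hyy'), max_eq_left (sub_nonneg.2 hyy'),
        max_eq_right (sub_nonneg.2 hyy')]
    rw [h5] at h
    have := (abs_le.1 h).1
    nlinarith
  · have h := h₁ _ (hbb hρ1 hp (Metric.mem_ball_self hρpos))
    simp only [sub_zero, hu0, hu', Prod.norm_mk, norm_zero, Real.norm_eq_abs, abs_of_pos hx,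
      abs_of_nonneg hz] at h
    have h5 : max x (max 0 z) ≤ x + z := by
      rw [max_eq_right hz]
      exact max_le (by linarith) (by linarith)
    have := (abs_le.1 h).1
    nlinarith [mul_le_mul_of_nonneg_left h5 hηpos.le, mul_pos (sub_pos.2 hη1) hx,
      mul_nonneg (sub_pos.2 hη3).le hz]
  · refine E.hasDerivAt_physical hc hcA hub (fun p hp t ht => ?_) b μ hx (hb hρr hP)
    obtain ⟨F, hF1, hF2⟩ := hF p hp
    exact E.hasDerivAt_orbit (fun _ => rfl) (fun _ => rfl) (fun _ => rfl) hF1 hF2 (hsc p hp) ht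

end WaveExponents

/-! ### Comparison of trajectories -/

lemma monotoneOn_Ioc {f f' : ℝ → ℝ} {a X : ℝ} (hf : ∀ x ∈ Ioc a X, HasDerivAt f (f' x) x)
    (h : ∀ x ∈ Ioo a X, 0 ≤ f' x) : MonotoneOn f (Ioc a X) := by
  refine monotoneOn_of_deriv_nonneg (convex_Ioc a X)
    (fun x hx => (hf x hx).continuousAt.continuousWithinAt) ?_ ?_
  · rw [interior_Ioc]
    exact fun x hx => (hf x (Ioo_subset_Ioc_self hx)).differentiableAt.differentiableWithinAt
  · rw [interior_Ioc]
    intro x hx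
    rw [(hf x (Ioo_subset_Ioc_self hx)).deriv]
    exact h x hx

lemma le_of_monotoneOn_Ioc {f : ℝ → ℝ} {a X l : ℝ} (hf : MonotoneOn f (Ioc a X))
    (hl : Tendsto f (𝓝[>] a) (𝓝 l)) {x : ℝ} (hx : x ∈ Ioc a X) : l ≤ f x := by
  refine le_of_tendsto hl ?_
  filter_upwards [Ioc_mem_nhdsGT hx.1] with y hy
  exact hf ⟨hy.1, hy.2.trans hx.2⟩ hx hy.2

/-- A maximum principle for third-order differences. If `W' = G`, `G' = R + S` and `R' = r`, where
`r` and `S` are nonnegative wherever `W` is positive, then positivity of `W` near the left endpoint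
propagates, together with that of `G` and the monotonicity of `R`. -/
theorem comparison {W G R S r : ℝ → ℝ} {a X ρ : ℝ}
    (hW : ∀ x ∈ Ioc a X, HasDerivAt W (G x) x)
    (hG : ∀ x ∈ Ioc a X, HasDerivAt G (R x + S x) x)
    (hR : ∀ x ∈ Ioc a X, HasDerivAt R (r x) x)
    (hr : ∀ x ∈ Ioc a X, 0 < W x → 0 ≤ r x) (hS : ∀ x ∈ Ioc a X, 0 < W x → 0 ≤ S x)
    (hW0 : Tendsto W (𝓝[>] a) (𝓝 0)) (hG0 : Tendsto G (𝓝[>] a) (𝓝 0))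
    (hR0 : Tendsto R (𝓝[>] a) (𝓝 ρ)) (hρ : 0 ≤ ρ) (hpos : ∀ᶠ x in 𝓝[>] a, 0 < W x) :
    (∀ x ∈ Ioc a X, 0 < W x ∧ 0 < G x ∧ 0 ≤ R x) ∧ MonotoneOn R (Ioc a X) := by
  have key : ∀ Y, a < Y → Y ≤ X → (∀ x ∈ Ioo a Y, 0 < W x) →
      (∀ x ∈ Ioc a Y, 0 < W x ∧ 0 < G x ∧ 0 ≤ R x) ∧ MonotoneOn R (Ioc a Y) := by
    intro Y haY hYX hWY
    have hsub : Ioc a Y ⊆ Ioc a X := Ioc_subset_Ioc_right hYX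
    have mR : MonotoneOn R (Ioc a Y) := monotoneOn_Ioc (fun x hx => hR x (hsub hx))
      fun x hx => hr x (hsub (Ioo_subset_Ioc_self hx)) (hWY x hx)
    have pR : ∀ x ∈ Ioc a Y, 0 ≤ R x := fun x hx => hρ.trans (le_of_monotoneOn_Ioc mR hR0 hx)
    have mG : MonotoneOn G (Ioc a Y) := monotoneOn_Ioc (fun x hx => hG x (hsub hx))
      fun x hx => add_nonneg (pR x (Ioo_subset_Ioc_self hx))
        (hS x (hsub (Ioo_subset_Ioc_self hx)) (hWY x hx))
    have pG : ∀ x ∈ Ioc a Y, 0 ≤ G x := fun x hx => le_of_monotoneOn_Ioc mG hG0 hx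
    have mW : MonotoneOn W (Ioc a Y) := monotoneOn_Ioc (fun x hx => hW x (hsub hx))
      fun x hx => pG x (Ioo_subset_Ioc_self hx)
    have pW : ∀ x ∈ Ioc a Y, 0 < W x := fun x hx => by
      have hmid : (a + x) / 2 ∈ Ioo a Y := ⟨by linarith [hx.1], by linarith [hx.1, hx.2]⟩
      exact (hWY _ hmid).trans_le
        (mW (Ioo_subset_Ioc_self hmid) hx (by linarith [hx.1]))
    refine ⟨fun x hx => ⟨pW x hx, (pG x hx).lt_of_ne fun h0 => ?_, pR x hx⟩, mR⟩
    -- If `G` vanished at `x` it would vanish before `x`, and `W` would be constantly zero there.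
    have mW' : MonotoneOn (fun y => -W y) (Ioc a x) := monotoneOn_Ioc
      (fun y hy => (hW y (hsub ⟨hy.1, hy.2.trans hx.2⟩)).neg) fun y hy => by
        have := mG ⟨hy.1, hy.2.le.trans hx.2⟩ hx hy.2.le
        linarith
    have := le_of_monotoneOn_Ioc mW' (by simpa using hW0.neg) (x := x) ⟨hx.1, le_rfl⟩
    linarith [pW x hx]
  rcases le_or_gt X a with hXa | haX
  · simp [Ioc_eq_empty_of_le hXa, MonotoneOn]
  refine key X haX le_rfl fun x hx => ?_
  by_contra hneg
  obtain ⟨d, hd, hdpos⟩ := (mem_nhdsGT_iff_exists_Ioc_subset).1 hpos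
  rw [mem_Ioi] at hd
  have hdx : d < x := by
    by_contra h
    exact hneg (hdpos ⟨hx.1, not_lt.1 h⟩)
  have hc : ContinuousOn W (Icc d x) := fun y hy =>
    (hW y ⟨hd.trans_le hy.1, hy.2.trans hx.2.le⟩).continuousAt.continuousWithinAt
  have hcomp : IsCompact (Icc d x ∩ W ⁻¹' Iic 0) :=
    isCompact_Icc.of_isClosed_subset
      (hc.preimage_isClosed_of_isClosed isClosed_Icc isClosed_Iic) inter_subset_left
  obtain ⟨Y, hY, hYmin⟩ := hcomp.exists_isLeast ⟨x, ⟨hdx.le, le_rfl⟩, not_lt.1 hneg⟩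
  have haY : a < Y := hd.trans_le hY.1.1
  have := ((key Y haY (hY.1.2.trans hx.2.le) fun y hy => by
    by_contra hy0
    rcases le_or_gt y d with h | h
    · exact hy0 (hdpos ⟨hy.1, h⟩)
    · exact absurd (hYmin ⟨⟨h.le, hy.2.le.trans hY.1.2⟩, not_lt.1 hy0⟩) (not_le.2 hy.2)).1 Y
      ⟨haY, le_rfl⟩).1
  exact absurd hY.2 (not_le.2 this)

/-- Trajectories on `(0, X]` of the first-order system `H' = G`, `G' = Q + ψ(H)`,
`Q' = (x - 1) φ(x, H)`. The travelling wave equation is the case `φ(x, s) = s ^ (1 - n)` and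
`ψ(s) = μ s ^ 3 / 3`, with the flux variable `Q = H'' - μ H ^ 3 / 3`. -/
structure IsTraj (φ : ℝ → ℝ → ℝ) (ψ : ℝ → ℝ) (X : ℝ) (H G Q : ℝ → ℝ) : Prop where
  dH : ∀ x ∈ Ioc 0 X, HasDerivAt H (G x) x
  dG : ∀ x ∈ Ioc 0 X, HasDerivAt G (Q x + ψ (H x)) x
  dQ : ∀ x ∈ Ioc 0 X, HasDerivAt Q ((x - 1) * φ x (H x)) x

lemma IsTraj.mono {φ : ℝ → ℝ → ℝ} {ψ : ℝ → ℝ} {X Y : ℝ} {H G Q : ℝ → ℝ}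
    (h : IsTraj φ ψ X H G Q) (hY : Y ≤ X) : IsTraj φ ψ Y H G Q :=
  ⟨fun x hx => h.dH x ⟨hx.1, hx.2.trans hY⟩, fun x hx => h.dG x ⟨hx.1, hx.2.trans hY⟩,
    fun x hx => h.dQ x ⟨hx.1, hx.2.trans hY⟩⟩

/-- The system is order preserving with respect to the expansion at the contact line. -/
theorem IsTraj.comparison {φ₁ φ₂ : ℝ → ℝ → ℝ} {ψ₁ ψ₂ : ℝ → ℝ} {X : ℝ} {H₁ G₁ Q₁ H₂ G₂ Q₂ : ℝ → ℝ}
    (h₁ : IsTraj φ₁ ψ₁ X H₁ G₁ Q₁) (h₂ : IsTraj φ₂ ψ₂ X H₂ G₂ Q₂) (hX : X ≤ 1)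
    (hφ : ∀ x ∈ Ioc 0 X, H₂ x < H₁ x → φ₁ x (H₁ x) ≤ φ₂ x (H₂ x))
    (hψ : ∀ x ∈ Ioc 0 X, H₂ x < H₁ x → ψ₂ (H₂ x) ≤ ψ₁ (H₁ x))
    (hH : Tendsto (fun x => H₁ x - H₂ x) (𝓝[>] 0) (𝓝 0))
    (hG : Tendsto (fun x => G₁ x - G₂ x) (𝓝[>] 0) (𝓝 0))
    (hQ : Tendsto (fun x => Q₁ x - Q₂ x) (𝓝[>] 0) (𝓝 0))
    (hpos : ∀ᶠ x in 𝓝[>] 0, H₂ x < H₁ x) :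
    (∀ x ∈ Ioc 0 X, H₂ x < H₁ x ∧ G₂ x < G₁ x ∧ Q₂ x ≤ Q₁ x) ∧
      MonotoneOn (fun x => Q₁ x - Q₂ x) (Ioc 0 X) := by
  have := ThinFilm.comparison (X := X) (R := fun x => Q₁ x - Q₂ x)
    (S := fun x => ψ₁ (H₁ x) - ψ₂ (H₂ x))
    (fun x hx => (h₁.dH x hx).sub (h₂.dH x hx))
    (fun x hx => ((h₁.dG x hx).sub (h₂.dG x hx)).congr_deriv (by ring))
    (fun x hx => (h₁.dQ x hx).sub (h₂.dQ x hx))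
    (fun x hx hW => by
      have e1 := hφ x hx (sub_pos.1 hW)
      have e2 : x ≤ 1 := hx.2.trans hX
      nlinarith)
    (fun x hx hW => sub_nonneg.2 (hψ x hx (sub_pos.1 hW))) hH hG hQ le_rfl
    (hpos.mono fun x hx => sub_pos.2 hx)
  refine ⟨fun x hx => ?_, this.2⟩
  obtain ⟨a, b, c⟩ := this.1 x hx
  exact ⟨sub_pos.1 a, sub_pos.1 b, sub_nonneg.1 c⟩

/-- Once the height of a film has stopped increasing it decreases strictly: at the first critical
point `s` the curvature is nonpositive and decreasing, and from there on the comparison principle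
applies to `H s - H`. -/
theorem IsTraj.neg_of_nonpos {φ : ℝ → ℝ → ℝ} {ψ : ℝ → ℝ} {H G Q : ℝ → ℝ}
    (h : IsTraj φ ψ 1 H G Q) (hφ : ∀ x ∈ Ioc (0 : ℝ) 1, 0 < φ x (H x)) (hψm : Monotone ψ)
    {L : ℝ} (hψL : ∀ s t, |ψ s - ψ t| ≤ L * |s - t|) {x₀ x₁ : ℝ} (hx₀ : 0 < x₀) (h01 : x₀ < x₁)
    (hx₁ : x₁ < 1) (hG₀ : 0 < G x₀) (hG₁ : G x₁ ≤ 0) : G 1 < 0 := by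
  have hc : ContinuousOn G (Icc x₀ x₁) := fun y hy =>
    (h.dG y ⟨hx₀.trans_le hy.1, hy.2.trans hx₁.le⟩).continuousAt.continuousWithinAt
  have hcomp : IsCompact (Icc x₀ x₁ ∩ G ⁻¹' Iic 0) :=
    isCompact_Icc.of_isClosed_subset
      (hc.preimage_isClosed_of_isClosed isClosed_Icc isClosed_Iic) inter_subset_left
  obtain ⟨s, hs, hsmin⟩ := hcomp.exists_isLeast ⟨x₁, ⟨h01.le, le_rfl⟩, hG₁⟩
  have hx₀s : x₀ < s := hs.1.1.lt_of_ne fun e => by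
    have := hs.2
    rw [← e, mem_preimage, mem_Iic] at this
    linarith
  have hs0 : 0 < s := hx₀.trans hx₀s
  have hs1 : s < 1 := hs.1.2.trans_lt hx₁
  have hsI : s ∈ Ioc (0 : ℝ) 1 := ⟨hs0, hs1.le⟩
  have hleft : ∀ y ∈ Ico x₀ s, 0 < G y := fun y hy => by
    by_contra h0
    exact absurd (hsmin ⟨⟨hy.1, hy.2.le.trans hs.1.2⟩, not_lt.1 h0⟩) (not_le.2 hy.2)
  have hlev : ∀ᶠ y in 𝓝[<] s, 0 < G y :=
    mem_of_superset (Ico_mem_nhdsLT hx₀s) hleft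
  have hGs : G s = 0 := le_antisymm hs.2
    (ge_of_tendsto ((h.dG s hsI).continuousAt.tendsto.mono_left nhdsWithin_le_nhds)
      (hlev.mono fun y hy => hy.le))
  have hDs : Q s + ψ (H s) ≤ 0 := by
    have ht := (hasDerivAt_iff_tendsto_slope_left_right.1 (h.dG s hsI)).1
    refine le_of_tendsto ht ?_
    filter_upwards [hlev, self_mem_nhdsWithin] with y hy hys
    rw [slope_def_field, hGs, sub_zero]
    exact div_nonpos_of_nonneg_of_nonpos hy.le (by linarith [mem_Iio.1 hys])
  -- At the first critical point the derivative of `ψ ∘ H` vanishes, so that `G''` exists and is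
  -- negative.
  have hψH : HasDerivAt (fun y => ψ (H y)) 0 s := by
    have h1 : (fun y => H y - H s) =o[𝓝 s] fun y => y - s := by
      have := (h.dH s hsI).isLittleO
      simpa [hGs] using this
    rw [hasDerivAt_iff_isLittleO]
    simp only [smul_zero, sub_zero]
    refine Asymptotics.IsBigO.trans_isLittleO (Asymptotics.IsBigO.of_bound L ?_) h1
    exact Eventually.of_forall fun y => hψL _ _
  have hD : HasDerivAt (fun y => Q y + ψ (H y)) ((s - 1) * φ s (H s) + 0) s :=
    (h.dQ s hsI).add hψH
  have hneg : (s - 1) * φ s (H s) + 0 < 0 := by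
    rw [add_zero]
    exact mul_neg_of_neg_of_pos (by linarith) (hφ s hsI)
  have hDr : ∀ᶠ y in 𝓝[>] s, Q y + ψ (H y) < 0 := by
    have ht := (hasDerivAt_iff_tendsto_slope_left_right.1 hD).2
    filter_upwards [ht.eventually_lt_const hneg, self_mem_nhdsWithin] with y hy hys
    rw [slope_def_field, div_neg_iff] at hy
    rcases hy with hy | hy
    · linarith [mem_Ioi.1 hys]
    · linarith
  obtain ⟨d, hd, hdneg⟩ := (mem_nhdsGT_iff_exists_Ioc_subset).1 hDr
  rw [mem_Ioi] at hd
  set e := min d 1 with he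
  have hse : s < e := lt_min hd hs1
  have hGneg : ∀ y ∈ Ioc s e, G y < 0 := by
    have hanti : StrictAntiOn G (Icc s e) := by
      refine strictAntiOn_of_deriv_neg (convex_Icc _ _) (fun y hy => ?_) fun y hy => ?_
      · exact (h.dG y ⟨hs0.trans_le hy.1,
          hy.2.trans (min_le_right _ _)⟩).continuousAt.continuousWithinAt
      · rw [interior_Icc] at hy
        rw [(h.dG y ⟨hs0.trans hy.1, hy.2.le.trans (min_le_right _ _)⟩).deriv]
        exact hdneg ⟨hy.1, hy.2.le.trans (min_le_left _ _)⟩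
    intro y hy
    rw [← hGs]
    exact hanti ⟨le_rfl, hse.le⟩ ⟨hy.1.le, hy.2⟩ hy.1
  have hHlt : ∀ y ∈ Ioc s e, H y < H s := by
    have hanti : StrictAntiOn H (Icc s e) := by
      refine strictAntiOn_of_deriv_neg (convex_Icc _ _) (fun y hy => ?_) fun y hy => ?_
      · exact (h.dH y ⟨hs0.trans_le hy.1,
          hy.2.trans (min_le_right _ _)⟩).continuousAt.continuousWithinAt
      · rw [interior_Icc] at hy
        rw [(h.dH y ⟨hs0.trans hy.1, hy.2.le.trans (min_le_right _ _)⟩).deriv]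
        exact hGneg y ⟨hy.1, hy.2.le⟩
    exact fun y hy => hanti ⟨le_rfl, hse.le⟩ ⟨hy.1.le, hy.2⟩ hy.1
  have hsub : ∀ y ∈ Ioc s 1, y ∈ Ioc (0 : ℝ) 1 := fun y hy => ⟨hs0.trans hy.1, hy.2⟩
  have hlim : ∀ {f : ℝ → ℝ}, ContinuousAt f s → Tendsto f (𝓝[>] s) (𝓝 (f s)) := fun hf =>
    hf.tendsto.mono_left nhdsWithin_le_nhds
  have hcmp := ThinFilm.comparison (W := fun y => H s - H y) (G := fun y => -G y)
    (R := fun y => -Q y - ψ (H s)) (S := fun y => ψ (H s) - ψ (H y))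
    (r := fun y => -((y - 1) * φ y (H y))) (a := s) (X := 1) (ρ := -Q s - ψ (H s))
    (fun y hy => (h.dH y (hsub y hy)).const_sub _)
    (fun y hy => (h.dG y (hsub y hy)).neg.congr_deriv (by ring))
    (fun y hy => (h.dQ y (hsub y hy)).neg.sub_const _)
    (fun y hy _ => by
      have := hφ y (hsub y hy)
      have := hy.2
      nlinarith)
    (fun y hy hW => sub_nonneg.2 (hψm (sub_pos.1 hW).le))
    (by simpa using (hlim (h.dH s hsI).continuousAt).const_sub (H s))
    (by simpa [hGs] using (hlim (h.dG s hsI).continuousAt).neg)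
    ((hlim (h.dQ s hsI).continuousAt).neg.sub_const _) (by linarith)
    (mem_of_superset (Ioc_mem_nhdsGT hse) fun y hy => sub_pos.2 (hHlt y hy))
  linarith [(hcmp.1 1 ⟨hs1, le_rfl⟩).2.1]

/-- An increasing film that is flat at `1` has a slope controlled by its slope at `x₀`, because
`G + C x ^ 2 / 2` is convex. -/
theorem IsTraj.slope_le {φ : ℝ → ℝ → ℝ} {ψ : ℝ → ℝ} {H G Q : ℝ → ℝ}
    (h : IsTraj φ ψ 1 H G Q) (hψm : Monotone ψ) {x₀ C : ℝ} (hx₀ : 0 < x₀)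
    (hφ : ∀ x ∈ Icc x₀ 1, 0 ≤ φ x (H x) ∧ φ x (H x) ≤ C) (hG : ∀ x ∈ Icc x₀ 1, 0 ≤ G x)
    (hG₁ : G 1 = 0) {x : ℝ} (hx : x ∈ Icc x₀ 1) : G x ≤ G x₀ + C := by
  have hI : ∀ y ∈ Icc x₀ 1, y ∈ Ioc (0 : ℝ) 1 := fun y hy => ⟨hx₀.trans_le hy.1, hy.2⟩
  have h01 : x₀ ≤ 1 := hx.1.trans hx.2
  have hC : 0 ≤ C := (hφ x hx).1.trans (hφ x hx).2
  have hd : ∀ y ∈ Icc x₀ 1, HasDerivAt (fun y => G y + C * (y ^ 2 / 2))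
      (Q y + ψ (H y) + C * y) y := fun y hy => by
    refine ((h.dG y (hI y hy)).add (((hasDerivAt_pow 2 y).div_const 2).const_mul C)).congr_deriv ?_
    simp
  have hmono : ∀ {f f' : ℝ → ℝ}, (∀ y ∈ Icc x₀ 1, HasDerivAt f (f' y) y) →
      (∀ y ∈ Ioo x₀ 1, 0 ≤ f' y) → MonotoneOn f (Icc x₀ 1) := fun {f f'} hf hf' => by
    refine monotoneOn_of_deriv_nonneg (convex_Icc _ _)
      (fun y hy => (hf y hy).continuousAt.continuousWithinAt) ?_ ?_
    · rw [interior_Icc]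
      exact fun y hy => (hf y (Ioo_subset_Icc_self hy)).differentiableAt.differentiableWithinAt
    · rw [interior_Icc]
      intro y hy
      rw [(hf y (Ioo_subset_Icc_self hy)).deriv]
      exact hf' y hy
  have mH : MonotoneOn H (Icc x₀ 1) := hmono (fun y hy => h.dH y (hI y hy))
    fun y hy => hG y (Ioo_subset_Icc_self hy)
  have mQ : MonotoneOn (fun y => Q y + C * y) (Icc x₀ 1) := hmono
    (fun y hy => (h.dQ y (hI y hy)).add ((hasDerivAt_id y).const_mul C)) fun y hy => by
      have h1 := hφ y (Ioo_subset_Icc_self hy)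
      have h2 := hy.2
      have h3 := hx₀.trans hy.1
      nlinarith
  have mD : MonotoneOn (deriv fun y => G y + C * (y ^ 2 / 2)) (Ioo x₀ 1) := by
    intro y hy z hz hyz
    have hy' := Ioo_subset_Icc_self hy
    have hz' := Ioo_subset_Icc_self hz
    rw [(hd y hy').deriv, (hd z hz').deriv]
    have h1 := mQ hy' hz' hyz
    have h2 := hψm (mH hy' hz' hyz)
    simp only at h1
    linarith
  have hconv : ConvexOn ℝ (Icc x₀ 1) fun y => G y + C * (y ^ 2 / 2) := by
    refine MonotoneOn.convexOn_of_deriv (convex_Icc _ _)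
      (fun y hy => (hd y hy).continuousAt.continuousWithinAt) ?_ ?_
    · rw [interior_Icc]
      exact fun y hy => (hd y (Ioo_subset_Icc_self hy)).differentiableAt.differentiableWithinAt
    · rwa [interior_Icc]
  have hmax := hconv.le_max_of_mem_Icc ⟨le_rfl, h01⟩ ⟨h01, le_rfl⟩ hx
  simp only [hG₁] at hmax
  have hG₀ := hG x₀ ⟨le_rfl, h01⟩
  have hx1 : x₀ ^ 2 ≤ 1 := by nlinarith
  have hx2 : 0 ≤ C * (x ^ 2 / 2) := by positivity
  refine le_trans (le_add_of_nonneg_right hx2) (hmax.trans (max_le ?_ ?_)) <;> nlinarith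

/-! ### A truncated system with a global flow -/

/-- A bounded, globally Lipschitz vector field has a global flow that is continuous in the initial
value. -/
theorem exists_flow {E : Type*} [NormedAddCommGroup E] [NormedSpace ℝ E] [CompleteSpace E]
    {f : ℝ → E → E} {t₀ T : ℝ} (hT : t₀ ≤ T) {K L : NNReal}
    (hK : ∀ t ∈ Icc t₀ T, LipschitzWith K (f t)) (hc : ∀ y, ContinuousOn (f · y) (Icc t₀ T))
    (hL : ∀ t ∈ Icc t₀ T, ∀ y, ‖f t y‖ ≤ L) (r : NNReal) :
    ∃ Φ : E → ℝ → E, (∀ y ∈ Metric.closedBall (0 : E) r, Φ y t₀ = y ∧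
      ∀ t ∈ Icc t₀ T, HasDerivWithinAt (Φ y) (f t (Φ y t)) (Icc t₀ T) t) ∧
      ∀ t ∈ Icc t₀ T, ContinuousOn (Φ · t) (Metric.closedBall (0 : E) r) := by
  have hpl : IsPicardLindelof f (⟨t₀, le_rfl, hT⟩ : Icc t₀ T) 0 (L * (T - t₀).toNNReal + r) r L K :=
    { lipschitzOnWith := fun t ht => (hK t ht).lipschitzOnWith
      continuousOn := fun x _ => hc x
      norm_le := fun t ht x _ => hL t ht x
      mul_max_le := by
        simp [Real.coe_toNNReal _ (sub_nonneg.2 hT), max_eq_left (sub_nonneg.2 hT)] }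
  obtain ⟨Φ, h1, L', h2⟩ := hpl.exists_forall_mem_closedBall_eq_hasDerivWithinAt_lipschitzOnWith
  exact ⟨Φ, h1, fun t ht => (h2 t ht).continuousOn⟩

/-- Truncation of a real number to the interval `[a, b]`. -/
def clamp (a b s : ℝ) : ℝ := max a (min s b)

lemma clamp_of_mem {a b s : ℝ} (h : s ∈ Icc a b) : clamp a b s = s := by
  rw [clamp, min_eq_left h.2, max_eq_right h.1]

lemma clamp_mem {a b : ℝ} (h : a ≤ b) (s : ℝ) : clamp a b s ∈ Icc a b :=
  ⟨le_max_left _ _, max_le h (min_le_right _ _)⟩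

lemma abs_clamp_sub_le (a b s t : ℝ) : |clamp a b s - clamp a b t| ≤ |s - t| := by
  have h : LipschitzWith 1 (clamp a b) := (LipschitzWith.id.min_const b).const_max a
  simpa [Real.dist_eq] using h.dist_le_mul s t

lemma clamp_mono (a b : ℝ) : Monotone (clamp a b) := fun _ _ h =>
  max_le_max le_rfl (min_le_min h le_rfl)

lemma abs_clamp_neg_le {a : ℝ} (ha : 0 ≤ a) (s : ℝ) : |clamp (-a) a s| ≤ a :=
  abs_le.2 (clamp_mem (by linarith) s)

/-- The cube of a height truncated to `[0, K]`. -/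
def cutCube (K s : ℝ) : ℝ := clamp 0 K s ^ 3

lemma cutCube_of_mem {K s : ℝ} (h : s ∈ Icc 0 K) : cutCube K s = s ^ 3 := by
  rw [cutCube, clamp_of_mem h]

lemma cutCube_nonneg (K s : ℝ) : 0 ≤ cutCube K s := pow_nonneg (le_max_left _ _) 3

lemma cutCube_le {K : ℝ} (hK : 0 ≤ K) (s : ℝ) : cutCube K s ≤ K ^ 3 :=
  pow_le_pow_left₀ (clamp_mem hK s).1 (clamp_mem hK s).2 3

lemma cutCube_le_cube {K s : ℝ} (hs : 0 ≤ s) : cutCube K s ≤ s ^ 3 :=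
  pow_le_pow_left₀ (le_max_left _ _) (max_le hs (min_le_left _ _)) 3

lemma cutCube_mono (K : ℝ) : Monotone (cutCube K) := fun _ _ h =>
  pow_le_pow_left₀ (le_max_left _ _) (clamp_mono 0 K h) 3

lemma abs_cutCube_sub_le {K : ℝ} (hK : 0 ≤ K) (s t : ℝ) :
    |cutCube K s - cutCube K t| ≤ 3 * K ^ 2 * |s - t| := by
  obtain ⟨h1, h2⟩ := clamp_mem hK s
  obtain ⟨h3, h4⟩ := clamp_mem hK t
  have h5 := abs_clamp_sub_le 0 K s t
  set p := clamp 0 K s with hp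
  set q := clamp 0 K t with hq
  have h6 : cutCube K s - cutCube K t = (p ^ 2 + p * q + q ^ 2) * (p - q) := by
    rw [cutCube, cutCube, ← hp, ← hq]
    ring
  rw [h6, abs_mul, abs_of_nonneg (by positivity)]
  have h7 : p ^ 2 + p * q + q ^ 2 ≤ 3 * K ^ 2 := by nlinarith
  gcongr

lemma rpow_max_pos {δ : ℝ} (hδ : 0 < δ) (n s : ℝ) : 0 < max s δ ^ (1 - n) :=
  Real.rpow_pos_of_pos (hδ.trans_le (le_max_right _ _)) _

lemma rpow_max_le {δ n : ℝ} (hδ : 0 < δ) (hn : 1 < n) (s : ℝ) :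
    max s δ ^ (1 - n) ≤ δ ^ (1 - n) :=
  Real.rpow_le_rpow_of_nonpos hδ (le_max_right _ _) (by linarith)

lemma abs_rpow_max_sub_le {δ n : ℝ} (hδ : 0 < δ) (hn : 1 < n) (s t : ℝ) :
    |max s δ ^ (1 - n) - max t δ ^ (1 - n)| ≤ (n - 1) * δ ^ (-n) * |s - t| := by
  have h1 : ∀ x ∈ Ici δ, HasDerivWithinAt (fun x : ℝ => x ^ (1 - n))
      ((1 - n) * x ^ (1 - n - 1)) (Ici δ) x := fun x hx =>
    (Real.hasDerivAt_rpow_const (Or.inl (hδ.trans_le hx).ne')).hasDerivWithinAt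
  have h2 : ∀ x ∈ Ici δ, ‖(1 - n) * x ^ (1 - n - 1)‖ ≤ (n - 1) * δ ^ (-n) := fun x hx => by
    rw [norm_mul, Real.norm_of_nonpos (by linarith : 1 - n ≤ 0),
      Real.norm_of_nonneg (Real.rpow_nonneg (hδ.le.trans hx) _), neg_sub,
      show 1 - n - 1 = -n by ring]
    exact mul_le_mul_of_nonneg_left
      (Real.rpow_le_rpow_of_nonpos hδ hx (by linarith : -n ≤ 0)) (by linarith)
  have h3 := (convex_Ici δ).norm_image_sub_le_of_norm_hasDerivWithin_le h1 h2
    (mem_Ici.2 (le_max_right t δ)) (mem_Ici.2 (le_max_right s δ))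
  have h4 : |max s δ - max t δ| ≤ |s - t| := by
    have h : LipschitzWith 1 fun x : ℝ => max x δ := LipschitzWith.id.max_const δ
    simpa [Real.dist_eq] using h.dist_le_mul s t
  have h5 : 0 ≤ (n - 1) * δ ^ (-n) := mul_nonneg (by linarith) (Real.rpow_nonneg hδ.le _)
  exact h3.trans (mul_le_mul_of_nonneg_left h4 h5)

/-- The truncated vector field for the state `(H, H', Q, μ)`; carrying `μ` as a state variable
turns dependence on parameters into dependence on initial values. -/
def truncField (n δ K m CG CQ x : ℝ) (Y : ℝ × ℝ × ℝ × ℝ) : ℝ × ℝ × ℝ × ℝ :=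
  (clamp (-CG) CG Y.2.1, clamp (-CQ) CQ Y.2.2.1 + clamp 0 m Y.2.2.2 / 3 * cutCube K Y.1,
    (x - 1) * max Y.1 δ ^ (1 - n), 0)

lemma truncField_lipschitz {n δ K m : ℝ} (hn : 1 < n) (hδ : 0 < δ) (hK : 0 ≤ K) (hm : 0 ≤ m)
    (CG CQ : ℝ) : ∃ C : NNReal, ∀ x ∈ Icc (0 : ℝ) 2,
      LipschitzWith C (truncField n δ K m CG CQ x) := by
  have hn' : 0 ≤ n - 1 := by linarith
  have hδn : 0 ≤ δ ^ (-n) := Real.rpow_nonneg hδ.le _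
  set C : ℝ := 1 + (m / 3 * (3 * K ^ 2) + K ^ 3 / 3) + (n - 1) * δ ^ (-n) with hC
  have hC0 : 0 ≤ C := by positivity
  refine ⟨⟨C, hC0⟩, fun x hx => LipschitzWith.of_dist_le_mul fun Y Z => ?_⟩
  set d := dist Y Z with hd
  have hd0 : 0 ≤ d := dist_nonneg
  have d1 : |Y.1 - Z.1| ≤ d := le_max_left _ _
  have d' : dist Y.2 Z.2 ≤ d := le_max_right _ _
  have d2 : |Y.2.1 - Z.2.1| ≤ d := (le_max_left _ _).trans d'
  have d'' : dist Y.2.2 Z.2.2 ≤ d := (le_max_right _ _).trans d'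
  have d3 : |Y.2.2.1 - Z.2.2.1| ≤ d := (le_max_left _ _).trans d''
  have d4 : |Y.2.2.2 - Z.2.2.2| ≤ d := (le_max_right _ _).trans d''
  have hm1 : 0 ≤ m / 3 * (3 * K ^ 2) + K ^ 3 / 3 := by positivity
  have hm2 : 0 ≤ (n - 1) * δ ^ (-n) := by positivity
  refine max_le ?_ (max_le ?_ (max_le ?_ ?_))
  · refine ((abs_clamp_sub_le _ _ _ _).trans d2).trans ?_
    change d ≤ C * d
    nlinarith
  · have e1 := (abs_clamp_sub_le (-CQ) CQ Y.2.2.1 Z.2.2.1).trans d3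
    have e2 := abs_clamp_sub_le 0 m Y.2.2.2 Z.2.2.2
    have e3 := abs_cutCube_sub_le hK Y.1 Z.1
    have e4 := clamp_mem hm Z.2.2.2
    have e5 := clamp_mem hm Y.2.2.2
    have e6 := cutCube_nonneg K Z.1
    have e7 := cutCube_le hK Z.1
    change |(clamp (-CQ) CQ Y.2.2.1 + clamp 0 m Y.2.2.2 / 3 * cutCube K Y.1) -
      (clamp (-CQ) CQ Z.2.2.1 + clamp 0 m Z.2.2.2 / 3 * cutCube K Z.1)| ≤ C * d
    have e8 : (clamp (-CQ) CQ Y.2.2.1 + clamp 0 m Y.2.2.2 / 3 * cutCube K Y.1) -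
        (clamp (-CQ) CQ Z.2.2.1 + clamp 0 m Z.2.2.2 / 3 * cutCube K Z.1) =
        (clamp (-CQ) CQ Y.2.2.1 - clamp (-CQ) CQ Z.2.2.1) +
        (clamp 0 m Y.2.2.2 / 3 * (cutCube K Y.1 - cutCube K Z.1) +
          cutCube K Z.1 / 3 * (clamp 0 m Y.2.2.2 - clamp 0 m Z.2.2.2)) := by ring
    rw [e8]
    have e9 : |clamp 0 m Y.2.2.2 / 3 * (cutCube K Y.1 - cutCube K Z.1)| ≤
        m / 3 * (3 * K ^ 2 * d) := by
      rw [abs_mul, abs_of_nonneg (by linarith [e5.1])]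
      have : 3 * K ^ 2 * |Y.1 - Z.1| ≤ 3 * K ^ 2 * d := by gcongr
      exact mul_le_mul (by linarith [e5.2]) (e3.trans this) (abs_nonneg _) (by positivity)
    have e10 : |cutCube K Z.1 / 3 * (clamp 0 m Y.2.2.2 - clamp 0 m Z.2.2.2)| ≤ K ^ 3 / 3 * d := by
      rw [abs_mul, abs_of_nonneg (by linarith)]
      exact mul_le_mul (by linarith) (e2.trans d4) (abs_nonneg _) (by positivity)
    refine (abs_add_le _ _).trans ?_
    have e11 := (abs_add_le (clamp 0 m Y.2.2.2 / 3 * (cutCube K Y.1 - cutCube K Z.1))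
      (cutCube K Z.1 / 3 * (clamp 0 m Y.2.2.2 - clamp 0 m Z.2.2.2)))
    have e12 : 0 ≤ (n - 1) * δ ^ (-n) * d := by positivity
    rw [hC]
    nlinarith
  · change |(x - 1) * max Y.1 δ ^ (1 - n) - (x - 1) * max Z.1 δ ^ (1 - n)| ≤ C * d
    rw [← mul_sub, abs_mul]
    have e1 := abs_rpow_max_sub_le hδ hn Y.1 Z.1
    have e2 : |x - 1| ≤ 1 := abs_le.2 ⟨by linarith [hx.1], by linarith [hx.2]⟩
    have e3 : (n - 1) * δ ^ (-n) * |Y.1 - Z.1| ≤ (n - 1) * δ ^ (-n) * d := by gcongr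
    have e4 := mul_le_mul e2 (e1.trans e3) (abs_nonneg _) zero_le_one
    have e5 : 0 ≤ (m / 3 * (3 * K ^ 2) + K ^ 3 / 3) * d := by positivity
    rw [hC]
    nlinarith
  · change |(0 : ℝ) - 0| ≤ C * d
    simpa using mul_nonneg hC0 hd0

lemma truncField_bounded {n δ K m CG CQ : ℝ} (hn : 1 < n) (hδ : 0 < δ) (hK : 0 ≤ K) (hm : 0 ≤ m)
    (hCG : 0 ≤ CG) (hCQ : 0 ≤ CQ) : ∃ L : NNReal, ∀ x ∈ Icc (0 : ℝ) 2, ∀ Y,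
      ‖truncField n δ K m CG CQ x Y‖ ≤ L := by
  have hδn : 0 ≤ δ ^ (1 - n) := Real.rpow_nonneg hδ.le _
  set L : ℝ := CG + (CQ + m / 3 * K ^ 3) + δ ^ (1 - n) with hL
  have hm1 : 0 ≤ m / 3 * K ^ 3 := by positivity
  have hL0 : 0 ≤ L := by positivity
  refine ⟨⟨L, hL0⟩, fun x hx Y => ?_⟩
  refine max_le ?_ (max_le ?_ (max_le ?_ ?_))
  · refine (abs_clamp_neg_le hCG _).trans ?_
    change CG ≤ L
    linarith
  · refine (abs_add_le _ _).trans ?_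
    have e1 := abs_clamp_neg_le hCQ Y.2.2.1
    have e4 := clamp_mem hm Y.2.2.2
    have e6 := cutCube_nonneg K Y.1
    have e7 := cutCube_le hK Y.1
    rw [abs_of_nonneg (mul_nonneg (by linarith [e4.1]) e6 :
      0 ≤ clamp 0 m Y.2.2.2 / 3 * cutCube K Y.1)]
    have e8 : clamp 0 m Y.2.2.2 / 3 * cutCube K Y.1 ≤ m / 3 * K ^ 3 :=
      mul_le_mul (by linarith [e4.2]) e7 e6 (by positivity)
    change _ ≤ L
    linarith
  · change |(x - 1) * max Y.1 δ ^ (1 - n)| ≤ L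
    rw [abs_mul, abs_of_pos (rpow_max_pos hδ n _)]
    have e2 : |x - 1| ≤ 1 := abs_le.2 ⟨by linarith [hx.1], by linarith [hx.2]⟩
    have e4 := mul_le_mul e2 (rpow_max_le hδ hn Y.1) (rpow_max_pos hδ n _).le zero_le_one
    linarith
  · change |(0 : ℝ)| ≤ L
    simpa using hL0

/-- The flow of the film equation with the mobility cut off below the height `δ` and the gravity
term cut off above the height `K`. A priori bounds remove the other truncations. The interval
extends beyond `1` so that derivatives at `1` are two-sided. -/
theorem exists_filmFlow {n δ K m x₀ B₀ : ℝ} (hn : 1 < n) (hδ : 0 < δ) (hK : 0 ≤ K) (hm : 0 ≤ m)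
    (hx₀ : 0 ≤ x₀) (hx₀2 : x₀ ≤ 2) (hB₀ : 0 ≤ B₀) :
    ∃ Φ : ℝ × ℝ × ℝ × ℝ → ℝ → ℝ × ℝ × ℝ × ℝ,
      (∀ y, ‖y‖ ≤ B₀ → y.2.2.2 ∈ Icc 0 m → Φ y x₀ = y ∧ ∀ x ∈ Icc x₀ 2,
        HasDerivWithinAt (fun s => (Φ y s).1) (Φ y x).2.1 (Icc x₀ 2) x ∧
        HasDerivWithinAt (fun s => (Φ y s).2.1)
          ((Φ y x).2.2.1 + y.2.2.2 / 3 * cutCube K (Φ y x).1) (Icc x₀ 2) x ∧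
        HasDerivWithinAt (fun s => (Φ y s).2.2.1)
          ((x - 1) * max (Φ y x).1 δ ^ (1 - n)) (Icc x₀ 2) x) ∧
      ∀ x ∈ Icc x₀ 2, ContinuousOn (Φ · x) {y | ‖y‖ ≤ B₀} := by
  have hδn : 0 ≤ δ ^ (1 - n) := Real.rpow_nonneg hδ.le _
  have hmK : 0 ≤ m / 3 * K ^ 3 := by positivity
  -- A priori bounds for `Q` and `G` on an interval of length at most `2`.
  set CQ := B₀ + 2 * δ ^ (1 - n) with hCQ
  set CG := B₀ + 2 * (CQ + m / 3 * K ^ 3) with hCG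
  have hCQ0 : 0 ≤ CQ := by positivity
  have hCG0 : 0 ≤ CG := by positivity
  obtain ⟨C, hC⟩ := truncField_lipschitz hn hδ hK hm CG CQ
  obtain ⟨L, hL⟩ := truncField_bounded hn hδ hK hm hCG0 hCQ0
  have hsub : Icc x₀ 2 ⊆ Icc (0 : ℝ) 2 := Icc_subset_Icc_left hx₀
  obtain ⟨Φ, hΦ, hcont⟩ := exists_flow (f := truncField n δ K m CG CQ) hx₀2
    (fun t ht => hC t (hsub ht))
    (fun y => (continuous_const.prodMk (continuous_const.prodMk
      (((continuous_id.sub continuous_const).mul continuous_const).prodMk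
        continuous_const))).continuousOn)
    (fun t ht y => hL t (hsub ht) y) ⟨B₀, hB₀⟩
  have hball : ∀ y : ℝ × ℝ × ℝ × ℝ, ‖y‖ ≤ B₀ → y ∈ Metric.closedBall (0 : ℝ × ℝ × ℝ × ℝ)
      ((⟨B₀, hB₀⟩ : NNReal) : ℝ) := fun y hy => by rwa [mem_closedBall_zero_iff]
  refine ⟨Φ, fun y hy hym => ?_, fun x hx => (hcont x hx).mono fun y hy => hball y hy⟩
  obtain ⟨h0, hd⟩ := hΦ y (hball y hy)
  refine ⟨h0, ?_⟩
  have comp : ∀ l : ℝ × ℝ × ℝ × ℝ →L[ℝ] ℝ, ∀ x ∈ Icc x₀ 2, HasDerivWithinAt (fun s => l (Φ y s))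
      (l (truncField n δ K m CG CQ x (Φ y x))) (Icc x₀ 2) x := fun l x hx =>
    l.hasFDerivAt.comp_hasDerivWithinAt x (hd x hx)
  let π := ContinuousLinearMap.snd ℝ ℝ (ℝ × ℝ × ℝ)
  let π' := ContinuousLinearMap.snd ℝ ℝ (ℝ × ℝ)
  have d1 : ∀ x ∈ Icc x₀ 2, HasDerivWithinAt (fun s => (Φ y s).1)
      (truncField n δ K m CG CQ x (Φ y x)).1 (Icc x₀ 2) x :=
    comp (ContinuousLinearMap.fst ℝ ℝ (ℝ × ℝ × ℝ))
  have d2 : ∀ x ∈ Icc x₀ 2, HasDerivWithinAt (fun s => (Φ y s).2.1)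
      (truncField n δ K m CG CQ x (Φ y x)).2.1 (Icc x₀ 2) x :=
    comp ((ContinuousLinearMap.fst ℝ ℝ (ℝ × ℝ)).comp π)
  have d3 : ∀ x ∈ Icc x₀ 2, HasDerivWithinAt (fun s => (Φ y s).2.2.1)
      (truncField n δ K m CG CQ x (Φ y x)).2.2.1 (Icc x₀ 2) x :=
    comp ((ContinuousLinearMap.fst ℝ ℝ ℝ).comp (π'.comp π))
  have d4 : ∀ x ∈ Icc x₀ 2, HasDerivWithinAt (fun s => (Φ y s).2.2.2)
      (truncField n δ K m CG CQ x (Φ y x)).2.2.2 (Icc x₀ 2) x :=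
    comp ((ContinuousLinearMap.snd ℝ ℝ ℝ).comp (π'.comp π))
  have hx₀mem : x₀ ∈ Icc x₀ 2 := ⟨le_rfl, hx₀2⟩
  have hlen : ∀ x ∈ Icc x₀ 2, ‖x - x₀‖ ≤ 2 := fun x hx => by
    rw [Real.norm_of_nonneg (by linarith [hx.1])]
    linarith [hx.2]
  have y1 : |y.2.1| ≤ B₀ := (norm_fst_le y.2).trans ((norm_snd_le y).trans hy)
  have y2 : |y.2.2.1| ≤ B₀ :=
    (norm_fst_le y.2.2).trans ((norm_snd_le y.2).trans ((norm_snd_le y).trans hy))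
  have hμ : ∀ x ∈ Icc x₀ 2, (Φ y x).2.2.2 = y.2.2.2 := fun x hx => by
    have := (convex_Icc x₀ 2).norm_image_sub_le_of_norm_hasDerivWithin_le (C := 0) d4
      (fun x hx => by simp [truncField]) hx₀mem hx
    rw [zero_mul, norm_le_zero_iff, sub_eq_zero] at this
    rw [this, h0]
  have hQ : ∀ x ∈ Icc x₀ 2, (Φ y x).2.2.1 ∈ Icc (-CQ) CQ := fun x hx => by
    have := (convex_Icc x₀ 2).norm_image_sub_le_of_norm_hasDerivWithin_le (C := δ ^ (1 - n)) d3
      (fun x hx => by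
        change |(x - 1) * max (Φ y x).1 δ ^ (1 - n)| ≤ δ ^ (1 - n)
        rw [abs_mul, abs_of_pos (rpow_max_pos hδ n _)]
        have e2 : |x - 1| ≤ 1 := abs_le.2 ⟨by linarith [hx.1], by linarith [hx.2]⟩
        have e4 := mul_le_mul e2 (rpow_max_le hδ hn (Φ y x).1) (rpow_max_pos hδ n _).le zero_le_one
        linarith) hx₀mem hx
    rw [h0] at this
    have h2 : δ ^ (1 - n) * ‖x - x₀‖ ≤ δ ^ (1 - n) * 2 := by
      gcongr
      exact hlen x hx
    have h3 := abs_le.1 (this.trans h2)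
    have h4 := abs_le.1 y2
    constructor <;> linarith [h3.1, h3.2, h4.1, h4.2]
  have e2 : ∀ x ∈ Icc x₀ 2, HasDerivWithinAt (fun s => (Φ y s).2.1)
      ((Φ y x).2.2.1 + y.2.2.2 / 3 * cutCube K (Φ y x).1) (Icc x₀ 2) x := fun x hx => by
    refine (d2 x hx).congr_deriv ?_
    simp only [truncField]
    rw [clamp_of_mem (hQ x hx), hμ x hx, clamp_of_mem hym]
  have hG : ∀ x ∈ Icc x₀ 2, (Φ y x).2.1 ∈ Icc (-CG) CG := fun x hx => by
    have := (convex_Icc x₀ 2).norm_image_sub_le_of_norm_hasDerivWithin_le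
      (C := CQ + m / 3 * K ^ 3) e2 (fun x hx => by
        refine (norm_add_le _ _).trans (add_le_add (abs_le.2 (hQ x hx)) ?_)
        rw [Real.norm_of_nonneg (mul_nonneg (by linarith [hym.1]) (cutCube_nonneg _ _))]
        exact mul_le_mul (by linarith [hym.2]) (cutCube_le hK _) (cutCube_nonneg _ _)
          (by positivity)) hx₀mem hx
    rw [h0] at this
    have h2 : (CQ + m / 3 * K ^ 3) * ‖x - x₀‖ ≤ (CQ + m / 3 * K ^ 3) * 2 := by
      gcongr
      exact hlen x hx
    have h3 := abs_le.1 (this.trans h2)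
    have h4 := abs_le.1 y1
    constructor <;> linarith [h3.1, h3.2, h4.1, h4.2]
  refine fun x hx => ⟨(d1 x hx).congr_deriv ?_, e2 x hx, d3 x hx⟩
  exact clamp_of_mem (hG x hx)

/-! ### Uniqueness and gluing of trajectories -/

/-- The mobility factor `s ^ (1 - n)` of the travelling wave equation, which does not depend on
the first argument. -/
def mob (n : ℝ) : ℝ → ℝ → ℝ := fun _ s => s ^ (1 - n)

/-- The potential `μ s ^ 3 / 3` of the gravity term. -/
def grav (μ : ℝ) : ℝ → ℝ := fun s => μ / 3 * s ^ 3

/-- Two positive solutions that agree at one point agree to its right. -/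
theorem IsTraj.unique {n μ X : ℝ} (hn : 1 < n) (hμ : 0 ≤ μ) {H₁ G₁ Q₁ H₂ G₂ Q₂ : ℝ → ℝ}
    (h₁ : IsTraj (mob n) (grav μ) X H₁ G₁ Q₁) (h₂ : IsTraj (mob n) (grav μ) X H₂ G₂ Q₂)
    (hX : X ≤ 1) (p₁ : ∀ x ∈ Ioc 0 X, 0 < H₁ x) (p₂ : ∀ x ∈ Ioc 0 X, 0 < H₂ x) {x₀ : ℝ}
    (hx₀ : 0 < x₀) (hH : H₁ x₀ = H₂ x₀) (hG : G₁ x₀ = G₂ x₀) (hQ : Q₁ x₀ = Q₂ x₀) :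
    ∀ x ∈ Icc x₀ X, H₁ x = H₂ x := by
  rcases lt_or_ge X x₀ with hlt | hle
  · intro x hx
    exact absurd (hx.1.trans hx.2) (not_le.2 hlt)
  have hsub : ∀ x ∈ Icc x₀ X, x ∈ Ioc 0 X := fun x hx => ⟨hx₀.trans_le hx.1, hx.2⟩
  have hne : (Icc x₀ X).Nonempty := ⟨x₀, le_rfl, hle⟩
  have hcont : ∀ {f f' : ℝ → ℝ}, (∀ x ∈ Ioc 0 X, HasDerivAt f (f' x) x) →
      ContinuousOn f (Icc x₀ X) := fun hf x hx =>
    (hf x (hsub x hx)).continuousAt.continuousWithinAt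
  have low : ∀ {f : ℝ → ℝ}, ContinuousOn f (Icc x₀ X) → (∀ x ∈ Ioc 0 X, 0 < f x) →
      ∃ δ, 0 < δ ∧ ∀ x ∈ Icc x₀ X, δ ≤ f x := fun {f} hf hp => by
    obtain ⟨z, hz, hmin⟩ := isCompact_Icc.exists_isMinOn hne hf
    exact ⟨f z, hp z (hsub z hz), fun x hx => hmin hx⟩
  have up : ∀ {f : ℝ → ℝ}, ContinuousOn f (Icc x₀ X) →
      ∃ C, ∀ x ∈ Icc x₀ X, |f x| ≤ C := fun {f} hf => isCompact_Icc.exists_bound_of_continuousOn hf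
  obtain ⟨δ₁, hδ₁, l₁⟩ := low (hcont h₁.dH) p₁
  obtain ⟨δ₂, hδ₂, l₂⟩ := low (hcont h₂.dH) p₂
  obtain ⟨K₁, k₁⟩ := up (hcont h₁.dH)
  obtain ⟨K₂, k₂⟩ := up (hcont h₂.dH)
  obtain ⟨g₁, hg₁⟩ := up (hcont h₁.dG)
  obtain ⟨g₂, hg₂⟩ := up (hcont h₂.dG)
  obtain ⟨q₁, hq₁⟩ := up (hcont h₁.dQ)
  obtain ⟨q₂, hq₂⟩ := up (hcont h₂.dQ)
  have hK0 : 0 ≤ max K₁ K₂ := le_max_of_le_left ((abs_nonneg _).trans (k₁ x₀ ⟨le_rfl, hle⟩))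
  obtain ⟨C, hC⟩ := truncField_lipschitz (δ := min δ₁ δ₂) hn (lt_min hδ₁ hδ₂) hK0 hμ
    (max g₁ g₂) (max q₁ q₂)
  have mk : ∀ {H G Q : ℝ → ℝ}, IsTraj (mob n) (grav μ) X H G Q →
      (∀ x ∈ Icc x₀ X, min δ₁ δ₂ ≤ H x) → (∀ x ∈ Icc x₀ X, |H x| ≤ max K₁ K₂) →
      (∀ x ∈ Icc x₀ X, |G x| ≤ max g₁ g₂) → (∀ x ∈ Icc x₀ X, |Q x| ≤ max q₁ q₂) →
      ∀ t ∈ Icc x₀ X, HasDerivAt (fun s => (H s, G s, Q s, μ))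
        (truncField n (min δ₁ δ₂) (max K₁ K₂) μ (max g₁ g₂) (max q₁ q₂) t
          (H t, G t, Q t, μ)) t := by
    intro H G Q h e1 e2 e3 e4 t ht
    have hpos : 0 ≤ H t := (lt_min hδ₁ hδ₂).le.trans (e1 t ht)
    have := (h.dH t (hsub t ht)).prodMk ((h.dG t (hsub t ht)).prodMk ((h.dQ t (hsub t ht)).prodMk
      (hasDerivAt_const t μ)))
    refine this.congr_deriv ?_
    simp only [truncField]
    rw [clamp_of_mem (abs_le.1 (e3 t ht)), clamp_of_mem (abs_le.1 (e4 t ht)),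
      clamp_of_mem ⟨hμ, le_rfl⟩, cutCube_of_mem ⟨hpos, (le_abs_self _).trans (e2 t ht)⟩,
      max_eq_left (e1 t ht)]
    rfl
  have D₁ := mk h₁ (fun x hx => (min_le_left _ _).trans (l₁ x hx))
    (fun x hx => (k₁ x hx).trans (le_max_left _ _)) (fun x hx => (hg₁ x hx).trans (le_max_left _ _))
    (fun x hx => (hq₁ x hx).trans (le_max_left _ _))
  have D₂ := mk h₂ (fun x hx => (min_le_right _ _).trans (l₂ x hx))
    (fun x hx => (k₂ x hx).trans (le_max_right _ _))
    (fun x hx => (hg₂ x hx).trans (le_max_right _ _))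
    (fun x hx => (hq₂ x hx).trans (le_max_right _ _))
  have := ODE_solution_unique_of_mem_Icc_right (s := fun _ => univ) (K := C)
    (v := truncField n (min δ₁ δ₂) (max K₁ K₂) μ (max g₁ g₂) (max q₁ q₂))
    (fun t ht => (hC t ⟨hx₀.le.trans ht.1, by linarith [ht.2]⟩).lipschitzOnWith)
    (fun t ht => (D₁ t ht).continuousAt.continuousWithinAt)
    (fun t ht => (D₁ t (Ico_subset_Icc_self ht)).hasDerivWithinAt) (fun _ _ => mem_univ _)
    (fun t ht => (D₂ t ht).continuousAt.continuousWithinAt)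
    (fun t ht => (D₂ t (Ico_subset_Icc_self ht)).hasDerivWithinAt) (fun _ _ => mem_univ _)
    (by simp [hH, hG, hQ])
  exact fun x hx => congrArg Prod.fst (this hx)

/-- The function equal to `f` up to `x₀` and to `g` beyond. -/
def glue (x₀ : ℝ) (f g : ℝ → ℝ) : ℝ → ℝ := fun x => if x ≤ x₀ then f x else g x

lemma glue_of_le {x₀ x : ℝ} (f g : ℝ → ℝ) (h : x ≤ x₀) : glue x₀ f g x = f x := if_pos h

lemma glue_of_ge {x₀ x : ℝ} {f g : ℝ → ℝ} (h₀ : f x₀ = g x₀) (h : x₀ ≤ x) :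
    glue x₀ f g x = g x := by
  rcases h.eq_or_lt with rfl | h
  · rw [glue_of_le _ _ le_rfl, h₀]
  · exact if_neg (not_le.2 h)

lemma hasDerivAt_glue {x₀ T x d : ℝ} {f g : ℝ → ℝ} (h₀ : f x₀ = g x₀) (hxT : x < T)
    (hf : x ≤ x₀ → HasDerivAt f d x) (hg : x₀ ≤ x → HasDerivWithinAt g d (Icc x₀ T) x) :
    HasDerivAt (glue x₀ f g) d x := by
  rcases lt_trichotomy x x₀ with h | h | h
  · refine (hf h.le).congr_of_eventuallyEq ?_
    filter_upwards [Iio_mem_nhds h] with y hy using glue_of_le _ _ (mem_Iio.1 hy).le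
  · subst h
    have h1 : HasDerivWithinAt (glue x f g) d (Iic x) x :=
      (hf le_rfl).hasDerivWithinAt.congr (fun y hy => glue_of_le _ _ hy) (glue_of_le _ _ le_rfl)
    have h2 : HasDerivWithinAt (glue x f g) d (Icc x T) x :=
      (hg le_rfl).congr (fun y hy => glue_of_ge h₀ hy.1) (glue_of_ge h₀ le_rfl)
    refine (h1.union h2).hasDerivAt (mem_of_superset (Iio_mem_nhds hxT) fun y hy => ?_)
    rcases le_total y x with h | h
    · exact Or.inl h
    · exact Or.inr ⟨h, (mem_Iio.1 hy).le⟩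
  · refine ((hg h.le).hasDerivAt (Icc_mem_nhds h hxT)).congr_of_eventuallyEq ?_
    filter_upwards [Ioi_mem_nhds h] with y hy using glue_of_ge h₀ (mem_Ioi.1 hy).le

/-! ### Films that follow the local family near the contact line -/

/-- The curve `x ↦ (x, b x ^ β, μ x ^ (2 ν + 2))` along which the local family is evaluated. -/
def par (ν β b μ x : ℝ) : ℝ × ℝ × ℝ := (x, b * x ^ β, μ * x ^ (2 * ν + 2))

/-- The profile `c x ^ e f(P)`, where `P` is the point `par ν β b μ x`. -/
def along (ν β c e : ℝ) (f : ℝ × ℝ × ℝ → ℝ) (b μ x : ℝ) : ℝ := c * x ^ e * f (par ν β b μ x)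

/-- The exponents, a local family `u, v, w` on the ball of radius `r`, and the size `ε` of a
box contained in this ball. -/
structure ContactData (n ν β ς A c r κ C ε : ℝ) (u v w : ℝ × ℝ × ℝ → ℝ) : Prop where
  exps : WaveExponents n ν β ς A
  fam : LocalFamily n ν β c r κ C u v w
  c_pos : 0 < c
  c_rpow : c ^ (-n) = A
  ε_pos : 0 < ε
  ε_lt_one : ε < 1
  ε_lt : ε < r

/-- A film of parameter `μ` on `(0, 1]` that is flat at `1`, and that follows the local family
with parameter `b` near `0`. Here `G = H'` and `Q = H'' - μ H ^ 3 / 3`. -/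
structure IsFilm (n ν β c : ℝ) (u v w : ℝ × ℝ × ℝ → ℝ) (b μ : ℝ) (H G Q : ℝ → ℝ) : Prop where
  b_pos : 0 < b
  traj : IsTraj (mob n) (grav μ) 1 H G Q
  pos : ∀ x ∈ Ioc (0 : ℝ) 1, 0 < H x
  slope_nonneg : ∀ x ∈ Ioc (0 : ℝ) 1, 0 ≤ G x
  flat : G 1 = 0
  zero : H 0 = 0
  near : ∀ᶠ x in 𝓝[>] 0, H x = along ν β c ν (fun p => 1 + u p) b μ x ∧
    G x = along ν β c (ν - 1) v b μ x ∧ Q x = along ν β c (ν - 2) w b μ x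

namespace ContactData

variable {n ν β ς A c r κ C ε : ℝ} {u v w : ℝ × ℝ × ℝ → ℝ}

lemma mem_ball_of_mem_box (S : ContactData n ν β ς A c r κ C ε u v w) {p : ℝ × ℝ × ℝ}
    (hp : p ∈ box ε) : p ∈ Metric.ball (0 : ℝ × ℝ × ℝ) r := by
  obtain ⟨⟨h1, h2⟩, ⟨h3, h4⟩, ⟨h5, h6⟩⟩ := hp
  have h0 := S.ε_pos
  have h7 := S.ε_lt_one
  have h8 := S.ε_lt
  have h9 : ε ^ 2 ≤ ε := by nlinarith
  rw [mem_ball_zero_iff]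
  refine max_lt ?_ (max_lt ?_ ?_) <;> rw [Real.norm_of_nonneg (by assumption)] <;> linarith

lemma tendsto_par (S : ContactData n ν β ς A c r κ C ε u v w) (b μ : ℝ) :
    Tendsto (par ν β b μ) (𝓝[>] 0) (𝓝 0) := by
  have h1 := S.exps.beta_pos
  have h2 := S.exps.one_lt
  have : ContinuousAt (par ν β b μ) 0 :=
    continuousAt_id.prodMk ((continuousAt_const.mul
      (Real.continuousAt_rpow_const _ _ (Or.inr h1.le))).prodMk (continuousAt_const.mul
      (Real.continuousAt_rpow_const _ _ (Or.inr (by linarith)))))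
  have h3 : par ν β b μ 0 = 0 := by
    simp [par, Real.zero_rpow h1.ne', Real.zero_rpow (by linarith : 2 * ν + 2 ≠ 0)]
  simpa [ContinuousAt, h3] using this.mono_left nhdsWithin_le_nhds

lemma eventually_par_mem (S : ContactData n ν β ς A c r κ C ε u v w) (b μ : ℝ) :
    ∀ᶠ x in 𝓝[>] 0, par ν β b μ x ∈ Metric.ball (0 : ℝ × ℝ × ℝ) r :=
  (S.tendsto_par b μ).eventually (Metric.ball_mem_nhds _ S.fam.r_pos)

lemma tendsto_along (S : ContactData n ν β ς A c r κ C ε u v w) {e : ℝ} (he : 0 < e)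
    {f : ℝ × ℝ × ℝ → ℝ} (hf : ContinuousOn f (Metric.ball 0 r)) (b μ : ℝ) :
    Tendsto (along ν β c e f b μ) (𝓝[>] 0) (𝓝 0) := by
  have h1 : ContinuousAt (fun x : ℝ => c * x ^ e) 0 :=
    continuousAt_const.mul (Real.continuousAt_rpow_const _ _ (Or.inr he.le))
  have h2 := (hf.continuousAt (Metric.ball_mem_nhds _ S.fam.r_pos)).tendsto.comp (S.tendsto_par b μ)
  have h3 := (h1.tendsto.mono_left (nhdsWithin_le_nhds (s := Ioi 0))).mul h2
  change Tendsto (fun x => c * x ^ e * f (par ν β b μ x)) _ _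
  simpa [Real.zero_rpow he.ne'] using h3

lemma tendsto_height (S : ContactData n ν β ς A c r κ C ε u v w) (b μ : ℝ) :
    Tendsto (along ν β c ν (fun p => 1 + u p) b μ) (𝓝[>] 0) (𝓝 0) :=
  S.tendsto_along (by linarith [S.exps.one_lt])
    (continuousOn_const.add S.fam.analyticOnNhd_u.continuousOn) b μ

lemma tendsto_slope (S : ContactData n ν β ς A c r κ C ε u v w) (b μ : ℝ) :
    Tendsto (along ν β c (ν - 1) v b μ) (𝓝[>] 0) (𝓝 0) :=
  S.tendsto_along (by linarith [S.exps.one_lt]) S.fam.continuousOn_v b μ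

lemma norm_par_le (S : ContactData n ν β ς A c r κ C ε u v w) (b μ : ℝ) {x : ℝ} (hx : 0 < x)
    (hx1 : x ≤ 1) : ‖par ν β b μ x‖ ≤ (1 + |b| + |μ|) * x ^ β := by
  have h1 := S.exps.one_lt
  have h2 : β < 1 := S.exps.lt_sigma.trans_le S.exps.sigma_le_one
  have h3 : 0 < x ^ β := Real.rpow_pos_of_pos hx β
  have h4 : x ≤ x ^ β := by
    simpa using Real.rpow_le_rpow_of_exponent_ge hx hx1 h2.le
  have h5 : x ^ (2 * ν + 2) ≤ x ^ β :=
    Real.rpow_le_rpow_of_exponent_ge hx hx1 (by linarith)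
  have h6 := abs_nonneg b
  have h7 := abs_nonneg μ
  refine max_le ?_ (max_le ?_ ?_)
  · rw [par, Real.norm_of_nonneg hx.le]
    nlinarith [mul_nonneg h6 h3.le, mul_nonneg h7 h3.le]
  · rw [par, norm_mul, Real.norm_of_nonneg h3.le, Real.norm_eq_abs]
    nlinarith [mul_nonneg h6 h3.le, mul_nonneg h7 h3.le]
  · rw [par, norm_mul, Real.norm_of_nonneg (Real.rpow_nonneg hx.le _), Real.norm_eq_abs]
    nlinarith [mul_nonneg h6 h3.le, mul_le_mul_of_nonneg_left h5 h7]

/-- The flux is unbounded at the contact line, but its singular part does not depend on `b` or `μ`;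
this is where `ν + β > 2` enters. -/
lemma tendsto_flux (S : ContactData n ν β ς A c r κ C ε u v w) (b μ : ℝ) :
    Tendsto (fun x => along ν β c (ν - 2) w b μ x - c * x ^ (ν - 2) * (ν * (ν - 1)))
      (𝓝[>] 0) (𝓝 0) := by
  have hc := S.c_pos
  have he : 0 < ν - 2 + β := by linarith [S.exps.two_lt]
  have h1 : Tendsto (fun x : ℝ => c * |C| * (1 + |b| + |μ|) * x ^ (ν - 2 + β)) (𝓝[>] 0) (𝓝 0) := by
    have : ContinuousAt (fun x : ℝ => c * |C| * (1 + |b| + |μ|) * x ^ (ν - 2 + β)) 0 :=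
      continuousAt_const.mul (Real.continuousAt_rpow_const _ _ (Or.inr he.le))
    simpa [ContinuousAt, Real.zero_rpow he.ne'] using this.mono_left nhdsWithin_le_nhds
  refine squeeze_zero_norm' ?_ h1
  filter_upwards [S.eventually_par_mem b μ, Ioc_mem_nhdsGT one_pos] with x hx hx1
  rw [along, ← mul_sub, norm_mul, Real.norm_of_nonneg (by have := hx1.1.le; positivity),
    Real.norm_eq_abs, Real.rpow_add hx1.1]
  have h2 := S.fam.abs_w_sub_le _ hx
  have h3 : C * ‖par ν β b μ x‖ ≤ |C| * ((1 + |b| + |μ|) * x ^ β) :=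
    mul_le_mul (le_abs_self C) (S.norm_par_le b μ hx1.1 hx1.2) (norm_nonneg _) (abs_nonneg _)
  calc c * x ^ (ν - 2) * |w (par ν β b μ x) - ν * (ν - 1)|
      ≤ c * x ^ (ν - 2) * (|C| * ((1 + |b| + |μ|) * x ^ β)) :=
        mul_le_mul_of_nonneg_left (h2.trans h3) (by have := hx1.1.le; positivity)
    _ = c * |C| * (1 + |b| + |μ|) * (x ^ (ν - 2) * x ^ β) := by ring

lemma tendsto_flux_sub (S : ContactData n ν β ς A c r κ C ε u v w) (b b' μ μ' : ℝ) :
    Tendsto (fun x => along ν β c (ν - 2) w b μ x - along ν β c (ν - 2) w b' μ' x)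
      (𝓝[>] 0) (𝓝 0) := by
  simpa using (S.tendsto_flux b μ).sub (S.tendsto_flux b' μ')

lemma isTraj_along (S : ContactData n ν β ς A c r κ C ε u v w) {b μ X : ℝ}
    (h : ∀ x ∈ Ioc 0 X, par ν β b μ x ∈ Metric.ball (0 : ℝ × ℝ × ℝ) r) :
    IsTraj (mob n) (grav μ) X (along ν β c ν (fun p => 1 + u p) b μ)
      (along ν β c (ν - 1) v b μ) (along ν β c (ν - 2) w b μ) where
  dH x hx := (S.fam.ode b μ x hx.1 (h x hx)).1
  dG x hx := (S.fam.ode b μ x hx.1 (h x hx)).2.1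
  dQ x hx := (S.fam.ode b μ x hx.1 (h x hx)).2.2

lemma height_bounds (S : ContactData n ν β ς A c r κ C ε u v w) {b μ x : ℝ} (hx : 0 < x)
    (h : par ν β b μ x ∈ Metric.ball (0 : ℝ × ℝ × ℝ) r) :
    c / 2 * x ^ ν ≤ along ν β c ν (fun p => 1 + u p) b μ x ∧
      along ν β c ν (fun p => 1 + u p) b μ x ≤ 3 / 2 * c * x ^ ν := by
  have h1 := abs_le.1 (S.fam.abs_u_le _ h)
  have h2 := Real.rpow_pos_of_pos hx ν
  have h3 := mul_pos S.c_pos h2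
  rw [along]
  constructor <;> nlinarith

lemma height_pos (S : ContactData n ν β ς A c r κ C ε u v w) {b μ x : ℝ} (hx : 0 < x)
    (h : par ν β b μ x ∈ Metric.ball (0 : ℝ × ℝ × ℝ) r) :
    0 < along ν β c ν (fun p => 1 + u p) b μ x :=
  (mul_pos (half_pos S.c_pos) (Real.rpow_pos_of_pos hx ν)).trans_le (S.height_bounds hx h).1

lemma slope_pos (S : ContactData n ν β ς A c r κ C ε u v w) {b μ x : ℝ} (hx : 0 < x)
    (h : par ν β b μ x ∈ Metric.ball (0 : ℝ × ℝ × ℝ) r) :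
    0 < along ν β c (ν - 1) v b μ x :=
  mul_pos (mul_pos S.c_pos (Real.rpow_pos_of_pos hx _)) (S.fam.v_pos _ h)

lemma slope_along_le (S : ContactData n ν β ς A c r κ C ε u v w) {b μ x : ℝ} (hx : 0 < x)
    (h : par ν β b μ x ∈ Metric.ball (0 : ℝ × ℝ × ℝ) r) :
    along ν β c (ν - 1) v b μ x ≤ 2 * ν * c * x ^ (ν - 1) := by
  have h1 := mul_le_mul_of_nonneg_left (S.fam.v_le _ h)
    (mul_pos S.c_pos (Real.rpow_pos_of_pos hx (ν - 1))).le
  rw [along]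
  linarith

lemma height_lt (S : ContactData n ν β ς A c r κ C ε u v w) {b b' μ x : ℝ} (hx : 0 < x)
    (h : par ν β b μ x ∈ Metric.ball (0 : ℝ × ℝ × ℝ) r)
    (h' : par ν β b' μ x ∈ Metric.ball (0 : ℝ × ℝ × ℝ) r) (hb : b < b') :
    along ν β c ν (fun p => 1 + u p) b' μ x < along ν β c ν (fun p => 1 + u p) b μ x := by
  have h1 := S.fam.u_anti x (b * x ^ β) (b' * x ^ β) _ h h'
    (mul_lt_mul_of_pos_right hb (Real.rpow_pos_of_pos hx β))
  exact mul_lt_mul_of_pos_left (by simpa [par] using h1)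
    (mul_pos S.c_pos (Real.rpow_pos_of_pos hx ν))

lemma eventually_height_lt (S : ContactData n ν β ς A c r κ C ε u v w) {b b' : ℝ} (μ : ℝ)
    (hb : b < b') : ∀ᶠ x in 𝓝[>] 0,
    along ν β c ν (fun p => 1 + u p) b' μ x < along ν β c ν (fun p => 1 + u p) b μ x := by
  filter_upwards [S.eventually_par_mem b μ, S.eventually_par_mem b' μ, self_mem_nhdsWithin]
    with x h h' hx using S.height_lt hx h h' hb

/-- The box is star-shaped along the curves `par ν β b μ`. -/
lemma par_mem_box (S : ContactData n ν β ς A c r κ C ε u v w) {b μ x X : ℝ} (hb : 0 ≤ b)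
    (hμ : 0 ≤ μ) (hX : par ν β b μ X ∈ box ε) (hx : 0 ≤ x) (hxX : x ≤ X) :
    par ν β b μ x ∈ box ε := by
  obtain ⟨⟨_, h2⟩, ⟨_, h4⟩, ⟨_, h6⟩⟩ := hX
  have h1 := S.exps.beta_pos.le
  have h3 := S.exps.one_lt
  refine ⟨⟨hx, hxX.trans h2⟩, ⟨mul_nonneg hb (Real.rpow_nonneg hx _), le_trans ?_ h4⟩,
    ⟨mul_nonneg hμ (Real.rpow_nonneg hx _), le_trans ?_ h6⟩⟩
  · exact mul_le_mul_of_nonneg_left (Real.rpow_le_rpow hx hxX h1) hb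
  · exact mul_le_mul_of_nonneg_left (Real.rpow_le_rpow hx hxX (by linarith)) hμ

/-- A film is determined by `μ`: the comparison principle fixes `b`, because the slopes at `1` would
otherwise differ, and films with the same `b` agree near `0`. -/
theorem film_unique (S : ContactData n ν β ς A c r κ C ε u v w) {b b' μ : ℝ} (hμ : 0 ≤ μ)
    {H G Q H' G' Q' : ℝ → ℝ} (h : IsFilm n ν β c u v w b μ H G Q)
    (h' : IsFilm n ν β c u v w b' μ H' G' Q') : b = b' ∧ ∀ x ∈ Icc (0 : ℝ) 1, H x = H' x := by
  have lt_absurd : ∀ {b b' : ℝ} {H G Q H' G' Q' : ℝ → ℝ}, IsFilm n ν β c u v w b μ H G Q →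
      IsFilm n ν β c u v w b' μ H' G' Q' → ¬ b < b' := by
    intro b b' H G Q H' G' Q' h h' hb
    have hn := S.exps.one_lt_n
    have := h.traj.comparison h'.traj le_rfl
      (fun x hx hlt => Real.rpow_le_rpow_of_nonpos (h'.pos x hx) hlt.le (by linarith))
      (fun x hx hlt => by
        have := pow_le_pow_left₀ (h'.pos x hx).le hlt.le 3
        exact mul_le_mul_of_nonneg_left this (by linarith))
      (by
        have e := (S.tendsto_height b μ).sub (S.tendsto_height b' μ)
        rw [sub_zero] at e
        refine e.congr' ?_
        filter_upwards [h.near, h'.near] with x e1 e2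
        rw [e1.1, e2.1])
      (by
        have e := (S.tendsto_slope b μ).sub (S.tendsto_slope b' μ)
        rw [sub_zero] at e
        refine e.congr' ?_
        filter_upwards [h.near, h'.near] with x e1 e2
        rw [e1.2.1, e2.2.1])
      (by
        refine (S.tendsto_flux_sub b b' μ μ).congr' ?_
        filter_upwards [h.near, h'.near] with x e1 e2
        rw [e1.2.2, e2.2.2])
      (by
        filter_upwards [h.near, h'.near, S.eventually_height_lt μ hb] with x e1 e2 e3
        rwa [e1.1, e2.1])
    have h1 := (this.1 1 ⟨one_pos, le_rfl⟩).2.1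
    rw [h.flat, h'.flat] at h1
    exact lt_irrefl _ h1
  have hb : b = b' := le_antisymm (not_lt.1 (lt_absurd h' h)) (not_lt.1 (lt_absurd h h'))
  refine ⟨hb, fun x hx => ?_⟩
  subst hb
  rcases hx.1.eq_or_lt with rfl | hx0
  · rw [h.zero, h'.zero]
  obtain ⟨y, ⟨hy, hy'⟩, hyx⟩ := ((h.near.and h'.near).and (Ioc_mem_nhdsGT hx0)).exists
  exact h.traj.unique S.exps.one_lt_n hμ h'.traj le_rfl h.pos h'.pos hyx.1 (hy.1.trans hy'.1.symm)
    (hy.2.1.trans hy'.2.1.symm) (hy.2.2.trans hy'.2.2.symm) x ⟨hyx.2, hx.2⟩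

/-- A film follows the local family throughout the box. -/
theorem film_eq_along (S : ContactData n ν β ς A c r κ C ε u v w) {b μ : ℝ} (hμ : 0 ≤ μ)
    {H G Q : ℝ → ℝ} (h : IsFilm n ν β c u v w b μ H G Q) {x : ℝ} (hx : 0 ≤ x)
    (hbox : par ν β b μ x ∈ box ε) : H x = along ν β c ν (fun p => 1 + u p) b μ x := by
  have hν := S.exps.one_lt
  rcases hx.eq_or_lt with rfl | hx0
  · rw [h.zero, along, Real.zero_rpow (by linarith)]
    ring
  have hball : ∀ y ∈ Ioc 0 x, par ν β b μ y ∈ Metric.ball (0 : ℝ × ℝ × ℝ) r := fun y hy =>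
    S.mem_ball_of_mem_box (S.par_mem_box h.b_pos.le hμ hbox hy.1.le hy.2)
  have hx1 : x ≤ 1 := by
    have h1 : x ≤ ε ^ 2 := hbox.1.2
    have h2 := S.ε_pos
    have h3 := S.ε_lt_one
    nlinarith
  obtain ⟨y, hy, hyx⟩ := (h.near.and (Ioc_mem_nhdsGT hx0)).exists
  exact (h.traj.mono hx1).unique S.exps.one_lt_n hμ (S.isTraj_along hball) hx1
    (fun z hz => h.pos z ⟨hz.1, hz.2.trans hx1⟩) (fun z hz => S.height_pos hz.1 (hball z hz))
    hyx.1 hy.1 hy.2.1 hy.2.2 x ⟨hyx.2, le_rfl⟩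

end ContactData

/-! ### The shooting problem -/

/-- The mobility `s ^ (1 - n)`, cut off at half the leading-order profile at `min x x₀`. -/
def cutMob (n ν c x₀ : ℝ) : ℝ → ℝ → ℝ := fun x s => max s (c / 2 * min x x₀ ^ ν) ^ (1 - n)

/-- The parameters `(b, μ)` of the shooting problem: `μ ≤ m`, and `b` is such that the local family
can be followed up to `x₀` inside the box. -/
def shootDomain (β ε m x₀ : ℝ) : Set (ℝ × ℝ) := Icc 0 (ε / x₀ ^ β) ×ˢ Icc 0 m

/-- Trajectories `H b μ` of the truncated system on `(0, 1]` that follow the local family up to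
`x₀`, depending continuously on `b` and `μ`. -/
structure Shooting (n ν β ς A c r κ C ε : ℝ) (u v w : ℝ × ℝ × ℝ → ℝ) (m x₀ K : ℝ)
    (H G Q : ℝ → ℝ → ℝ → ℝ) : Prop where
  data : ContactData n ν β ς A c r κ C ε u v w
  x₀_pos : 0 < x₀
  x₀_le : x₀ ≤ ε ^ 2
  gravity_le : m * x₀ ^ (2 * ν + 2) ≤ ε ^ 2
  le_K : 3 / 2 * c ≤ K
  traj : ∀ p ∈ shootDomain β ε m x₀,
    IsTraj (cutMob n ν c x₀) (fun s => p.2 / 3 * cutCube K s) 1 (H p.1 p.2) (G p.1 p.2) (Q p.1 p.2)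
  near : ∀ p ∈ shootDomain β ε m x₀, ∀ x ≤ x₀,
    H p.1 p.2 x = along ν β c ν (fun p => 1 + u p) p.1 p.2 x ∧
    G p.1 p.2 x = along ν β c (ν - 1) v p.1 p.2 x ∧ Q p.1 p.2 x = along ν β c (ν - 2) w p.1 p.2 x
  continuousOn_H : ∀ x ∈ Ioc (0 : ℝ) 1,
    ContinuousOn (fun p : ℝ × ℝ => H p.1 p.2 x) (shootDomain β ε m x₀)
  continuousOn_G : ContinuousOn (fun p : ℝ × ℝ => G p.1 p.2 1) (shootDomain β ε m x₀)

lemma cutMob_pos {n ν c x₀ x : ℝ} (hc : 0 < c) (hx₀ : 0 < x₀) (hx : 0 < x) (s : ℝ) :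
    0 < cutMob n ν c x₀ x s :=
  rpow_max_pos (mul_pos (half_pos hc) (Real.rpow_pos_of_pos (lt_min hx hx₀) _)) _ _

lemma cutMob_anti {n ν c x₀ x s t : ℝ} (hn : 1 < n) (hc : 0 < c) (hx₀ : 0 < x₀) (hx : 0 < x)
    (h : s ≤ t) : cutMob n ν c x₀ x t ≤ cutMob n ν c x₀ x s :=
  Real.rpow_le_rpow_of_nonpos ((mul_pos (half_pos hc)
    (Real.rpow_pos_of_pos (lt_min hx hx₀) _)).trans_le (le_max_right _ _))
    (max_le_max h le_rfl) (by linarith)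

lemma cutMob_of_le {n ν c x₀ x s : ℝ} (h : c / 2 * min x x₀ ^ ν ≤ s) :
    cutMob n ν c x₀ x s = mob n x s := by
  rw [cutMob, max_eq_left h, mob]

namespace ContactData

variable {n ν β ς A c r κ C ε : ℝ} {u v w : ℝ × ℝ × ℝ → ℝ}

lemma mem_box_of_mem_shootDomain (S : ContactData n ν β ς A c r κ C ε u v w) {m x₀ : ℝ}
    (hx₀ : 0 < x₀) (hx₀ε : x₀ ≤ ε ^ 2) (hm : m * x₀ ^ (2 * ν + 2) ≤ ε ^ 2) {p : ℝ × ℝ}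
    (hp : p ∈ shootDomain β ε m x₀) {x : ℝ} (hx : 0 ≤ x) (hxx : x ≤ x₀) :
    par ν β p.1 p.2 x ∈ box ε := by
  obtain ⟨⟨h1, h2⟩, ⟨h3, h4⟩⟩ := hp
  have h5 := Real.rpow_pos_of_pos hx₀ (2 * ν + 2)
  exact S.par_mem_box h1 h3 ⟨⟨hx₀.le, hx₀ε⟩,
    ⟨mul_nonneg h1 (Real.rpow_nonneg hx₀.le _), (le_div_iff₀ (Real.rpow_pos_of_pos hx₀ β)).1 h2⟩,
    ⟨mul_nonneg h3 h5.le, (mul_le_mul_of_nonneg_right h4 h5.le).trans hm⟩⟩ hx hxx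

lemma continuousOn_along (S : ContactData n ν β ς A c r κ C ε u v w) {m x₀ : ℝ}
    (hx₀ : 0 < x₀) (hx₀ε : x₀ ≤ ε ^ 2) (hm : m * x₀ ^ (2 * ν + 2) ≤ ε ^ 2) {e : ℝ}
    {f : ℝ × ℝ × ℝ → ℝ} (hf : ContinuousOn f (Metric.ball 0 r)) {x : ℝ} (hx : 0 ≤ x)
    (hxx : x ≤ x₀) :
    ContinuousOn (fun p : ℝ × ℝ => along ν β c e f p.1 p.2 x) (shootDomain β ε m x₀) := by
  refine continuousOn_const.mul (hf.comp (Continuous.continuousOn ?_) fun p hp =>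
    S.mem_ball_of_mem_box (S.mem_box_of_mem_shootDomain hx₀ hx₀ε hm hp hx hxx))
  unfold par
  fun_prop

/-- Up to `x₀` the truncations do not affect the local family, so it can be continued by the flow of
the truncated system. -/
theorem exists_shooting (S : ContactData n ν β ς A c r κ C ε u v w) {m x₀ K : ℝ} (hm : 0 ≤ m)
    (hx₀ : 0 < x₀) (hx₀ε : x₀ ≤ ε ^ 2) (hmx : m * x₀ ^ (2 * ν + 2) ≤ ε ^ 2)
    (hK : 3 / 2 * c ≤ K) :
    ∃ H G Q : ℝ → ℝ → ℝ → ℝ, Shooting n ν β ς A c r κ C ε u v w m x₀ K H G Q := by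
  have hc := S.c_pos
  have hn := S.exps.one_lt_n
  have hν := S.exps.one_lt
  have hx1 : x₀ ≤ 1 := by
    have h2 := S.ε_pos
    have h3 := S.ε_lt_one
    nlinarith
  have hδ : 0 < c / 2 * x₀ ^ ν := mul_pos (half_pos hc) (Real.rpow_pos_of_pos hx₀ _)
  have hfu : ContinuousOn (fun p => 1 + u p) (Metric.ball 0 r) :=
    continuousOn_const.add S.fam.analyticOnNhd_u.continuousOn
  set D := shootDomain β ε m x₀ with hD
  have hDc : IsCompact D := isCompact_Icc.prod isCompact_Icc
  set y : ℝ × ℝ → ℝ × ℝ × ℝ × ℝ := fun p => (along ν β c ν (fun p => 1 + u p) p.1 p.2 x₀,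
    along ν β c (ν - 1) v p.1 p.2 x₀, along ν β c (ν - 2) w p.1 p.2 x₀, p.2) with hy
  have hyc : ContinuousOn y D :=
    (S.continuousOn_along hx₀ hx₀ε hmx hfu hx₀.le le_rfl).prodMk
      ((S.continuousOn_along hx₀ hx₀ε hmx S.fam.continuousOn_v hx₀.le le_rfl).prodMk
      ((S.continuousOn_along hx₀ hx₀ε hmx S.fam.continuousOn_w hx₀.le le_rfl).prodMk
      continuousOn_snd))
  obtain ⟨B₀, hB₀⟩ := hDc.exists_bound_of_continuousOn hyc
  obtain ⟨Φ, hΦ, hΦc⟩ := exists_filmFlow (m := m) (B₀ := max B₀ 0) hn hδ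
    (by linarith : 0 ≤ K) hm hx₀.le (by linarith) (le_max_right _ _)
  have hyB : ∀ p ∈ D, ‖y p‖ ≤ max B₀ 0 := fun p hp => (hB₀ p hp).trans (le_max_left _ _)
  have hflow : ∀ x ∈ Icc x₀ 2, ContinuousOn (fun p => Φ (y p) x) D := fun x hx =>
    (hΦc x hx).comp hyc hyB
  have h0 : ∀ p ∈ D, Φ (y p) x₀ = y p := fun p hp => (hΦ _ (hyB p hp) hp.2).1
  refine ⟨fun b μ => glue x₀ (along ν β c ν (fun p => 1 + u p) b μ) fun x => (Φ (y (b, μ)) x).1,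
    fun b μ => glue x₀ (along ν β c (ν - 1) v b μ) fun x => (Φ (y (b, μ)) x).2.1,
    fun b μ => glue x₀ (along ν β c (ν - 2) w b μ) fun x => (Φ (y (b, μ)) x).2.2.1, S, hx₀, hx₀ε,
    hmx, hK, fun p hp => ?_, fun p hp x hx => ⟨glue_of_le _ _ hx, glue_of_le _ _ hx,
      glue_of_le _ _ hx⟩, fun x hx => ?_, ?_⟩
  · have hbox : ∀ x ∈ Ioc 0 x₀, par ν β p.1 p.2 x ∈ Metric.ball (0 : ℝ × ℝ × ℝ) r := fun x hx =>
      S.mem_ball_of_mem_box (S.mem_box_of_mem_shootDomain hx₀ hx₀ε hmx hp hx.1.le hx.2)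
    have g1 : along ν β c ν (fun p => 1 + u p) p.1 p.2 x₀ = (Φ (y p) x₀).1 := by rw [h0 p hp]
    have g2 : along ν β c (ν - 1) v p.1 p.2 x₀ = (Φ (y p) x₀).2.1 := by rw [h0 p hp]
    have g3 : along ν β c (ν - 2) w p.1 p.2 x₀ = (Φ (y p) x₀).2.2.1 := by rw [h0 p hp]
    have loc := S.isTraj_along hbox
    have hd := (hΦ _ (hyB p hp) hp.2).2
    have hK' : ∀ x ∈ Ioc 0 x₀,
        along ν β c ν (fun p => 1 + u p) p.1 p.2 x ∈ Icc 0 K := fun x hx => by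
      refine ⟨(S.height_pos hx.1 (hbox x hx)).le, (S.height_bounds hx.1 (hbox x hx)).2.trans ?_⟩
      have : x ^ ν ≤ 1 := Real.rpow_le_one hx.1.le (hx.2.trans hx1) (by linarith)
      nlinarith
    refine ⟨fun x hx => ?_, fun x hx => ?_, fun x hx => ?_⟩
    · refine hasDerivAt_glue g1 (by linarith [hx.2] : x < 2) (fun h => ?_) fun h => ?_
      · rw [glue_of_le _ _ h]
        exact loc.dH x ⟨hx.1, h⟩
      · rw [glue_of_ge g2 h]
        exact (hd x ⟨h, by linarith [hx.2]⟩).1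
    · refine hasDerivAt_glue g2 (by linarith [hx.2] : x < 2) (fun h => ?_) fun h => ?_
      · rw [glue_of_le _ _ h, glue_of_le _ _ h, cutCube_of_mem (hK' x ⟨hx.1, h⟩)]
        exact loc.dG x ⟨hx.1, h⟩
      · rw [glue_of_ge g3 h, glue_of_ge g1 h]
        exact (hd x ⟨h, by linarith [hx.2]⟩).2.1
    · refine hasDerivAt_glue g3 (by linarith [hx.2] : x < 2) (fun h => ?_) fun h => ?_
      · rw [glue_of_le _ _ h, cutMob_of_le (by
          rw [min_eq_left h]
          exact (S.height_bounds hx.1 (hbox x ⟨hx.1, h⟩)).1)]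
        exact loc.dQ x ⟨hx.1, h⟩
      · rw [glue_of_ge g1 h, cutMob, min_eq_right h]
        exact (hd x ⟨h, by linarith [hx.2]⟩).2.2
  · rcases le_or_gt x x₀ with h | h
    · simp only [glue_of_le _ _ h]
      exact S.continuousOn_along hx₀ hx₀ε hmx hfu hx.1.le h
    · refine (continuous_fst.comp_continuousOn (hflow x ⟨h.le, by linarith [hx.2]⟩)).congr
        fun p hp => if_neg (not_le.2 h)
  · rcases hx1.eq_or_lt with h | h
    · simp only [glue_of_le _ _ h.ge]
      exact S.continuousOn_along hx₀ hx₀ε hmx S.fam.continuousOn_v zero_le_one h.ge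
    · refine (continuous_fst.comp_continuousOn (continuous_snd.comp_continuousOn
        (hflow 1 ⟨h.le, by norm_num⟩))).congr fun p hp => if_neg (not_le.2 h)

end ContactData

namespace Shooting

variable {n ν β ς A c r κ C ε : ℝ} {u v w : ℝ × ℝ × ℝ → ℝ} {m x₀ K : ℝ} {H G Q : ℝ → ℝ → ℝ → ℝ}

lemma mem_ball (T : Shooting n ν β ς A c r κ C ε u v w m x₀ K H G Q) {p : ℝ × ℝ}
    (hp : p ∈ shootDomain β ε m x₀) {x : ℝ} (hx : 0 ≤ x) (hxx : x ≤ x₀) :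
    par ν β p.1 p.2 x ∈ Metric.ball (0 : ℝ × ℝ × ℝ) r :=
  T.data.mem_ball_of_mem_box
    (T.data.mem_box_of_mem_shootDomain T.x₀_pos T.x₀_le T.gravity_le hp hx hxx)

lemma x₀_lt_one (T : Shooting n ν β ς A c r κ C ε u v w m x₀ K H G Q) : x₀ < 1 := by
  have h1 := T.x₀_le
  have h2 := T.data.ε_pos
  have h3 := T.data.ε_lt_one
  nlinarith

lemma K_pos (T : Shooting n ν β ς A c r κ C ε u v w m x₀ K H G Q) : 0 < K := by
  linarith [T.le_K, T.data.c_pos]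

lemma eventually_near (T : Shooting n ν β ς A c r κ C ε u v w m x₀ K H G Q) {p : ℝ × ℝ}
    (hp : p ∈ shootDomain β ε m x₀) : ∀ᶠ x in 𝓝[>] 0,
      H p.1 p.2 x = along ν β c ν (fun p => 1 + u p) p.1 p.2 x ∧
      G p.1 p.2 x = along ν β c (ν - 1) v p.1 p.2 x ∧
      Q p.1 p.2 x = along ν β c (ν - 2) w p.1 p.2 x :=
  mem_of_superset (Ioc_mem_nhdsGT T.x₀_pos) fun x hx => T.near p hp x hx.2

/-- The final slope decreases with the shooting parameter. -/
lemma slope_strictAnti (T : Shooting n ν β ς A c r κ C ε u v w m x₀ K H G Q) {b b' μ : ℝ}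
    (hb : (b, μ) ∈ shootDomain β ε m x₀) (hb' : (b', μ) ∈ shootDomain β ε m x₀) (hlt : b < b') :
    G b' μ 1 < G b μ 1 := by
  have S := T.data
  have hμ : 0 ≤ μ := hb.2.1
  have e1 := T.eventually_near hb
  have e2 := T.eventually_near hb'
  have := (T.traj _ hb).comparison (T.traj _ hb') le_rfl
    (fun x hx hlt => cutMob_anti S.exps.one_lt_n S.c_pos T.x₀_pos hx.1 hlt.le)
    (fun x hx hlt => mul_le_mul_of_nonneg_left (cutCube_mono K hlt.le) (by positivity))
    (by
      have e := (S.tendsto_height b μ).sub (S.tendsto_height b' μ)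
      rw [sub_zero] at e
      refine e.congr' ?_
      filter_upwards [e1, e2] with x e1 e2
      rw [e1.1, e2.1])
    (by
      have e := (S.tendsto_slope b μ).sub (S.tendsto_slope b' μ)
      rw [sub_zero] at e
      refine e.congr' ?_
      filter_upwards [e1, e2] with x e1 e2
      rw [e1.2.1, e2.2.1])
    (by
      refine (S.tendsto_flux_sub b b' μ μ).congr' ?_
      filter_upwards [e1, e2] with x e1 e2
      rw [e1.2.2, e2.2.2])
    (by
      filter_upwards [e1, e2, S.eventually_height_lt μ hlt] with x e1 e2 e3
      rwa [e1.1, e2.1])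
  exact (this.1 1 ⟨one_pos, le_rfl⟩).2.1

/-- With parameter `b = 0` the film lies above the profile `c x ^ ν`, which solves the equation with
`x - 1` replaced by `-1` and without gravity. -/
lemma slope_zero_pos (T : Shooting n ν β ς A c r κ C ε u v w m x₀ K H G Q) {μ : ℝ}
    (h0 : (0, μ) ∈ shootDomain β ε m x₀) : 0 < G 0 μ 1 := by
  have S := T.data
  have hc := S.c_pos
  have hμ : 0 ≤ μ := h0.2.1
  have hν := S.exps.one_lt
  have e1 := T.eventually_near h0
  have tr := T.traj _ h0
  have zero : ∀ {e : ℝ}, 0 < e → ∀ a : ℝ, Tendsto (fun x : ℝ => a * x ^ e) (𝓝[>] 0) (𝓝 0) :=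
    fun {e} he a => by
      have : ContinuousAt (fun x : ℝ => a * x ^ e) 0 :=
        continuousAt_const.mul (Real.continuousAt_rpow_const _ _ (Or.inr he.le))
      simpa [ContinuousAt, Real.zero_rpow he.ne'] using this.mono_left nhdsWithin_le_nhds
  have dpow : ∀ (a e x : ℝ), 0 < x → HasDerivAt (fun s : ℝ => a * s ^ e) (a * e * x ^ (e - 1)) x :=
    fun a e x hx => ((Real.hasDerivAt_rpow_const (Or.inl hx.ne')).const_mul a).congr_deriv (by ring)
  have := ThinFilm.comparison (a := 0) (X := 1) (ρ := 0)
    (W := fun x => H 0 μ x - c * x ^ ν) (G := fun x => G 0 μ x - c * ν * x ^ (ν - 1))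
    (R := fun x => Q 0 μ x - c * ν * (ν - 1) * x ^ (ν - 1 - 1))
    (S := fun x => μ / 3 * cutCube K (H 0 μ x))
    (r := fun x => (x - 1) * cutMob n ν c x₀ x (H 0 μ x) -
      c * ν * (ν - 1) * (ν - 1 - 1) * x ^ (ν - 1 - 1 - 1))
    (fun x hx => (tr.dH x hx).sub (dpow _ _ x hx.1))
    (fun x hx => ((tr.dG x hx).sub (dpow _ _ x hx.1)).congr_deriv (by ring))
    (fun x hx => (tr.dQ x hx).sub (dpow _ _ x hx.1))
    (fun x hx hW => by
      have h1 : cutMob n ν c x₀ x (H 0 μ x) ≤ c * A * x ^ (ν - 3) := by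
        have h2 : 0 < c * x ^ ν := mul_pos hc (Real.rpow_pos_of_pos hx.1 _)
        have h3 : (c * x ^ ν) ^ (1 - n) = c * A * x ^ (ν - 3) := by
          rw [Real.mul_rpow hc.le (Real.rpow_nonneg hx.1.le _), ← Real.rpow_mul hx.1.le,
            sub_eq_add_neg 1 n, Real.rpow_add hc, Real.rpow_one, S.c_rpow, mul_add, mul_one,
            mul_neg, S.exps.nu_mul, ← sub_eq_add_neg]
        rw [← h3]
        exact Real.rpow_le_rpow_of_nonpos h2 ((sub_pos.1 hW).le.trans (le_max_left _ _))
          (by linarith [S.exps.one_lt_n])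
      -- The third derivative of `c x ^ ν` is `-(c x ^ ν) ^ (1 - n)`.
      have h4 : c * ν * (ν - 1) * (ν - 1 - 1) * x ^ (ν - 1 - 1 - 1) = -(c * A * x ^ (ν - 3)) := by
        rw [S.exps.A_eq, show ν - 1 - 1 - 1 = ν - 3 by ring]
        ring
      rw [h4]
      have h5 := cutMob_pos (n := n) (ν := ν) hc T.x₀_pos hx.1 (H 0 μ x)
      nlinarith [hx.1, hx.2, mul_nonneg hx.1.le h5.le])
    (fun x hx _ => mul_nonneg (by positivity) (cutCube_nonneg _ _))
    (by
      have e := (S.tendsto_height 0 μ).sub (zero (by linarith : 0 < ν) c)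
      rw [sub_zero] at e
      refine e.congr' ?_
      filter_upwards [e1] with x e1
      rw [e1.1])
    (by
      have e := (S.tendsto_slope 0 μ).sub (zero (by linarith : 0 < ν - 1) (c * ν))
      rw [sub_zero] at e
      refine e.congr' ?_
      filter_upwards [e1] with x e1
      rw [e1.2.1])
    (by
      refine (S.tendsto_flux 0 μ).congr' ?_
      filter_upwards [e1] with x e1
      rw [e1.2.2, show ν - 1 - 1 = ν - 2 by ring]
      ring)
    le_rfl
    (by
      filter_upwards [e1, S.eventually_par_mem 0 μ, self_mem_nhdsWithin] with x e1 e2 hx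
      have hx : 0 < x := hx
      rw [e1.1, along]
      have h1 : 0 < u (par ν β 0 μ x) := by
        rw [par, zero_mul] at e2 ⊢
        exact S.fam.u_pos _ _ e2 hx (mul_nonneg hμ (Real.rpow_nonneg hx.le _))
      have h2 : 0 < c * x ^ ν := mul_pos hc (Real.rpow_pos_of_pos hx _)
      nlinarith)
  have h1 := (this.1 1 ⟨one_pos, le_rfl⟩).2.1
  simp only [Real.one_rpow, mul_one] at h1
  have : 0 < c * ν := by positivity
  linarith

lemma abs_potential_sub_le (T : Shooting n ν β ς A c r κ C ε u v w m x₀ K H G Q) {μ : ℝ}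
    (hμ : 0 ≤ μ) (s t : ℝ) : |μ / 3 * cutCube K s - μ / 3 * cutCube K t| ≤
      μ / 3 * (3 * K ^ 2) * |s - t| := by
  rw [← mul_sub, abs_mul, abs_of_nonneg (by positivity : 0 ≤ μ / 3), mul_assoc (μ / 3)]
  exact mul_le_mul_of_nonneg_left (abs_cutCube_sub_le T.K_pos.le s t) (by positivity)

lemma neg_of_nonpos (T : Shooting n ν β ς A c r κ C ε u v w m x₀ K H G Q) {p : ℝ × ℝ}
    (hp : p ∈ shootDomain β ε m x₀) {x : ℝ} (hx₀ : x₀ < x) (hx : x < 1) (hG : G p.1 p.2 x ≤ 0) :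
    G p.1 p.2 1 < 0 := by
  have hμ : 0 ≤ p.2 := hp.2.1
  refine (T.traj p hp).neg_of_nonpos
    (fun y hy => cutMob_pos T.data.c_pos T.x₀_pos hy.1 _)
    (fun s t h => mul_le_mul_of_nonneg_left (cutCube_mono K h) (by positivity))
    (T.abs_potential_sub_le hμ) T.x₀_pos hx₀ hx ?_ hG
  rw [(T.near p hp x₀ le_rfl).2.1]
  exact T.data.slope_pos T.x₀_pos (T.mem_ball hp T.x₀_pos.le le_rfl)

/-- With the largest admissible parameter the film is forced down: compared with the local solution
of parameter `b = 0`, its flux at `x₀` is smaller by at least `c x₀ ^ (ν - 2) κ ε`, which pushes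
its slope below `0` before `δ₀`. -/
lemma slope_max_neg (T : Shooting n ν β ς A c r κ C ε u v w m x₀ K H G Q) {μ δ₀ : ℝ}
    (hμ : μ ∈ Icc 0 m) (hx₀δ : 2 * x₀ ≤ δ₀) (hδε : δ₀ ≤ ε ^ 2) (hmδ : m * δ₀ ^ (2 * ν + 2) ≤ ε ^ 2)
    (hbig : 2 * ν * c * δ₀ ^ (ν - 1) < δ₀ / 2 * (c * x₀ ^ (ν - 2) * (κ * ε))) :
    G (ε / x₀ ^ β) μ 1 < 0 := by
  have S := T.data
  have hc := S.c_pos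
  have hx₀ := T.x₀_pos
  have hδ0 : 0 < δ₀ := by linarith
  have hδ1 : δ₀ < 1 := by
    have h2 := S.ε_pos
    have h3 := S.ε_lt_one
    nlinarith
  have hx₀β := Real.rpow_pos_of_pos hx₀ β
  set b := ε / x₀ ^ β with hb
  have hb0 : 0 < b := div_pos S.ε_pos hx₀β
  have hB : (b, μ) ∈ shootDomain β ε m x₀ := ⟨⟨hb0.le, le_rfl⟩, hμ⟩
  have h0 : (0, μ) ∈ shootDomain β ε m x₀ := ⟨⟨le_rfl, hb0.le⟩, hμ⟩
  have hδb : par ν β 0 μ δ₀ ∈ box ε := by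
    have h5 := Real.rpow_pos_of_pos hδ0 (2 * ν + 2)
    refine ⟨⟨hδ0.le, hδε⟩, ⟨by simp [par], by simp [par, S.ε_pos.le]⟩,
      ⟨mul_nonneg hμ.1 h5.le, (mul_le_mul_of_nonneg_right hμ.2 h5.le).trans hmδ⟩⟩
  have hball : ∀ x ∈ Ioc 0 δ₀, par ν β 0 μ x ∈ Metric.ball (0 : ℝ × ℝ × ℝ) r := fun x hx =>
    S.mem_ball_of_mem_box (S.par_mem_box le_rfl hμ.1 hδb hx.1.le hx.2)
  have loc := S.isTraj_along hball
  have tr := (T.traj _ hB).mono hδ1.le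
  have e2 := T.eventually_near hB
  have hcmp := loc.comparison tr hδ1.le
    (fun x hx hlt => by
      have h1 := (S.height_bounds hx.1 (hball x hx)).1
      have h2 : min x x₀ ^ ν ≤ x ^ ν :=
        Real.rpow_le_rpow (le_min hx.1.le hx₀.le) (min_le_left _ _) (by linarith [S.exps.one_lt])
      have h3 : 0 < c / 2 * min x x₀ ^ ν :=
        mul_pos (half_pos hc) (Real.rpow_pos_of_pos (lt_min hx.1 hx₀) _)
      exact Real.rpow_le_rpow_of_nonpos (h3.trans_le (le_max_right _ _))
        (max_le hlt.le ((mul_le_mul_of_nonneg_left h2 (half_pos hc).le).trans h1))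
        (by linarith [S.exps.one_lt_n]))
    (fun x hx hlt => mul_le_mul_of_nonneg_left ((cutCube_mono K hlt.le).trans
      (cutCube_le_cube (S.height_pos hx.1 (hball x hx)).le)) (by linarith [hμ.1]))
    (by
      have e := (S.tendsto_height 0 μ).sub (S.tendsto_height b μ)
      rw [sub_zero] at e
      refine e.congr' ?_
      filter_upwards [e2] with x e2
      rw [e2.1])
    (by
      have e := (S.tendsto_slope 0 μ).sub (S.tendsto_slope b μ)
      rw [sub_zero] at e
      refine e.congr' ?_
      filter_upwards [e2] with x e2
      rw [e2.2.1])
    (by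
      refine (S.tendsto_flux_sub 0 b μ μ).congr' ?_
      filter_upwards [e2] with x e2
      rw [e2.2.2])
    (by
      filter_upwards [e2, S.eventually_height_lt μ hb0] with x e2 e3
      rwa [e2.1])
  obtain ⟨hord, hmono⟩ := hcmp
  set D := c * x₀ ^ (ν - 2) * (κ * ε) with hD
  have hx₀m : x₀ ∈ Ioc 0 δ₀ := ⟨hx₀, by linarith⟩
  have hflux : D ≤ along ν β c (ν - 2) w 0 μ x₀ - Q b μ x₀ := by
    rw [(T.near _ hB x₀ le_rfl).2.2, along, along, ← mul_sub]
    refine mul_le_mul_of_nonneg_left ?_ (mul_pos hc (Real.rpow_pos_of_pos hx₀ _)).le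
    have h1 := S.fam.w_anti x₀ (0 * x₀ ^ β) (b * x₀ ^ β) (μ * x₀ ^ (2 * ν + 2))
      (T.mem_ball h0 hx₀.le le_rfl) (T.mem_ball hB hx₀.le le_rfl)
      (mul_le_mul_of_nonneg_right hb0.le hx₀β.le)
    have h2 : b * x₀ ^ β - 0 * x₀ ^ β = ε := by
      rw [zero_mul, sub_zero, hb, div_mul_cancel₀ _ hx₀β.ne']
    rwa [h2] at h1
  have hslope : D * (δ₀ - x₀) ≤ (along ν β c (ν - 1) v 0 μ δ₀ - G b μ δ₀) -
      (along ν β c (ν - 1) v 0 μ x₀ - G b μ x₀) := by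
    have hsub : ∀ x ∈ Icc x₀ δ₀, x ∈ Ioc 0 δ₀ := fun x hx => ⟨hx₀.trans_le hx.1, hx.2⟩
    have hd : ∀ x ∈ Icc x₀ δ₀, HasDerivAt (fun x => along ν β c (ν - 1) v 0 μ x - G b μ x) _ x :=
      fun x hx => (loc.dG x (hsub x hx)).sub (tr.dG x (hsub x hx))
    refine Convex.mul_sub_le_image_sub_of_le_deriv (convex_Icc x₀ δ₀)
      (fun x hx => (hd x hx).continuousAt.continuousWithinAt) ?_ ?_ x₀ ⟨le_rfl, hx₀m.2⟩ δ₀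
      ⟨hx₀m.2, le_rfl⟩ hx₀m.2
    · rw [interior_Icc]
      exact fun x hx => (hd x (Ioo_subset_Icc_self hx)).differentiableAt.differentiableWithinAt
    · rw [interior_Icc]
      intro x hx
      have hx' := hsub x (Ioo_subset_Icc_self hx)
      rw [(hd x (Ioo_subset_Icc_self hx)).deriv]
      have h1 := hmono hx₀m hx' hx.1.le
      simp only at h1
      have h2 : μ / 3 * cutCube K (H b μ x) ≤
          grav μ (along ν β c ν (fun p => 1 + u p) 0 μ x) :=
        mul_le_mul_of_nonneg_left ((cutCube_mono K (hord x hx').1.le).trans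
          (cutCube_le_cube (S.height_pos hx'.1 (hball x hx')).le)) (by linarith [hμ.1])
      linarith
  have hκ : 0 < D := mul_pos (mul_pos hc (Real.rpow_pos_of_pos hx₀ _))
    (mul_pos S.fam.κ_pos S.ε_pos)
  have h1 := (hord x₀ hx₀m).2.1
  have h2 := S.slope_along_le hδ0 (hball δ₀ ⟨hδ0, le_rfl⟩)
  have h3 : δ₀ / 2 * D ≤ D * (δ₀ - x₀) := by nlinarith
  exact T.neg_of_nonpos hB (by linarith : x₀ < δ₀) hδ1 (by simp only; linarith)

/-- When the final slope vanishes all truncations are inactive: the film is increasing, so it stays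
above the cut-off of the mobility, and its slope is bounded, so it stays below `K`. -/
theorem isFilm (T : Shooting n ν β ς A c r κ C ε u v w m x₀ K H G Q)
    (hK : 3 / 2 * c + 2 * ν * c + (c / 2 * x₀ ^ ν) ^ (1 - n) ≤ K) {b μ : ℝ}
    (hp : (b, μ) ∈ shootDomain β ε m x₀) (hb : 0 < b) (hG : G b μ 1 = 0) :
    IsFilm n ν β c u v w b μ (H b μ) (G b μ) (Q b μ) ∧ ∀ x ∈ Ioc (0 : ℝ) 1, H b μ x ≤ K := by
  have S := T.data
  have hc := S.c_pos
  have hx₀ := T.x₀_pos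
  have hx1 := T.x₀_lt_one
  have hν := S.exps.one_lt
  have hn := S.exps.one_lt_n
  have hμ : 0 ≤ μ := hp.2.1
  have tr := T.traj _ hp
  have hball : ∀ x ∈ Ioc 0 x₀, par ν β b μ x ∈ Metric.ball (0 : ℝ × ℝ × ℝ) r := fun x hx =>
    T.mem_ball hp hx.1.le hx.2
  have hGpos : ∀ x ∈ Ioc (0 : ℝ) 1, 0 ≤ G b μ x := fun x hx => by
    rcases le_or_gt x x₀ with h | h
    · rw [(T.near _ hp x h).2.1]
      exact (S.slope_pos hx.1 (hball x ⟨hx.1, h⟩)).le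
    · rcases hx.2.eq_or_lt with rfl | h1
      · exact hG.ge
      · by_contra hneg
        exact absurd hG (T.neg_of_nonpos hp h h1 (not_le.1 hneg).le).ne
  have hsub : ∀ x ∈ Icc x₀ 1, x ∈ Ioc (0 : ℝ) 1 := fun x hx => ⟨hx₀.trans_le hx.1, hx.2⟩
  have hHc : ContinuousOn (H b μ) (Icc x₀ 1) := fun x hx =>
    (tr.dH x (hsub x hx)).continuousAt.continuousWithinAt
  have hHd : DifferentiableOn ℝ (H b μ) (interior (Icc x₀ 1)) := by
    rw [interior_Icc]
    exact fun x hx =>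
      (tr.dH x (hsub x (Ioo_subset_Icc_self hx))).differentiableAt.differentiableWithinAt
  have hHx₀ := S.height_bounds hx₀ (hball x₀ ⟨hx₀, le_rfl⟩)
  rw [← (T.near _ hp x₀ le_rfl).1] at hHx₀
  have hHlow : ∀ x ∈ Icc x₀ 1, c / 2 * x₀ ^ ν ≤ H b μ x := fun x hx => by
    refine hHx₀.1.trans (monotoneOn_of_deriv_nonneg (convex_Icc x₀ 1) hHc hHd (fun y hy => ?_)
      ⟨le_rfl, hx1.le⟩ hx hx.1)
    rw [interior_Icc] at hy
    have hy' := hsub y (Ioo_subset_Icc_self hy)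
    rw [(tr.dH y hy').deriv]
    exact hGpos y hy'
  have hδ : 0 < c / 2 * x₀ ^ ν := mul_pos (half_pos hc) (Real.rpow_pos_of_pos hx₀ _)
  have hδn := Real.rpow_pos_of_pos hδ (1 - n)
  have hmin : ∀ x ∈ Ioc (0 : ℝ) 1, c / 2 * min x x₀ ^ ν ≤ H b μ x := fun x hx => by
    rcases le_or_gt x x₀ with h | h
    · rw [min_eq_left h, (T.near _ hp x h).1]
      exact (S.height_bounds hx.1 (hball x ⟨hx.1, h⟩)).1
    · rw [min_eq_right h.le]
      exact hHlow x ⟨h.le, hx.2⟩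
  have hpos : ∀ x ∈ Ioc (0 : ℝ) 1, 0 < H b μ x := fun x hx =>
    (mul_pos (half_pos hc) (Real.rpow_pos_of_pos (lt_min hx.1 hx₀) _)).trans_le (hmin x hx)
  have hx₀ν : x₀ ^ ν ≤ 1 := Real.rpow_le_one hx₀.le hx1.le (by linarith)
  have hx₀ν' : x₀ ^ (ν - 1) ≤ 1 := Real.rpow_le_one hx₀.le hx1.le (by linarith)
  have hGle : ∀ x ∈ Icc x₀ 1, G b μ x ≤ 2 * ν * c + (c / 2 * x₀ ^ ν) ^ (1 - n) := fun x hx => by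
    have h1 := tr.slope_le
      (fun s t h => mul_le_mul_of_nonneg_left (cutCube_mono K h) (by positivity))
      hx₀ (C := (c / 2 * x₀ ^ ν) ^ (1 - n)) (fun y hy =>
        ⟨(cutMob_pos hc hx₀ (hsub y hy).1 _).le, by
          rw [cutMob, min_eq_right hy.1]
          exact rpow_max_le hδ hn _⟩) (fun y hy => hGpos y (hsub y hy)) hG hx
    have h2 := S.slope_along_le hx₀ (hball x₀ ⟨hx₀, le_rfl⟩)
    rw [← (T.near _ hp x₀ le_rfl).2.1] at h2
    have h3 : 2 * ν * c * x₀ ^ (ν - 1) ≤ 2 * ν * c * 1 :=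
      mul_le_mul_of_nonneg_left hx₀ν' (by positivity)
    simp only at h2
    linarith
  have hHK : ∀ x ∈ Ioc (0 : ℝ) 1, H b μ x ≤ K := fun x hx => by
    rcases le_or_gt x x₀ with h | h
    · rw [(T.near _ hp x h).1]
      refine (S.height_bounds hx.1 (hball x ⟨hx.1, h⟩)).2.trans (le_trans ?_ T.le_K)
      have : x ^ ν ≤ 1 := Real.rpow_le_one hx.1.le hx.2 (by linarith)
      nlinarith
    · have h1 := Convex.image_sub_le_mul_sub_of_deriv_le (convex_Icc x₀ 1) hHc hHd
        (C := 2 * ν * c + (c / 2 * x₀ ^ ν) ^ (1 - n)) (fun y hy => by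
          rw [interior_Icc] at hy
          rw [(tr.dH y (hsub y (Ioo_subset_Icc_self hy))).deriv]
          exact hGle y (Ioo_subset_Icc_self hy)) x₀ ⟨le_rfl, hx1.le⟩ x ⟨h.le, hx.2⟩ h.le
      have h2 : (2 * ν * c + (c / 2 * x₀ ^ ν) ^ (1 - n)) * (x - x₀) ≤
          (2 * ν * c + (c / 2 * x₀ ^ ν) ^ (1 - n)) * 1 :=
        mul_le_mul_of_nonneg_left (by linarith [hx.2]) (by positivity)
      have h3 := hHx₀.2
      simp only at h3
      nlinarith
  refine ⟨⟨hb, ⟨tr.dH, fun x hx => ?_, fun x hx => ?_⟩, hpos, hGpos, hG, ?_,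
    T.eventually_near hp⟩, hHK⟩
  · have := tr.dG x hx
    simp only at this
    rwa [cutCube_of_mem ⟨(hpos x hx).le, hHK x hx⟩] at this
  · have := tr.dQ x hx
    rwa [cutMob_of_le (hmin x hx)] at this
  · have := (T.near _ hp 0 hx₀.le).1
    simp only at this
    rw [this, along, Real.zero_rpow (by linarith)]
    ring

end Shooting

/-! ### Films for a bounded range of the gravity parameter -/

/-- The zero of a function that is strictly decreasing in its first argument depends continuously on
the second one. -/
lemma continuousOn_of_strictAnti_zero {g : ℝ × ℝ → ℝ} {B : ℝ} {J : Set ℝ} {b : ℝ → ℝ}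
    (hg : ContinuousOn g (Icc 0 B ×ˢ J)) (hb : ∀ μ ∈ J, b μ ∈ Ioo 0 B)
    (h0 : ∀ μ ∈ J, g (b μ, μ) = 0)
    (hanti : ∀ μ ∈ J, ∀ a ∈ Icc 0 B, ∀ a' ∈ Icc 0 B, a < a' → g (a', μ) < g (a, μ)) :
    ContinuousOn b J := by
  intro μ₀ hμ₀
  have hslice : ∀ a ∈ Icc 0 B, ContinuousWithinAt (fun μ => g (a, μ)) J μ₀ := fun a ha =>
    (hg (a, μ₀) ⟨ha, hμ₀⟩).comp (continuousWithinAt_const.prodMk continuousWithinAt_id)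
      fun μ hμ => ⟨ha, hμ⟩
  have hI : ∀ μ ∈ J, b μ ∈ Icc 0 B := fun μ hμ => Ioo_subset_Icc_self (hb μ hμ)
  refine tendsto_order.2 ⟨fun a ha => ?_, fun a ha => ?_⟩
  · have hmem : max a 0 ∈ Icc 0 B :=
      ⟨le_max_right _ _, (max_lt ha (hb μ₀ hμ₀).1).le.trans (hI μ₀ hμ₀).2⟩
    have h1 : 0 < g (max a 0, μ₀) := by
      have := hanti μ₀ hμ₀ _ hmem _ (hI μ₀ hμ₀) (max_lt ha (hb μ₀ hμ₀).1)
      rwa [h0 μ₀ hμ₀] at this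
    filter_upwards [(hslice _ hmem).eventually_const_lt h1, self_mem_nhdsWithin] with μ h2 hμ
    refine (le_max_left a 0).trans_lt (lt_of_not_ge fun h3 => ?_)
    rcases h3.eq_or_lt with h4 | h4
    · rw [← h4, h0 μ hμ] at h2
      exact lt_irrefl _ h2
    · have := hanti μ hμ _ (hI μ hμ) _ hmem h4
      rw [h0 μ hμ] at this
      linarith
  · have hmem : min a B ∈ Icc 0 B :=
      ⟨(hI μ₀ hμ₀).1.trans (lt_min ha (hb μ₀ hμ₀).2).le, min_le_right _ _⟩
    have h1 : g (min a B, μ₀) < 0 := by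
      have := hanti μ₀ hμ₀ _ (hI μ₀ hμ₀) _ hmem (lt_min ha (hb μ₀ hμ₀).2)
      rwa [h0 μ₀ hμ₀] at this
    filter_upwards [(hslice _ hmem).eventually_lt_const h1, self_mem_nhdsWithin] with μ h2 hμ
    refine (lt_of_not_ge fun h3 => ?_ : b μ < min a B).trans_le (min_le_left a B)
    rcases h3.eq_or_lt with h4 | h4
    · rw [h4, h0 μ hμ] at h2
      exact lt_irrefl _ h2
    · have := hanti μ hμ _ hmem _ (hI μ hμ) h4
      rw [h0 μ hμ] at this
      linarith

namespace ContactData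

variable {n ν β ς A c r κ C ε : ℝ} {u v w : ℝ × ℝ × ℝ → ℝ}

/-- Since `ν < 2`, the flux at the contact line is singular, and shooting from close enough to it
gives access to arbitrarily negative slopes. -/
lemma exists_start (S : ContactData n ν β ς A c r κ C ε u v w) (m : ℝ) :
    ∃ x₀ δ₀ : ℝ, 0 < x₀ ∧ 2 * x₀ ≤ δ₀ ∧ δ₀ ≤ ε ^ 2 ∧ m * δ₀ ^ (2 * ν + 2) ≤ ε ^ 2 ∧
      2 * ν * c * δ₀ ^ (ν - 1) < δ₀ / 2 * (c * x₀ ^ (ν - 2) * (κ * ε)) := by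
  have hc := S.c_pos
  have hε := S.ε_pos
  have hκ := S.fam.κ_pos
  have hν : 0 < 2 * ν + 2 := by linarith [S.exps.one_lt]
  have h1 : Tendsto (fun x : ℝ => m * x ^ (2 * ν + 2)) (𝓝[>] 0) (𝓝 0) := by
    have : ContinuousAt (fun x : ℝ => m * x ^ (2 * ν + 2)) 0 :=
      continuousAt_const.mul (Real.continuousAt_rpow_const _ _ (Or.inr hν.le))
    simpa [ContinuousAt, Real.zero_rpow hν.ne'] using this.mono_left nhdsWithin_le_nhds
  -- First `δ₀` is fixed, and then `x₀` is taken small in terms of `δ₀`.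
  obtain ⟨δ₀, hδ, hδ₀, hδε⟩ := ((h1.eventually_lt_const (by positivity : 0 < ε ^ 2)).and
    (Ioc_mem_nhdsGT (by positivity : 0 < ε ^ 2))).exists
  have h2 := (tendsto_rpow_neg_nhdsGT_zero
    (by linarith [S.exps.lt_two] : ν - 2 < 0)).eventually_gt_atTop
    (2 * ν * c * δ₀ ^ (ν - 1) / (δ₀ / 2 * (c * (κ * ε))))
  obtain ⟨x₀, hx, hx₀, hxδ⟩ := (h2.and (Ioc_mem_nhdsGT (half_pos hδ₀))).exists
  refine ⟨x₀, δ₀, hx₀, by linarith, hδε, hδ.le, ?_⟩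
  rw [div_lt_iff₀ (by positivity)] at hx
  linarith

lemma continuousOn_film (S : ContactData n ν β ς A c r κ C ε u v w) {b μ : ℝ} {H G Q : ℝ → ℝ}
    (h : IsFilm n ν β c u v w b μ H G Q) : ContinuousOn H (Icc 0 1) := by
  intro x hx
  rcases hx.1.eq_or_lt with rfl | hx0
  · have h1 : Tendsto H (𝓝[>] 0) (𝓝 (H 0)) := by
      rw [h.zero]
      refine (S.tendsto_height b μ).congr' ?_
      filter_upwards [h.near] with x e
      rw [e.1]
    exact (continuousWithinAt_Ioi_iff_Ici.1 h1).mono Icc_subset_Ici_self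
  · exact (h.traj.dH x ⟨hx0, hx.2⟩).continuousAt.continuousWithinAt

/-- Films exist for all `μ` in a bounded range. They are uniformly bounded there, and their mass
depends continuously on `μ`. -/
theorem exists_films (S : ContactData n ν β ς A c r κ C ε u v w) {m : ℝ} (hm : 0 ≤ m) :
    ∃ (K : ℝ) (b : ℝ → ℝ) (H G Q : ℝ → ℝ → ℝ),
      (∀ μ ∈ Icc 0 m, IsFilm n ν β c u v w (b μ) μ (H μ) (G μ) (Q μ) ∧
        ∀ x ∈ Ioc (0 : ℝ) 1, H μ x ≤ K) ∧
      ContinuousOn (fun μ => ∫ x in (0 : ℝ)..1, H μ x) (Icc 0 m) := by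
  have hc := S.c_pos
  have hν := S.exps.one_lt
  obtain ⟨x₀, δ₀, hx₀, hxδ, hδε, hmδ, hbig⟩ := S.exists_start m
  have hx₀ε : x₀ ≤ ε ^ 2 := by linarith
  have hmx : m * x₀ ^ (2 * ν + 2) ≤ ε ^ 2 := le_trans
    (mul_le_mul_of_nonneg_left (Real.rpow_le_rpow hx₀.le (by linarith) (by linarith)) hm) hmδ
  set K := 3 / 2 * c + 2 * ν * c + (c / 2 * x₀ ^ ν) ^ (1 - n) with hK
  have hδn : 0 ≤ (c / 2 * x₀ ^ ν) ^ (1 - n) := Real.rpow_nonneg (by positivity) _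
  have hνc : 0 ≤ 2 * ν * c := by positivity
  obtain ⟨H, G, Q, T⟩ := S.exists_shooting hm hx₀ hx₀ε hmx (by linarith : 3 / 2 * c ≤ K)
  have hB0 : 0 < ε / x₀ ^ β := div_pos S.ε_pos (Real.rpow_pos_of_pos hx₀ β)
  have hex : ∀ μ : ℝ, ∃ b : ℝ, μ ∈ Icc 0 m → b ∈ Ioo 0 (ε / x₀ ^ β) ∧ G b μ 1 = 0 := by
    intro μ
    by_cases hμ : μ ∈ Icc 0 m
    · have hcont : ContinuousOn (fun b => G b μ 1) (Icc 0 (ε / x₀ ^ β)) :=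
        T.continuousOn_G.comp (f := fun b => (b, μ))
          (continuousOn_id.prodMk continuousOn_const) fun b hb => ⟨hb, hμ⟩
      obtain ⟨b, hb, hb0⟩ := intermediate_value_Ioo' hB0.le hcont
        ⟨T.slope_max_neg hμ hxδ hδε hmδ hbig, T.slope_zero_pos ⟨⟨le_rfl, hB0.le⟩, hμ⟩⟩
      exact ⟨b, fun _ => ⟨hb, hb0⟩⟩
    · exact ⟨0, fun h => absurd h hμ⟩
  choose b hb using hex
  have hbD : ∀ μ ∈ Icc 0 m, (b μ, μ) ∈ shootDomain β ε m x₀ := fun μ hμ =>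
    ⟨Ioo_subset_Icc_self (hb μ hμ).1, hμ⟩
  have hbc : ContinuousOn b (Icc 0 m) :=
    continuousOn_of_strictAnti_zero (g := fun p => G p.1 p.2 1) T.continuousOn_G
      (fun μ hμ => (hb μ hμ).1) (fun μ hμ => (hb μ hμ).2)
      fun μ hμ a ha a' ha' hlt => T.slope_strictAnti ⟨ha, hμ⟩ ⟨ha', hμ⟩ hlt
  have hfilm : ∀ μ ∈ Icc 0 m, IsFilm n ν β c u v w (b μ) μ (H (b μ) μ) (G (b μ) μ) (Q (b μ) μ) ∧
      ∀ x ∈ Ioc (0 : ℝ) 1, H (b μ) μ x ≤ K := fun μ hμ =>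
    T.isFilm le_rfl (hbD μ hμ) (hb μ hμ).1.1 (hb μ hμ).2
  refine ⟨K, b, fun μ => H (b μ) μ, fun μ => G (b μ) μ, fun μ => Q (b μ) μ, hfilm,
    fun μ₀ hμ₀ => ?_⟩
  refine intervalIntegral.continuousWithinAt_of_dominated_interval (bound := fun _ => K) ?_ ?_
    intervalIntegrable_const ?_
  · filter_upwards [self_mem_nhdsWithin] with μ hμ
    rw [uIoc_of_le zero_le_one]
    exact ((S.continuousOn_film (hfilm μ hμ).1).mono
      Ioc_subset_Icc_self).aestronglyMeasurable measurableSet_Ioc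
  · filter_upwards [self_mem_nhdsWithin] with μ hμ
    refine Eventually.of_forall fun x hx => ?_
    rw [uIoc_of_le zero_le_one] at hx
    rw [Real.norm_of_nonneg ((hfilm μ hμ).1.pos x hx).le]
    exact (hfilm μ hμ).2 x hx
  · refine Eventually.of_forall fun x hx => ?_
    rw [uIoc_of_le zero_le_one] at hx
    exact (T.continuousOn_H x hx).comp (hbc.prodMk continuousOn_id) hbD μ₀ hμ₀

end ContactData

/-! ### The mass for small and large gravity parameter -/

lemma mul_sub_le_of_hasDerivAt {f f' : ℝ → ℝ} {a b d : ℝ} (hab : a ≤ b)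
    (hf : ∀ x ∈ Icc a b, HasDerivAt f (f' x) x) (hd : ∀ x ∈ Ioo a b, d ≤ f' x) :
    d * (b - a) ≤ f b - f a := by
  refine Convex.mul_sub_le_image_sub_of_le_deriv (convex_Icc a b)
    (fun x hx => (hf x hx).continuousAt.continuousWithinAt) ?_ ?_ a ⟨le_rfl, hab⟩ b
    ⟨hab, le_rfl⟩ hab
  · rw [interior_Icc]
    exact fun x hx => (hf x (Ioo_subset_Icc_self hx)).differentiableAt.differentiableWithinAt
  · rw [interior_Icc]
    intro x hx
    rw [(hf x (Ioo_subset_Icc_self hx)).deriv]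
    exact hd x hx

namespace IsFilm

variable {n ν β c b μ : ℝ} {u v w : ℝ × ℝ × ℝ → ℝ} {H G Q : ℝ → ℝ}

lemma monotone (h : IsFilm n ν β c u v w b μ H G Q) {x y : ℝ} (hx : 0 < x) (hxy : x ≤ y)
    (hy : y ≤ 1) : H x ≤ H y := by
  have := mul_sub_le_of_hasDerivAt (d := 0) hxy
    (fun z hz => h.traj.dH z ⟨hx.trans_le hz.1, hz.2.trans hy⟩)
    (fun z hz => h.slope_nonneg z ⟨hx.trans hz.1, hz.2.le.trans hy⟩)
  linarith

/-- A film that is thin on `[0, 1/2]` has a mobility so large that its flux varies by a large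
amount, which contradicts thinness: if the flux is positive on `[0, 1/4]` the film has risen too
much there, and otherwise it is strongly concave on `[1/4, 1/2]`, so too steep before `1/2`. -/
theorem lt_half_height (h : IsFilm n ν β c u v w b μ H G Q) (hn : 1 < n) (hμ : 0 ≤ μ) {η a : ℝ}
    (hη : 0 < η) (hψ : μ / 3 * η ^ 3 ≤ a * η) (hbig : 4096 + 16 * a < η ^ (-n)) :
    η < H (1 / 2) := by
  by_contra hle
  rw [not_lt] at hle
  have ha : 0 ≤ a := by
    by_contra hneg
    have : 0 ≤ μ / 3 * η ^ 3 := by positivity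
    nlinarith
  set D := η ^ (1 - n) / 2 with hD
  have hDη : η ^ (1 - n) = η * η ^ (-n) := by
    rw [sub_eq_add_neg, Real.rpow_add hη, Real.rpow_one]
  have hD0 : 0 < η ^ (1 - n) := Real.rpow_pos_of_pos hη _
  have hDbig : (2048 + 8 * a) * η < D := by
    rw [hD, hDη]
    nlinarith
  have hI : ∀ x ∈ Ioc (0 : ℝ) (1 / 2), x ∈ Ioc (0 : ℝ) 1 := fun x hx =>
    ⟨hx.1, by linarith [hx.2]⟩
  have hHη : ∀ x ∈ Ioc (0 : ℝ) (1 / 2), H x ≤ η := fun x hx =>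
    (h.monotone hx.1 hx.2 (by norm_num)).trans hle
  -- On `(0, 1/2]` the flux decreases at a rate of at least `D`, as `x - 1 ≤ -1/2` there.
  have hQ : ∀ x y, 0 < x → x ≤ y → y ≤ 1 / 2 → D * (y - x) ≤ Q x - Q y := by
    intro x y hx hxy hy
    have := mul_sub_le_of_hasDerivAt (f := fun z => -Q z) (d := D) hxy
      (fun z hz => (h.traj.dQ z ⟨hx.trans_le hz.1, by linarith [hz.2]⟩).neg)
      (fun z hz => by
        have hz' : z ∈ Ioc (0 : ℝ) (1 / 2) := ⟨hx.trans hz.1, hz.2.le.trans hy⟩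
        have h1 : η ^ (1 - n) ≤ mob n z (H z) :=
          Real.rpow_le_rpow_of_nonpos (h.pos z (hI z hz')) (hHη z hz') (by linarith)
        have h2 := hz'.2
        nlinarith)
    linarith
  have hgrav0 : ∀ x ∈ Ioc (0 : ℝ) (1 / 2), 0 ≤ grav μ (H x) := fun x hx =>
    mul_nonneg (by positivity) (pow_nonneg (h.pos x (hI x hx)).le 3)
  have hgrav : ∀ x ∈ Ioc (0 : ℝ) (1 / 2), grav μ (H x) ≤ a * η := fun x hx =>
    (mul_le_mul_of_nonneg_left (pow_le_pow_left₀ (h.pos x (hI x hx)).le (hHη x hx) 3)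
      (by positivity)).trans hψ
  have dG : ∀ x y, 0 < x → y ≤ 1 / 2 → ∀ z ∈ Icc x y, HasDerivAt G (Q z + grav μ (H z)) z :=
    fun x y hx hy z hz => h.traj.dG z ⟨hx.trans_le hz.1, by linarith [hz.2]⟩
  have dH : ∀ x y, 0 < x → y ≤ 1 / 2 → ∀ z ∈ Icc x y, HasDerivAt H (G z) z :=
    fun x y hx hy z hz => h.traj.dH z ⟨hx.trans_le hz.1, by linarith [hz.2]⟩
  have hD1 : 0 < D := by positivity
  have haη : 0 ≤ a * η := by positivity
  rcases le_or_gt 0 (Q (1 / 4)) with hQ4 | hQ4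
  · have h1 : D / 8 * (1 / 8 - 1 / 16) ≤ G (1 / 8) - G (1 / 16) :=
      mul_sub_le_of_hasDerivAt (by norm_num) (dG _ _ (by norm_num) (by norm_num)) fun z hz => by
        have hz' : z ∈ Ioc (0 : ℝ) (1 / 2) := ⟨by linarith [hz.1], by linarith [hz.2]⟩
        have := hQ z (1 / 4) hz'.1 (by linarith [hz.2]) (by norm_num)
        have := hgrav0 z hz'
        have := hz.2
        nlinarith
    have h2 := h.slope_nonneg (1 / 16) ⟨by norm_num, by norm_num⟩
    have h3 : D / 128 * (1 / 4 - 1 / 8) ≤ H (1 / 4) - H (1 / 8) :=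
      mul_sub_le_of_hasDerivAt (by norm_num) (dH _ _ (by norm_num) (by norm_num)) fun z hz => by
        have h4 : 0 * (z - 1 / 8) ≤ G z - G (1 / 8) :=
          mul_sub_le_of_hasDerivAt hz.1.le (dG _ _ (by norm_num) (by linarith [hz.2]))
            fun y hy => by
            have hy' : y ∈ Ioc (0 : ℝ) (1 / 2) :=
              ⟨by linarith [hy.1], by linarith [hy.2, hz.2]⟩
            have := hQ y (1 / 4) hy'.1 (by linarith [hy.2, hz.2]) (by norm_num)
            have := hgrav0 y hy'
            have := hy.2.trans hz.2
            nlinarith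
        linarith
    have h5 := h.pos (1 / 8) ⟨by norm_num, by norm_num⟩
    have h6 := hHη (1 / 4) ⟨by norm_num, by norm_num⟩
    nlinarith
  · have h1 : (D / 8 - a * η) / 16 * (7 / 16 - 3 / 8) ≤ H (7 / 16) - H (3 / 8) :=
      mul_sub_le_of_hasDerivAt (by norm_num) (dH _ _ (by norm_num) (by norm_num)) fun z hz => by
        have h4 : (D / 8 - a * η) * (1 / 2 - z) ≤ -G (1 / 2) - -G z :=
          mul_sub_le_of_hasDerivAt (f := fun y => -G y) (by linarith [hz.2])
            (fun y hy => (dG z (1 / 2) (by linarith [hz.1]) le_rfl y hy).neg) fun y hy => by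
            have hy' : y ∈ Ioc (0 : ℝ) (1 / 2) := ⟨by linarith [hy.1, hz.1], hy.2.le⟩
            have := hQ (1 / 4) y (by norm_num) (by linarith [hy.1, hz.1]) hy'.2
            have := hgrav y hy'
            have := hz.1.trans hy.1
            nlinarith
        have h5 := h.slope_nonneg (1 / 2) ⟨by norm_num, by norm_num⟩
        have h6 : (D / 8 - a * η) / 16 ≤ (D / 8 - a * η) * (1 / 2 - z) := by
          have := hz.2
          nlinarith
        linarith
    have h5 := h.pos (3 / 8) ⟨by norm_num, by norm_num⟩
    have h6 := hHη (7 / 16) ⟨by norm_num, by norm_num⟩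
    nlinarith

end IsFilm

namespace ContactData

variable {n ν β ς A c r κ C ε : ℝ} {u v w : ℝ × ℝ × ℝ → ℝ}

lemma intervalIntegrable_film (S : ContactData n ν β ς A c r κ C ε u v w) {b μ : ℝ}
    {H G Q : ℝ → ℝ} (h : IsFilm n ν β c u v w b μ H G Q) {x y : ℝ} (hx : x ∈ Icc (0 : ℝ) 1)
    (hy : y ∈ Icc (0 : ℝ) 1) : IntervalIntegrable H MeasureTheory.volume x y :=
  ((S.continuousOn_film h).mono (uIcc_subset_Icc hx hy)).intervalIntegrable

lemma exists_small_mass (S : ContactData n ν β ς A c r κ C ε u v w) {k : ℝ} (hk : 0 < k) :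
    ∃ μ, 0 < μ ∧ μ ≤ 1 ∧ ∀ b H G Q, IsFilm n ν β c u v w b μ H G Q →
      √μ * ∫ x in (0 : ℝ)..1, H x < k := by
  obtain ⟨K, b, H, G, Q, hfilm, -⟩ := S.exists_films zero_le_one
  have h1 : Tendsto (fun μ : ℝ => √μ * K) (𝓝[>] 0) (𝓝 0) := by
    have : ContinuousAt (fun μ : ℝ => √μ * K) 0 :=
      Real.continuous_sqrt.continuousAt.mul continuousAt_const
    simpa [ContinuousAt] using this.mono_left nhdsWithin_le_nhds
  obtain ⟨μ, hμ, hμ0, hμ1⟩ := ((h1.eventually_lt_const hk).and (Ioc_mem_nhdsGT one_pos)).exists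
  refine ⟨μ, hμ0, hμ1, fun b' H' G' Q' h' => lt_of_le_of_lt ?_ hμ⟩
  refine mul_le_mul_of_nonneg_left ?_ (Real.sqrt_nonneg _)
  obtain ⟨h, hK⟩ := hfilm μ ⟨hμ0.le, hμ1⟩
  have h01 : (0 : ℝ) ∈ Icc (0 : ℝ) 1 := ⟨le_rfl, zero_le_one⟩
  have h11 : (1 : ℝ) ∈ Icc (0 : ℝ) 1 := ⟨zero_le_one, le_rfl⟩
  have h2 := intervalIntegral.integral_mono_on_of_le_Ioo zero_le_one
    (S.intervalIntegrable_film h' h01 h11) (intervalIntegrable_const (c := K)) fun x hx => by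
      rw [(S.film_unique hμ0.le h' h).2 x (Ioo_subset_Icc_self hx)]
      exact hK x (Ioo_subset_Ioc_self hx)
  simpa using h2

lemma exists_large_mass (S : ContactData n ν β ς A c r κ C ε u v w) {k : ℝ} (hk : 0 < k) :
    ∃ μ, 1 ≤ μ ∧ ∀ b H G Q, IsFilm n ν β c u v w b μ H G Q →
      k < √μ * ∫ x in (0 : ℝ)..1, H x := by
  have hn := S.exps.one_lt_n
  obtain ⟨η, hη, hη0, hηk⟩ := (((tendsto_rpow_neg_nhdsGT_zero
    (by linarith : -n < 0)).eventually_gt_atTop (4096 + 16 * (4 * k ^ 2 / 3))).and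
    (Ioc_mem_nhdsGT (by linarith : 0 < 2 * k))).exists
  have h1 : 1 ≤ 2 * k / η := (one_le_div hη0).2 hηk
  -- With `√μ η = 2 k` the potential at height `η` is `(4 k ^ 2 / 3) η`, and a film with
  -- `H(1/2) > η` has mass more than `η / 2 = k / √μ`.
  refine ⟨(2 * k / η) ^ 2, one_le_pow₀ h1, fun b H G Q h => ?_⟩
  rw [Real.sqrt_sq (by positivity)]
  have h2 := h.lt_half_height hn (by positivity) hη0 (a := 4 * k ^ 2 / 3)
    (le_of_eq (by field_simp; ring)) hη
  have h01 : (0 : ℝ) ∈ Icc (0 : ℝ) 1 := ⟨le_rfl, zero_le_one⟩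
  have h11 : (1 : ℝ) ∈ Icc (0 : ℝ) 1 := ⟨zero_le_one, le_rfl⟩
  have hh1 : (1 / 2 : ℝ) ∈ Icc (0 : ℝ) 1 := ⟨by norm_num, by norm_num⟩
  have h3 : 0 ≤ ∫ x in (0 : ℝ)..(1 / 2), H x :=
    intervalIntegral.integral_nonneg (by norm_num) fun x hx => by
      rcases hx.1.eq_or_lt with rfl | h0
      · exact h.zero.ge
      · exact (h.pos x ⟨h0, by linarith [hx.2]⟩).le
  have h4 : ∫ _ in (1 / 2 : ℝ)..1, H (1 / 2) ≤ ∫ x in (1 / 2 : ℝ)..1, H x :=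
    intervalIntegral.integral_mono_on (by norm_num) intervalIntegrable_const
      (S.intervalIntegrable_film h hh1 h11) fun x hx => h.monotone (by norm_num) hx.1 hx.2
  rw [intervalIntegral.integral_const, smul_eq_mul] at h4
  have h5 := intervalIntegral.integral_add_adjacent_intervals
    (S.intervalIntegrable_film h h01 hh1) (S.intervalIntegrable_film h hh1 h11)
  have h6 : η / 2 < ∫ x in (0 : ℝ)..1, H x := by linarith
  calc k = 2 * k / η * (η / 2) := by field_simp
    _ < _ := mul_lt_mul_of_pos_left h6 (by positivity)

/-- Every rescaled mass is attained. -/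
theorem exists_mass_eq (S : ContactData n ν β ς A c r κ C ε u v w) {k : ℝ} (hk : 0 < k) :
    ∃ μ, 0 < μ ∧ ∀ b H G Q, IsFilm n ν β c u v w b μ H G Q →
      √μ * ∫ x in (0 : ℝ)..1, H x = k := by
  obtain ⟨μ₁, h1, h1', hlow⟩ := S.exists_small_mass hk
  obtain ⟨μ₂, h2, hup⟩ := S.exists_large_mass hk
  obtain ⟨K, b, H, G, Q, hfilm, hcont⟩ := S.exists_films (zero_le_one.trans h2)
  have h12 : μ₁ ≤ μ₂ := h1'.trans h2
  obtain ⟨μ, hμ, hμk⟩ := intermediate_value_Icc h12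
    ((Real.continuous_sqrt.continuousOn.mul hcont).mono (Icc_subset_Icc_left h1.le))
    ⟨(hlow _ _ _ _ (hfilm μ₁ ⟨h1.le, h12⟩).1).le,
      (hup _ _ _ _ (hfilm μ₂ ⟨h1.le.trans h12, le_rfl⟩).1).le⟩
  have hμ0 : 0 < μ := h1.trans_le hμ.1
  refine ⟨μ, hμ0, fun b' H' G' Q' h' => ?_⟩
  have heq : ∫ x in (0 : ℝ)..1, H' x = ∫ x in (0 : ℝ)..1, H μ x :=
    intervalIntegral.integral_congr fun x hx => by
      rw [uIcc_of_le zero_le_one] at hx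
      exact (S.film_unique hμ0.le h' (hfilm μ ⟨hμ0.le, hμ.2⟩).1).2 x hx
  rw [heq]
  exact hμk

end ContactData

/-! ### Classical regularity of films -/

lemma contDiffOn_succ_of_hasDerivAt {f f' : ℝ → ℝ} {s : Set ℝ} (hs : UniqueDiffOn ℝ s) {k : ℕ}
    (hf : ∀ x ∈ s, HasDerivAt f (f' x) x) (hf' : ContDiffOn ℝ k f' s) :
    ContDiffOn ℝ (k + 1) f s :=
  (contDiffOn_succ_iff_derivWithin hs).2
    ⟨fun x hx => (hf x hx).differentiableAt.differentiableWithinAt, fun h => by simp at h,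
      hf'.congr fun x hx => (hf x hx).hasDerivWithinAt.derivWithin (hs x hx)⟩

lemma iteratedDerivWithin_succ_of_hasDerivAt {f f' : ℝ → ℝ} {s : Set ℝ} (hs : UniqueDiffOn ℝ s)
    {k : ℕ} (hf : ∀ x ∈ s, HasDerivAt f (f' x) x) :
    EqOn (iteratedDerivWithin (k + 1) f s) (iteratedDerivWithin k f' s) s := by
  rw [iteratedDerivWithin_succ']
  exact iteratedDerivWithin_congr fun x hx => (hf x hx).hasDerivWithinAt.derivWithin (hs x hx)

namespace ContactData

variable {n ν β ς A c r κ C ε : ℝ} {u v w : ℝ × ℝ × ℝ → ℝ}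

/-- The slope of a film tends to `0` at the contact line, so the film has derivative `0` there. -/
lemma hasDerivWithinAt_film_zero (S : ContactData n ν β ς A c r κ C ε u v w) {b μ : ℝ}
    {H G Q : ℝ → ℝ} (h : IsFilm n ν β c u v w b μ H G Q) :
    Tendsto G (𝓝[>] 0) (𝓝 0) ∧ HasDerivWithinAt H 0 (Icc 0 1) 0 := by
  have hG : Tendsto G (𝓝[>] 0) (𝓝 0) := by
    refine (S.tendsto_slope b μ).congr' ?_
    filter_upwards [h.near] with x e
    rw [e.2.1]
  refine ⟨hG, (hasDerivWithinAt_Ici_of_tendsto_deriv (s := Ioc 0 1)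
    (fun x hx => (h.traj.dH x hx).differentiableAt.differentiableWithinAt)
    ((S.continuousOn_film h 0 ⟨le_rfl, zero_le_one⟩).mono Ioc_subset_Icc_self)
    (Ioc_mem_nhdsGT one_pos) (hG.congr' ?_)).mono Icc_subset_Ici_self⟩
  filter_upwards [Ioc_mem_nhdsGT one_pos] with x hx
  rw [(h.traj.dH x hx).deriv]

theorem isProfile_of_isFilm (S : ContactData n ν β ς A c r κ C ε u v w) {b μ : ℝ}
    {H G Q : ℝ → ℝ} (h : IsFilm n ν β c u v w b μ H G Q) : IsProfile n μ H := by
  obtain ⟨hG0, hd0⟩ := S.hasDerivWithinAt_film_zero h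
  have hu : UniqueDiffOn ℝ (Icc (0 : ℝ) 1) := uniqueDiffOn_Icc one_pos
  have hu' : UniqueDiffOn ℝ (Ioc (0 : ℝ) 1) := uniqueDiffOn_Ioc 0 1
  have hdW : ∀ x ∈ Ioc (0 : ℝ) 1, derivWithin H (Icc 0 1) x = G x := fun x hx =>
    (h.traj.dH x hx).hasDerivWithinAt.derivWithin (hu x (Ioc_subset_Icc_self hx))
  have hdW0 : derivWithin H (Icc 0 1) 0 = 0 := hd0.derivWithin (hu 0 ⟨le_rfl, zero_le_one⟩)
  have dQ : ∀ x ∈ Ioc (0 : ℝ) 1, HasDerivAt (fun x => Q x + grav μ (H x))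
      ((x - 1) * H x ^ (1 - n) + μ * H x ^ 2 * G x) x := fun x hx =>
    ((h.traj.dQ x hx).add (((h.traj.dH x hx).pow 3).const_mul (μ / 3))).congr_deriv (by
      simp only [mob, Nat.cast_ofNat]
      ring)
  have hcH : ContinuousOn H (Ioc 0 1) := fun x hx =>
    (h.traj.dH x hx).continuousAt.continuousWithinAt
  have hcG : ContinuousOn G (Ioc 0 1) := fun x hx =>
    (h.traj.dG x hx).continuousAt.continuousWithinAt
  have hc3 : ContinuousOn (fun x => (x - 1) * H x ^ (1 - n) + μ * H x ^ 2 * G x) (Ioc 0 1) :=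
    ((continuousOn_id.sub continuousOn_const).mul
      (hcH.rpow_const fun x hx => Or.inl (h.pos x hx).ne')).add
      ((continuousOn_const.mul (hcH.pow 2)).mul hcG)
  refine ⟨?_, ?_, h.pos, fun x hx => ?_, h.zero, hdW0, ?_⟩
  · refine (contDiffOn_one_iff_derivWithin hu).2 ⟨fun x hx => ?_, fun x hx => ?_⟩
    · rcases hx.1.eq_or_lt with rfl | hx0
      · exact hd0.differentiableWithinAt
      · exact (h.traj.dH x ⟨hx0, hx.2⟩).differentiableAt.differentiableWithinAt
    · rcases hx.1.eq_or_lt with rfl | hx0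
      · have h1 : Tendsto (derivWithin H (Icc 0 1)) (𝓝[>] 0) (𝓝 (derivWithin H (Icc 0 1) 0)) := by
          rw [hdW0]
          refine hG0.congr' ?_
          filter_upwards [Ioc_mem_nhdsGT one_pos] with x hx
          rw [hdW x hx]
        exact (continuousWithinAt_Ioi_iff_Ici.1 h1).mono Icc_subset_Ici_self
      · have h1 : ContinuousWithinAt G (Icc 0 1) x :=
          (h.traj.dG x ⟨hx0, hx.2⟩).continuousAt.continuousWithinAt
        refine h1.congr_of_eventuallyEq ?_ (hdW x ⟨hx0, hx.2⟩)
        filter_upwards [self_mem_nhdsWithin, mem_nhdsWithin_of_mem_nhds (Ioi_mem_nhds hx0)]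
          with y hy hy0 using hdW y ⟨hy0, hy.2⟩
  · have h1 := contDiffOn_succ_of_hasDerivAt (k := 0) hu' dQ (by simpa using hc3)
    have h2 := contDiffOn_succ_of_hasDerivAt (k := 1) hu' h.traj.dG (by simpa using h1)
    have h3 := contDiffOn_succ_of_hasDerivAt (k := 2) hu' h.traj.dH (by exact_mod_cast h2)
    exact_mod_cast h3
  · have h1 : iteratedDerivWithin 3 H (Ioc 0 1) x =
        (x - 1) * H x ^ (1 - n) + μ * H x ^ 2 * G x := by
      rw [iteratedDerivWithin_succ_of_hasDerivAt (k := 2) hu' h.traj.dH hx,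
        iteratedDerivWithin_succ_of_hasDerivAt (k := 1) hu' h.traj.dG hx,
        iteratedDerivWithin_succ_of_hasDerivAt (k := 0) hu' dQ hx, iteratedDerivWithin_zero]
    have hp := h.pos x hx
    have h2 : H x ^ (n - 1) * H x ^ (1 - n) = 1 := by
      rw [← Real.rpow_add hp, sub_add_sub_cancel, sub_self, Real.rpow_zero]
    have h3 : H x ^ (n - 1) * H x ^ 2 = H x ^ (n + 1) := by
      rw [← Real.rpow_natCast, ← Real.rpow_add hp]
      congr 1
      push_cast
      ring
    rw [h1, hdW x hx, ← h3]
    linear_combination (x - 1) * h2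
  · rw [hdW 1 ⟨one_pos, le_rfl⟩, h.flat]

end ContactData

/-! ### The exponents of the travelling wave -/

/-- The exponent `ν + β` is a root of `t ^ 2 + (ν - 4) t + (3 - ν) (2 - ν)`, which is the quotient
of `t (t - 1) (t - 2) - (n - 1) A` by `t - (ν - 1)`. -/
lemma waveExponents {n : ℝ} (hn₁ : 3 / 2 < n) (hn₂ : n < 3) :
    WaveExponents n (nu n) (beta n) (min (2 * beta n) 1) (coeffA n) := by
  have hn : 0 < n := by linarith
  have h1 : 1 < nu n := by
    rw [nu, lt_div_iff₀ hn]
    linarith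
  have h2 : nu n < 2 := by
    rw [nu, div_lt_iff₀ hn]
    linarith
  have h3 : nu n * n = 3 := div_mul_cancel₀ _ hn.ne'
  have hA : coeffA n = nu n * (nu n - 1) * (2 - nu n) := rfl
  have hb : beta n = (√(-3 * nu n ^ 2 + 12 * nu n - 8) - 3 * nu n + 4) / 2 := rfl
  set ν := nu n
  set s := √(-3 * ν ^ 2 + 12 * ν - 8)
  have hpos : 0 < (ν - 1) * (2 - ν) := mul_pos (by linarith) (by linarith)
  have hs : s ^ 2 = -3 * ν ^ 2 + 12 * ν - 8 := Real.sq_sqrt (by nlinarith)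
  have hs0 : 0 ≤ s := Real.sqrt_nonneg _
  have hs1 : 3 * ν - 4 < s := by
    by_contra h
    nlinarith
  have hs2 : s < 3 * ν - 2 := by
    by_contra h
    nlinarith
  have hs3 : ν < s := by
    by_contra h
    nlinarith
  have hβ0 : 0 < beta n := by linarith
  have hβ1 : beta n < 1 := by linarith
  refine ⟨h1, h2, h3, hA, hβ0, lt_min (by linarith) hβ1, min_le_right _ _, min_le_left _ _,
    by linarith, ?_⟩
  rw [hA, hb]
  linear_combination (s - 3 * ν + 6) / 8 * hs - (ν - 1) * (2 - ν) * h3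

lemma le_of_le_rpow_div {a b β x : ℝ} (ha : 0 ≤ a) (hb : 0 < b) (hβ : 0 < β) (hx : 0 ≤ x)
    (h : x ≤ (a / b) ^ (1 / β)) : b * x ^ β ≤ a := by
  have h1 := Real.rpow_le_rpow hx h hβ.le
  rw [← Real.rpow_mul (div_nonneg ha hb.le), one_div_mul_cancel hβ.ne', Real.rpow_one,
    le_div_iff₀ hb] at h1
  linarith

end

end ThinFilm


theorem theorem1 (n : ℝ) (hn₁ : 3 / 2 < n) (hn₂ : n < 3) :
    ∃ (ε : ℝ) (u : ℝ × ℝ × ℝ → ℝ) (b : ℝ → ℝ) (H : ℝ → ℝ → ℝ),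
      0 < ε ∧ ε < 1 ∧
      AnalyticOnNhd ℝ u (ThinFilm.box ε) ∧
      u (0, 0, 0) = 0 ∧
      deriv (fun y : ℝ => u (0, y, 0)) 0 < 0 ∧
      (∀ μ : ℝ, 0 < μ →
        0 < b μ ∧
        ThinFilm.IsProfile n μ (H μ) ∧
        ∀ x : ℝ, 0 ≤ x →
          x ≤ min (ε ^ 2) (min ((ε / b μ) ^ (1 / ThinFilm.beta n))
            ((ε ^ 2 / μ) ^ (1 / ThinFilm.gamma n))) →
          H μ x = ThinFilm.coeffA n ^ (-(ThinFilm.nu n / 3)) * x ^ ThinFilm.nu n *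
            (1 + u (x, b μ * x ^ ThinFilm.beta n, μ * x ^ ThinFilm.gamma n))) ∧
      (∀ M : ℝ, 0 < M →
        ∃ μ' : ℝ, 0 < μ' ∧
          ∫ x in (0 : ℝ)..1, H μ' x = ThinFilm.kappa n M μ' / 2) := by
  have E := ThinFilm.waveExponents hn₁ hn₂
  have hA := E.A_pos
  have hc : 0 < ThinFilm.coeffA n ^ (-(ThinFilm.nu n / 3)) := Real.rpow_pos_of_pos hA _
  have hcA : (ThinFilm.coeffA n ^ (-(ThinFilm.nu n / 3))) ^ (-n) = ThinFilm.coeffA n := by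
    rw [← Real.rpow_mul hA.le, show -(ThinFilm.nu n / 3) * -n = ThinFilm.nu n * n / 3 by ring,
      E.nu_mul, div_self (by norm_num), Real.rpow_one]
  obtain ⟨r, κ, C, u, v, w, F⟩ := E.exists_localFamily hc hcA
  have hr := F.r_pos
  have S : ThinFilm.ContactData n _ _ _ _ _ r κ C (min (r / 2) (1 / 2)) u v w :=
    ⟨E, F, hc, hcA, lt_min (by linarith) (by norm_num),
      (min_le_right _ _).trans_lt (by norm_num), (min_le_left _ _).trans_lt (by linarith)⟩
  set ε := min (r / 2) (1 / 2)
  have hex : ∀ μ : ℝ, ∃ (b : ℝ) (H G Q : ℝ → ℝ), 0 < μ →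
      ThinFilm.IsFilm n (ThinFilm.nu n) (ThinFilm.beta n)
        (ThinFilm.coeffA n ^ (-(ThinFilm.nu n / 3))) u v w b μ H G Q := by
    intro μ
    by_cases hμ : 0 < μ
    · obtain ⟨K, b, H, G, Q, h, -⟩ := S.exists_films hμ.le
      exact ⟨b μ, H μ, G μ, Q μ, fun _ => (h μ ⟨hμ.le, le_rfl⟩).1⟩
    · exact ⟨0, 0, 0, 0, fun h => absurd h hμ⟩
  choose b H G Q hfilm using hex
  have hγ : ThinFilm.gamma n = 2 * ThinFilm.nu n + 2 := by
    rw [ThinFilm.gamma]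
    ring
  refine ⟨ε, u, b, H, S.ε_pos, S.ε_lt_one,
    F.analyticOnNhd_u.mono fun p hp => S.mem_ball_of_mem_box hp, F.u_zero, F.deriv_u,
    fun μ hμ => ⟨(hfilm μ hμ).b_pos, S.isProfile_of_isFilm (hfilm μ hμ), fun x hx hxle => ?_⟩,
    fun M hM => ?_⟩
  · obtain ⟨h1, h2⟩ := le_min_iff.1 hxle
    obtain ⟨h2, h3⟩ := le_min_iff.1 h2
    rw [hγ] at h3 ⊢
    have hb := (hfilm μ hμ).b_pos
    exact S.film_eq_along hμ.le (hfilm μ hμ) hx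
      ⟨⟨hx, h1⟩, ⟨mul_nonneg hb.le (Real.rpow_nonneg hx _),
        ThinFilm.le_of_le_rpow_div S.ε_pos.le hb E.beta_pos hx h2⟩,
        ⟨mul_nonneg hμ.le (Real.rpow_nonneg hx _),
        ThinFilm.le_of_le_rpow_div (sq_nonneg _) hμ (by linarith [E.one_lt]) hx h3⟩⟩
  · have hk : 0 < √(n + 3) * M / 2 := by
      have : 0 < √(n + 3) := Real.sqrt_pos.2 (by linarith)
      positivity
    obtain ⟨μ, hμ, h⟩ := S.exists_mass_eq hk
    refine ⟨μ, hμ, ?_⟩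
    have h1 := h _ _ _ _ (hfilm μ hμ)
    have h2 : 0 < √μ := Real.sqrt_pos.2 hμ
    rw [ThinFilm.kappa, div_mul_eq_mul_div, div_right_comm, eq_div_iff h2.ne', mul_comm, h1]
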